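/- Let $\sigma>0$, let $u_0\in C((0,1))$ take values in $[0,1]$, and let $v_-,v_+\in[0,1]$. Let $U=C^{2,1}((0,1)\times(0,\infty))$ be the set of functions $u(r,t)$ for which $u,u_r,u_{rr},u_t$ exist and are continuous on $(0,1)\times(0,\infty)$, and let $H=C^1((0,\infty))\cap C([0,\infty))$. Then there is exactly one triple $(u,\rho_-,\rho_+)\in U\times H\times H$ such that $u$ is bounded, $\rho_\pm(0)=v_\pm$, the boundary values $u(0,t)=\lim_{r\downarrow0}u(r,t)$ and $u(1,t)=\lim_{r\uparrow1}u(r,t)$ exist for every $t>0$, take values in $[0,1]$ and are continuous in $t\in(0,\infty)$, and \begin{align*} &u_t(r,t)=\tfrac12u_{rr}(r,t)\quad (0<r<1,\ t>0),\qquad \lim_{t\downarrow0}u(r,t)=u_0(r)\quad (0<r<1),\\ &\rho_-'(t)=\sigma^{-1}\bigl[u(0,t)-\rho_-(t)\bigr],\qquad \rho_+'(t)=\sigma^{-1}\bigl[u(1,t)-\rho_+(t)\bigr]\quad (t>0),\\ &\rho_-(t)=\rho_-(0)+\lim_{l\downarrow0}\,\lim_{t_0\downarrow0}\int_{t_0}^t\tfrac12u_r(l,s)\,ds\quad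 (t>0),\\ &\rho_+(t)=\rho_+(0)-\lim_{l\uparrow1}\,\lim_{t_0\downarrow0}\int_{t_0}^t\tfrac12u_r(l,s)\,ds\quad (t>0), \end{align*} where the existence of the iterated limits is part of the requirement. -/

import Mathlib

open Set Filter Topology

/-- The class `U = C^{2,1}((0,1) × (0,∞))`: functions `u r t` for which `u`, `u_r`, `u_rr` and
`u_t` exist and are (jointly) continuous on the open strip `(0,1) × (0,∞)`.
Nothing is required of `u` outside the open strip. -/
structure IsC21 (u : ℝ → ℝ → ℝ) : Prop where
  continuousOn : ContinuousOn (fun p : ℝ × ℝ => u p.1 p.2) (Ioo 0 1 ×ˢ Ioi 0)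
  differentiableAt_r : ∀ r ∈ Ioo (0 : ℝ) 1, ∀ t ∈ Ioi (0 : ℝ),
    DifferentiableAt ℝ (fun x => u x t) r
  differentiableAt_rr : ∀ r ∈ Ioo (0 : ℝ) 1, ∀ t ∈ Ioi (0 : ℝ),
    DifferentiableAt ℝ (fun y => deriv (fun x => u x t) y) r
  differentiableAt_t : ∀ r ∈ Ioo (0 : ℝ) 1, ∀ t ∈ Ioi (0 : ℝ),
    DifferentiableAt ℝ (fun s => u r s) t
  continuousOn_r : ContinuousOn (fun p : ℝ × ℝ => deriv (fun x => u x p.2) p.1)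
    (Ioo 0 1 ×ˢ Ioi 0)
  continuousOn_rr : ContinuousOn
    (fun p : ℝ × ℝ => deriv (fun y => deriv (fun x => u x p.2) y) p.1) (Ioo 0 1 ×ˢ Ioi 0)
  continuousOn_t : ContinuousOn (fun p : ℝ × ℝ => deriv (fun s => u p.1 s) p.2)
    (Ioo 0 1 ×ˢ Ioi 0)

/-- The class `H = C¹(0,∞) ∩ C([0,∞))`. -/
def IsClassH (ρ : ℝ → ℝ) : Prop :=
  ContDiffOn ℝ 1 ρ (Ioi 0) ∧ ContinuousOn ρ (Ici 0)

/-- `HasWeakFlux u F t L` says that the iterated limit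
`lim_{l → F} lim_{t₀ ↓ 0} ∫_{t₀}^t ½ u_r(l,s) ds` exists and equals `L`: the inner limit exists
for all `l` close to the end of the filter `F`, and these inner limits converge to `L`. -/
def HasWeakFlux (u : ℝ → ℝ → ℝ) (F : Filter ℝ) (t L : ℝ) : Prop :=
  ∃ J : ℝ → ℝ,
    (∀ᶠ l in F, Tendsto (fun t₀ : ℝ => ∫ s in t₀..t, (1 / 2 : ℝ) * deriv (fun x => u x s) l)
      (𝓝[>] 0) (𝓝 (J l))) ∧
    Tendsto J F (𝓝 L)

/-- `(u, ρm, ρp)` is a bounded solution in `U × H × H` of the coupled system with parameter `σ`,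
initial datum `u₀` on `(0,1)` and initial reservoir values `vm` (left) and `vp` (right).
The values `u 0 t` and `u 1 t` are the boundary values of `u`, i.e. the limits of `u r t`
as `r ↓ 0` and as `r ↑ 1`, for each `t > 0`. -/
structure IsSolution (σ : ℝ) (u₀ : ℝ → ℝ) (vm vp : ℝ)
    (u : ℝ → ℝ → ℝ) (ρm ρp : ℝ → ℝ) : Prop where
  mem_U : IsC21 u
  mem_H_left : IsClassH ρm
  mem_H_right : IsClassH ρp
  bounded : ∃ C : ℝ, ∀ r ∈ Ioo (0 : ℝ) 1, ∀ t ∈ Ioi (0 : ℝ), |u r t| ≤ C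
  boundary_left : ∀ t ∈ Ioi (0 : ℝ), Tendsto (fun r => u r t) (𝓝[>] 0) (𝓝 (u 0 t))
  boundary_right : ∀ t ∈ Ioi (0 : ℝ), Tendsto (fun r => u r t) (𝓝[<] 1) (𝓝 (u 1 t))
  boundary_left_mem : ∀ t ∈ Ici (0 : ℝ), u 0 t ∈ Icc (0 : ℝ) 1
  boundary_right_mem : ∀ t ∈ Ici (0 : ℝ), u 1 t ∈ Icc (0 : ℝ) 1
  boundary_left_cont : ContinuousOn (fun t => u 0 t) (Ioi 0)
  boundary_right_cont : ContinuousOn (fun t => u 1 t) (Ioi 0)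
  heat : ∀ r ∈ Ioo (0 : ℝ) 1, ∀ t ∈ Ioi (0 : ℝ),
    deriv (fun s => u r s) t = (1 / 2 : ℝ) * deriv (fun y => deriv (fun x => u x t) y) r
  initial : ∀ r ∈ Ioo (0 : ℝ) 1, Tendsto (fun t => u r t) (𝓝[>] 0) (𝓝 (u₀ r))
  reservoir_left_zero : ρm 0 = vm
  reservoir_right_zero : ρp 0 = vp
  ode_left : ∀ t ∈ Ioi (0 : ℝ), HasDerivAt ρm (σ⁻¹ * (u 0 t - ρm t)) t
  ode_right : ∀ t ∈ Ioi (0 : ℝ), HasDerivAt ρp (σ⁻¹ * (u 1 t - ρp t)) t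
  flux_left : ∀ t ∈ Ioi (0 : ℝ), ∃ L : ℝ, HasWeakFlux u (𝓝[>] 0) t L ∧ ρm t = ρm 0 + L
  flux_right : ∀ t ∈ Ioi (0 : ℝ), ∃ L : ℝ, HasWeakFlux u (𝓝[<] 1) t L ∧ ρp t = ρp 0 - L

/-! Existence. The solution is sought as a heat potential on the strip (`stripPotential`): the
initial datum on (0,1) together with its mirror images in 0 and 1, plus single layers on the two
walls with unknown densities `a` and `b`. Whatever the densities are, the heat equation, the
interior regularity and the initial condition come from the kernel, because the heat kernel extended
by zero to nonpositive times is continuous off the space-time origin and its potentials can be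
differentiated under the integral. The jump relation `tendsto_layer_heatKx` says that the flux at a
wall is minus the density there plus terms that are regular at that wall. Write `gm`, `gp` for the
derivatives of the two reservoir values. Requiring that these equal the fluxes into the reservoirs
and also satisfy the relaxation law gives four linear Volterra equations of the second kind for `a`,
`b`, `gm`, `gp` (`exists_boundary_densities`). Their kernels become integrable after multiplication
by e^{-t}, so a stronger exponential weight makes the fixed point map a contraction
(`exists_volterra_solution`).

The range. The potentials come only with bounds that grow in time, so boundedness by 1 has to be
proved separately. For convex φ the sum of ∫φ(u), φ(ρm) and φ(ρp) does not increase: diffusion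
dissipates it in the interior, and each wall contributes -(φ'(u) - φ'(ρ)) σ⁻¹ (u - ρ) ≤ 0. Taking
for φ the cubed negative part gives u ≥ 0 (`IsRegularSolution.nonneg`), and the symmetry u ↦ 1 - u
gives u ≤ 1. The flux at fixed l is dominated in time by a multiple of s^{-1/2} plus a constant,
uniformly in l, which yields the iterated limits (`hasWeakFlux_of_dominated`).

Uniqueness. A general solution has its flux controlled only through iterated limits of time
integrals, so the difference d of two solutions cannot be tested against itself up to the walls. Its
time integral D can. Conservation of mass turns the weak flux conditions into D_r = 2F with F(r,t) =
δm(t) + ∫_0^r d(y,t) dy, where F is continuous on the closed interval, F(0,t) = δm(t) and F(1,t) =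
-δp(t) (`tendsto_integral_dx`, `flux_one`). The integrated relaxation law is ∫b = σδ + ∫δ at each
wall. Hence the energy ½∫D² + ½(∫δm)² + ½(∫δp)² has derivative -2∫F² - σδm² - σδp² ≤ 0 and tends to
0 as t ↓ 0, so it vanishes (`exists_hasDerivAt_energy`, `energy_nonpos`). Differentiating in time
shows that d and both δ vanish. -/

open MeasureTheory
open scoped BoundedContinuousFunction

/-! ### The heat kernel: causality, bounds and derivatives -/

/-- The function `(2π)^{-1/2} t^{-1/2-j} exp(-x²/(2t))`, which vanishes for `t ≤ 0`. -/
noncomputable def heatK (j : ℕ) (t x : ℝ) : ℝ :=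
  (√(2 * Real.pi))⁻¹ * (√t)⁻¹ * (t⁻¹) ^ j * Real.exp (-x ^ 2 / (2 * t))

/-- The spatial derivative of the heat kernel. -/
noncomputable def heatKx (t x : ℝ) : ℝ := -x * heatK 1 t x

/-- The second spatial derivative of the heat kernel. -/
noncomputable def heatKxx (t x : ℝ) : ℝ := x ^ 2 * heatK 2 t x - heatK 1 t x

/-- The conventions √t = 0 for t ≤ 0 and 0⁻¹ = 0 make the kernels causal, so that time convolutions
can be written over the whole line. -/
theorem heatK_of_nonpos (j : ℕ) {t : ℝ} (ht : t ≤ 0) (x : ℝ) : heatK j t x = 0 := by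
  simp [heatK, Real.sqrt_eq_zero_of_nonpos ht]

theorem heatK_nonneg (j : ℕ) (t x : ℝ) : 0 ≤ heatK j t x := by
  rcases le_or_gt t 0 with h | h
  · rw [heatK_of_nonpos j h]
  · unfold heatK; positivity

theorem heatK_neg (j : ℕ) (t x : ℝ) : heatK j t (-x) = heatK j t x := by
  simp [heatK]

theorem heatK_eq_mul_succ (j : ℕ) (t x : ℝ) : heatK j t x = t * heatK (j + 1) t x := by
  rcases le_or_gt t 0 with h | h
  · rw [heatK_of_nonpos j h, heatK_of_nonpos _ h, mul_zero]
  · unfold heatK; rw [inv_pow, inv_pow]; field_simp; ring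

theorem heatK_le_zero_right (j : ℕ) (t x : ℝ) : heatK j t x ≤ heatK j t 0 := by
  rcases le_or_gt t 0 with h | h
  · rw [heatK_of_nonpos j h, heatK_of_nonpos _ h]
  · unfold heatK
    gcongr ?_ * Real.exp (?_ / _)
    nlinarith [sq_nonneg x]

theorem measurable_heatK (j : ℕ) : Measurable (fun p : ℝ × ℝ => heatK j p.1 p.2) := by
  unfold heatK; fun_prop

theorem inv_sqrt_two_pi_le_one : (√(2 * Real.pi))⁻¹ ≤ 1 := by
  apply inv_le_one_of_one_le₀
  rw [Real.one_le_sqrt]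
  linarith [Real.pi_gt_three]

/-- With w = |x|/√t the product is (2π)^{-1/2} w^{2j+1} e^{-w²/2}, a function of w alone. The
constant comes from w^{2j+1} ≤ 1 + w^{2(j+1)} and from the term of order j+1 in the series of
exp(w²/2). -/
theorem exists_heatK_mul_pow_le (j : ℕ) :
    ∃ C : ℝ, 0 ≤ C ∧ ∀ t x : ℝ, heatK j t x * |x| ^ (2 * j + 1) ≤ C := by
  refine ⟨1 + 2 ^ (j + 1) * (j + 1).factorial, by positivity, fun t x => ?_⟩
  rcases le_or_gt t 0 with h | h
  · rw [heatK_of_nonpos j h]; simp; positivity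
  set w := |x| / √t with hw
  have hst : 0 < √t := Real.sqrt_pos.2 h
  have hw0 : 0 ≤ w := by positivity
  have hw2 : w ^ 2 = x ^ 2 / t := by rw [hw, div_pow, sq_abs, Real.sq_sqrt h.le]
  have e1 : heatK j t x * |x| ^ (2 * j + 1)
      = (√(2 * Real.pi))⁻¹ * (w ^ (2 * j + 1) * Real.exp (-(w ^ 2 / 2))) := by
    have : w ^ (2 * j + 1) = (√t)⁻¹ * (t⁻¹) ^ j * |x| ^ (2 * j + 1) := by
      rw [hw, div_pow, pow_succ (√t), pow_mul, Real.sq_sqrt h.le]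
      rw [inv_pow]; field_simp
    rw [this, hw2, heatK]
    have : -x ^ 2 / (2 * t) = -(x ^ 2 / t / 2) := by field_simp
    rw [this]; ring
  have e2 : w ^ (2 * j + 1) ≤ 1 + w ^ (2 * (j + 1)) := by
    rcases le_total w 1 with h1 | h1
    · have := pow_le_one₀ hw0 h1 (n := 2 * j + 1)
      have : 0 ≤ w ^ (2 * (j + 1)) := by positivity
      linarith
    · have := pow_le_pow_right₀ h1 (show 2 * j + 1 ≤ 2 * (j + 1) by omega)
      linarith
  have e3 : w ^ (2 * (j + 1)) * Real.exp (-(w ^ 2 / 2)) ≤ 2 ^ (j + 1) * (j + 1).factorial := by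
    have := Real.pow_div_factorial_le_exp (w ^ 2 / 2) (by positivity) (j + 1)
    rw [Real.exp_neg, ← div_eq_mul_inv, div_le_iff₀ (Real.exp_pos _), pow_mul]
    rw [div_le_iff₀ (by positivity), div_pow, div_le_iff₀ (by positivity)] at this
    linarith
  have e4 : Real.exp (-(w ^ 2 / 2)) ≤ 1 := Real.exp_le_one_iff.2 (by
    have : 0 ≤ w ^ 2 := by positivity
    linarith)
  have e5 : w ^ (2 * j + 1) * Real.exp (-(w ^ 2 / 2)) ≤ 1 + 2 ^ (j + 1) * (j + 1).factorial := by
    calc _ ≤ (1 + w ^ (2 * (j + 1))) * Real.exp (-(w ^ 2 / 2)) := by gcongr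
      _ = Real.exp (-(w ^ 2 / 2)) + w ^ (2 * (j + 1)) * Real.exp (-(w ^ 2 / 2)) := by ring
      _ ≤ _ := add_le_add e4 e3
  rw [e1]
  calc _ ≤ 1 * (w ^ (2 * j + 1) * Real.exp (-(w ^ 2 / 2))) := by
        gcongr
        exact inv_sqrt_two_pi_le_one
    _ ≤ _ := by rw [one_mul]; exact e5

/-- Away from `x = 0` the functions `heatK j` are bounded, uniformly in time. -/
theorem exists_heatK_le (j : ℕ) {ε : ℝ} (hε : 0 < ε) :
    ∃ C : ℝ, 0 ≤ C ∧ ∀ t x : ℝ, ε ≤ |x| → heatK j t x ≤ C := by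
  obtain ⟨C, hC, h⟩ := exists_heatK_mul_pow_le j
  refine ⟨C / ε ^ (2 * j + 1), by positivity, fun t x hx => ?_⟩
  rw [le_div_iff₀ (by positivity)]
  refine le_trans ?_ (h t x)
  have := heatK_nonneg j t x
  gcongr

/-- The only delicate points are (0,x) with x ≠ 0. There `heatK j` is t times `heatK (j+1)`, and the
latter is bounded near x uniformly in time. Potentials can therefore be continued across t = 0 away
from their carrier. -/
theorem continuousAt_heatK (j : ℕ) {p : ℝ × ℝ} (hp : p ≠ 0) :
    ContinuousAt (fun p : ℝ × ℝ => heatK j p.1 p.2) p := by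
  obtain ⟨t, x⟩ := p
  rcases lt_trichotomy t 0 with h | h | h
  · have : (fun p : ℝ × ℝ => heatK j p.1 p.2) =ᶠ[𝓝 (t, x)] fun _ => 0 := by
      filter_upwards [(continuous_fst.tendsto (t, x)).eventually (gt_mem_nhds h)] with q hq
      exact heatK_of_nonpos j hq.le _
    exact continuousAt_const.congr this.symm
  · subst h
    have hx : x ≠ 0 := fun h => hp (by simp [h])
    have hx' : 0 < |x| / 2 := by positivity
    obtain ⟨C, hC, hCb⟩ := exists_heatK_le (j + 1) hx'
    rw [ContinuousAt]
    simp only [heatK_of_nonpos j le_rfl]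
    apply squeeze_zero_norm' (a := fun q : ℝ × ℝ => |q.1| * C)
    · have : ∀ᶠ q : ℝ × ℝ in 𝓝 (0, x), |x| / 2 < |q.2| :=
        (continuous_snd.abs.tendsto (0, x)).eventually (lt_mem_nhds (by simp [abs_pos.2 hx]))
      filter_upwards [this] with q hq
      rw [heatK_eq_mul_succ, norm_mul, Real.norm_eq_abs, Real.norm_eq_abs,
        abs_of_nonneg (heatK_nonneg _ _ _)]
      gcongr
      exact hCb _ _ hq.le
    · have : Tendsto (fun q : ℝ × ℝ => |q.1| * C) (𝓝 (0, x)) (𝓝 (|(0 : ℝ)| * C)) := by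
        apply Continuous.tendsto' (by fun_prop); simp
      simpa using this
  · unfold heatK
    have h1 : √t ≠ 0 := (Real.sqrt_pos.2 h).ne'
    have h2 : 2 * t ≠ 0 := by positivity
    have h3 := h.ne'
    fun_prop (disch := assumption)

theorem hasDerivAt_heatK_right (j : ℕ) (t x : ℝ) :
    HasDerivAt (fun x => heatK j t x) (-x * heatK (j + 1) t x) x := by
  rcases le_or_gt t 0 with h | h
  · simp only [heatK_of_nonpos _ h, mul_zero]
    exact hasDerivAt_const _ _
  · unfold heatK
    have h1 : HasDerivAt (fun x : ℝ => -x ^ 2 / (2 * t)) (-(2 * x) / (2 * t)) x := by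
      simpa using ((hasDerivAt_pow 2 x).neg.div_const (2 * t))
    refine (h1.exp.const_mul ((√(2 * Real.pi))⁻¹ * (√t)⁻¹ * (t⁻¹) ^ j)).congr_deriv ?_
    rw [inv_pow, inv_pow]; field_simp; ring

theorem hasDerivAt_heatK_zero_right (t x : ℝ) :
    HasDerivAt (fun x => heatK 0 t x) (heatKx t x) x :=
  hasDerivAt_heatK_right 0 t x

theorem hasDerivAt_heatKx (t x : ℝ) : HasDerivAt (fun x => heatKx t x) (heatKxx t x) x := by
  refine ((hasDerivAt_neg x).mul (hasDerivAt_heatK_right 1 t x)).congr_deriv ?_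
  simp only [heatKxx]; ring

theorem hasDerivAt_heatK_left {t x : ℝ} (h0 : (t, x) ≠ 0) :
    HasDerivAt (fun t => heatK 0 t x) (1 / 2 * heatKxx t x) t := by
  rcases lt_trichotomy t 0 with h | h | h
  · rw [heatKxx, heatK_of_nonpos _ h.le, heatK_of_nonpos _ h.le]
    simp only [mul_zero, sub_zero]
    apply (hasDerivAt_const t (0 : ℝ)).congr_of_eventuallyEq
    filter_upwards [gt_mem_nhds h] with s hs
    exact heatK_of_nonpos _ hs.le _
  · subst h
    have hx : x ≠ 0 := fun h => h0 (by simp [h])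
    obtain ⟨C, hC, hCb⟩ := exists_heatK_le 2 (abs_pos.2 hx)
    rw [heatKxx, heatK_of_nonpos _ le_rfl, heatK_of_nonpos _ le_rfl]
    simp only [mul_zero, sub_zero]
    rw [hasDerivAt_iff_isLittleO_nhds_zero]
    simp only [zero_add, heatK_of_nonpos _ le_rfl, smul_zero, sub_zero]
    -- Two factors of t are extracted, so the kernel is O(t²) at fixed x ≠ 0 and its time derivative
    -- at 0 is 0.
    have : (fun h : ℝ => heatK 0 h x) =O[𝓝 0] fun h : ℝ => h ^ 2 := by
      apply Asymptotics.IsBigO.of_bound C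
      refine Eventually.of_forall fun s => ?_
      rw [heatK_eq_mul_succ, heatK_eq_mul_succ, ← mul_assoc, ← sq, norm_mul, mul_comm]
      gcongr
      rw [Real.norm_of_nonneg (heatK_nonneg _ _ _)]
      exact hCb _ _ le_rfl
    refine this.trans_isLittleO ?_
    exact Asymptotics.isLittleO_pow_id (by norm_num)
  · unfold heatKxx heatK
    have hs := (Real.sqrt_pos.2 h)
    have h1 : HasDerivAt (fun t : ℝ => -x ^ 2 / (2 * t)) (x ^ 2 / (2 * t ^ 2)) t := by
      have : (fun t : ℝ => -x ^ 2 / (2 * t)) = fun t => -x ^ 2 / 2 * t⁻¹ := by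
        ext s; rw [div_mul_eq_div_div, div_eq_mul_inv _ s]
      rw [this]
      refine ((hasDerivAt_inv h.ne').const_mul (-x ^ 2 / 2)).congr_deriv ?_
      field_simp
    have h2 := ((Real.hasDerivAt_sqrt h.ne').inv hs.ne').const_mul ((√(2 * Real.pi))⁻¹)
    have h3 := h2.mul h1.exp
    simp only [pow_zero, mul_one]
    refine h3.congr_deriv ?_
    simp only [Pi.inv_apply]
    rw [Real.sq_sqrt h.le]
    field_simp
    ring

theorem continuousAt_heatKx {p : ℝ × ℝ} (hp : p ≠ 0) :
    ContinuousAt (fun p : ℝ × ℝ => heatKx p.1 p.2) p :=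
  continuousAt_snd.neg.mul (continuousAt_heatK 1 hp)

theorem continuousAt_heatKxx {p : ℝ × ℝ} (hp : p ≠ 0) :
    ContinuousAt (fun p : ℝ × ℝ => heatKxx p.1 p.2) p :=
  ((continuousAt_snd.pow 2).mul (continuousAt_heatK 2 hp)).sub (continuousAt_heatK 1 hp)

theorem heatKx_of_nonpos {t : ℝ} (ht : t ≤ 0) (x : ℝ) : heatKx t x = 0 := by
  simp [heatKx, heatK_of_nonpos _ ht]

theorem heatKxx_of_nonpos {t : ℝ} (ht : t ≤ 0) (x : ℝ) : heatKxx t x = 0 := by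
  simp [heatKxx, heatK_of_nonpos _ ht]

theorem heatKx_neg (t x : ℝ) : heatKx t (-x) = -heatKx t x := by
  simp [heatKx, heatK_neg]

theorem measurable_heatKx : Measurable (fun p : ℝ × ℝ => heatKx p.1 p.2) :=
  measurable_snd.neg.mul (measurable_heatK 1)

theorem measurable_heatKxx : Measurable (fun p : ℝ × ℝ => heatKxx p.1 p.2) :=
  ((measurable_snd.pow_const 2).mul (measurable_heatK 2)).sub (measurable_heatK 1)

/-! ### Parabolic scaling and total masses -/

/-- Parabolic scaling in time. -/
theorem heatK_one_scale {x : ℝ} (hx : 0 < x) (θ : ℝ) :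
    x ^ 2 * (x * heatK 1 (x ^ 2 * θ) x) = heatK 1 θ 1 := by
  rcases le_or_gt θ 0 with h | h
  · rw [heatK_of_nonpos _ h, heatK_of_nonpos _ (by nlinarith [sq_nonneg x])]; simp
  · unfold heatK
    rw [Real.sqrt_mul (sq_nonneg x) θ, Real.sqrt_sq hx.le]
    have : -x ^ 2 / (2 * (x ^ 2 * θ)) = -1 ^ 2 / (2 * θ) := by field_simp
    rw [this]
    field_simp

/-- Parabolic scaling in space. -/
theorem heatK_space_scale (j : ℕ) {t : ℝ} (ht : 0 < t) (w : ℝ) :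
    √t * heatK j t (√t * w) = (t⁻¹) ^ j * heatK j 1 w := by
  unfold heatK
  rw [mul_pow, Real.sq_sqrt ht.le]
  have : -(t * w ^ 2) / (2 * t) = -w ^ 2 / (2 * 1) := by field_simp
  rw [this]
  have := (Real.sqrt_pos.2 ht).ne'
  field_simp
  simp

/-- Written in the form produced by the substitution x = θ^{-1/2}, which carries the first passage
density to a Gaussian on the half line. -/
theorem heatK_one_one_of_pos {θ : ℝ} (hθ : θ ∈ Ioi (0 : ℝ)) : heatK 1 θ 1 =
    (√(2 * Real.pi))⁻¹ * 2 *
      ((|(-1 / 2 : ℝ)| * θ ^ ((-1 / 2 : ℝ) - 1)) • Real.exp (-(1 / 2) * (θ ^ (-1 / 2 : ℝ)) ^ 2)) := by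
  have h0 : (0 : ℝ) < θ := hθ
  have e1 : θ ^ ((-1 / 2 : ℝ) - 1) = (√θ)⁻¹ * θ⁻¹ := by
    rw [Real.rpow_sub h0, Real.rpow_one, Real.sqrt_eq_rpow, neg_div, Real.rpow_neg h0.le]
    rfl
  have e2 : (θ ^ (-1 / 2 : ℝ)) ^ 2 = θ⁻¹ := by
    rw [neg_div, Real.rpow_neg h0.le, ← Real.sqrt_eq_rpow, inv_pow, Real.sq_sqrt h0.le]
  rw [e1, e2, heatK, abs_of_nonpos (by norm_num)]
  have : -1 ^ 2 / (2 * θ) = -(1 / 2) * θ⁻¹ := by field_simp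
  rw [this, smul_eq_mul]; ring

theorem integrable_heatK_one_one : Integrable (fun θ => heatK 1 θ 1) := by
  have h1 : IntegrableOn (fun θ => heatK 1 θ 1) (Ioi 0) := by
    have h2 : IntegrableOn (fun x : ℝ => Real.exp (-(1 / 2) * x ^ 2)) (Ioi 0) :=
      (integrable_exp_neg_mul_sq (by norm_num)).integrableOn
    rw [← integrableOn_Ioi_comp_rpow_iff _ (show (-1 / 2 : ℝ) ≠ 0 by norm_num)] at h2
    exact IntegrableOn.congr_fun (h2.const_mul ((√(2 * Real.pi))⁻¹ * 2))
      (fun θ hθ => (heatK_one_one_of_pos hθ).symm) measurableSet_Ioi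
  rw [← integrableOn_univ, ← Iic_union_Ioi (a := (0 : ℝ))]
  refine IntegrableOn.union ?_ h1
  exact (integrableOn_zero).congr_fun (fun θ hθ => (heatK_of_nonpos 1 hθ 1).symm) measurableSet_Iic

/-- The first passage density at level one has total mass one. -/
theorem integral_heatK_one_one : ∫ θ, heatK 1 θ 1 = 1 := by
  rw [← setIntegral_eq_integral_of_forall_compl_eq_zero (s := Ioi (0 : ℝ))
    (fun θ hθ => heatK_of_nonpos 1 (not_lt.1 hθ) 1),
    setIntegral_congr_fun measurableSet_Ioi (fun θ hθ => heatK_one_one_of_pos hθ),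
    integral_const_mul,
    integral_comp_rpow_Ioi (fun x => Real.exp (-(1 / 2) * x ^ 2)) (by norm_num),
    integral_gaussian_Ioi]
  have : Real.pi / (1 / 2) = 2 * Real.pi := by ring
  rw [this]
  have : √(2 * Real.pi) ≠ 0 := by positivity
  field_simp

/-- Up to a constant this is the integrand of Γ(1/2). The kernel t^{-1/2} is not integrable at
infinity, which is why the weight is carried through all the Volterra arguments. -/
theorem integrable_exp_mul_heatK_zero : Integrable (fun τ => Real.exp (-τ) * heatK 0 τ 0) := by
  have h1 : IntegrableOn (fun τ => Real.exp (-τ) * heatK 0 τ 0) (Ioi 0) := by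
    have h2 := Real.GammaIntegral_convergent (s := 1 / 2) (by norm_num)
    refine IntegrableOn.congr_fun (h2.const_mul ((√(2 * Real.pi))⁻¹)) (fun θ hθ => ?_)
      measurableSet_Ioi
    have h0 : (0 : ℝ) < θ := hθ
    have : (1 / 2 - 1 : ℝ) = -(1 / 2) := by norm_num
    simp only [this]
    rw [Real.rpow_neg h0.le, ← Real.sqrt_eq_rpow, heatK]
    simp only [pow_zero, mul_one, ne_eq, OfNat.ofNat_ne_zero, not_false_eq_true, zero_pow,
      neg_zero, zero_div, Real.exp_zero]
    ring
  rw [← integrableOn_univ, ← Iic_union_Ioi (a := (0 : ℝ))]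
  refine IntegrableOn.union ?_ h1
  exact (integrableOn_zero).congr_fun
    (fun θ hθ => by simp [heatK_of_nonpos 0 hθ 0]) measurableSet_Iic

theorem integrable_exp_mul_heatK (j : ℕ) : Integrable (fun τ => Real.exp (-τ) * heatK j τ 1) := by
  obtain ⟨C, hC, hCb⟩ := exists_heatK_le j one_pos
  have h1 : IntegrableOn (fun τ => Real.exp (-τ) * heatK j τ 1) (Ioi 0) := by
    refine Integrable.mono' ((integrableOn_exp_neg_Ioi 0).const_mul C) ?_
      (Eventually.of_forall fun τ => ?_)
    · exact (((Real.measurable_exp.comp measurable_neg).mul ((measurable_heatK j).comp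
        (measurable_id.prodMk measurable_const)))).aestronglyMeasurable
    · rw [norm_mul, Real.norm_of_nonneg (Real.exp_pos _).le,
        Real.norm_of_nonneg (heatK_nonneg _ _ _), mul_comm]
      gcongr
      exact hCb _ _ (by simp)
  rw [← integrableOn_univ, ← Iic_union_Ioi (a := (0 : ℝ))]
  refine IntegrableOn.union ?_ h1
  exact (integrableOn_zero).congr_fun
    (fun θ hθ => by simp [heatK_of_nonpos j hθ 1]) measurableSet_Iic

theorem heatK_time_one (j : ℕ) (w : ℝ) :
    heatK j 1 w = (√(2 * Real.pi))⁻¹ * Real.exp (-(1 / 2) * w ^ 2) := by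
  simp only [heatK, Real.sqrt_one, inv_one, one_pow, mul_one]
  congr 2; ring

theorem integrable_heatK_time_one : Integrable (fun w => heatK 0 1 w) := by
  simp only [heatK_time_one]
  exact (integrable_exp_neg_mul_sq (by norm_num)).const_mul _

theorem integral_heatK_time_one : ∫ w, heatK 0 1 w = 1 := by
  simp only [heatK_time_one]
  rw [integral_const_mul, integral_gaussian]
  have : Real.pi / (1 / 2) = 2 * Real.pi := by ring
  rw [this]
  exact inv_mul_cancel₀ (by positivity)

theorem integrable_heatKx_time_one : Integrable (fun w => heatKx 1 w) := by
  simp only [heatKx, heatK_time_one]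
  refine ((integrable_mul_exp_neg_mul_sq (b := 1 / 2) (by norm_num)).const_mul
    (-(√(2 * Real.pi))⁻¹)).congr (Eventually.of_forall fun w => ?_)
  simp only; ring

/-! ### Potentials carried by a curve in space-time -/

/-- The potential with kernel `K` of the density `f` on `(a, b)` placed along the curve
`z ↦ (s z, y z)` in space-time. -/
noncomputable def curvePotential (K : ℝ → ℝ → ℝ) (s y f : ℝ → ℝ) (a b t x : ℝ) : ℝ :=
  ∫ z in Ioo a b, K (t - s z) (x - y z) * f z

section Potential

variable {K K' : ℝ → ℝ → ℝ} {s y f : ℝ → ℝ} {a b : ℝ}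

/-- The pairs (q,z) for which q is not the curve point of parameter z form an open set containing
{p} × [a,b]. The tube lemma gives a ball around p that works for all z at once, and compactness
bounds K there. This bound dominates every later differentiation under the integral. -/
theorem exists_local_bound (hK : ∀ p : ℝ × ℝ, p ≠ 0 → ContinuousAt (fun p : ℝ × ℝ => K p.1 p.2) p)
    (hs : Continuous s) (hy : Continuous y) {p : ℝ × ℝ}
    (hp : ∀ z ∈ Icc a b, (p.1 - s z, p.2 - y z) ≠ 0) :
    ∃ ε > 0, ∃ C : ℝ, ∀ q ∈ Metric.ball p ε, ∀ z ∈ Icc a b,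
      (q.1 - s z, q.2 - y z) ≠ 0 ∧ |K (q.1 - s z) (q.2 - y z)| ≤ C := by
  have hc : Continuous fun w : (ℝ × ℝ) × ℝ => (w.1.1 - s w.2, w.1.2 - y w.2) := by fun_prop
  have hD : IsOpen {w : (ℝ × ℝ) × ℝ | (w.1.1 - s w.2, w.1.2 - y w.2) ≠ 0} :=
    isOpen_ne_fun hc continuous_const
  obtain ⟨u, v, hu, hv, hpu, hzv, huv⟩ := generalized_tube_lemma (isCompact_singleton (x := p))
    (isCompact_Icc (a := a) (b := b)) hD (by
      rintro ⟨q, z⟩ ⟨hq, hz⟩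
      obtain rfl : q = p := hq
      exact hp z hz)
  obtain ⟨ε, hε, hεu⟩ := Metric.nhds_basis_closedBall.mem_iff.1 (hu.mem_nhds (hpu rfl))
  obtain ⟨C, hC⟩ := ((isCompact_closedBall p ε).prod (isCompact_Icc (a := a) (b := b)))
    |>.exists_bound_of_continuousOn (f := fun w => K (w.1.1 - s w.2) (w.1.2 - y w.2)) (by
      rintro ⟨q, z⟩ ⟨hq, hz⟩
      have h1 : (q.1 - s z, q.2 - y z) ≠ 0 := huv (a := (q, z)) ⟨hεu hq, hzv hz⟩
      exact (ContinuousAt.comp (g := fun p : ℝ × ℝ => K p.1 p.2) (x := (q, z)) (hK _ h1)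
        hc.continuousAt).continuousWithinAt)
  refine ⟨ε, hε, C, fun q hq z hz => ⟨huv (a := (q, z))
    ⟨hεu (Metric.ball_subset_closedBall hq), hzv hz⟩, ?_⟩⟩
  exact hC (q, z) ⟨Metric.ball_subset_closedBall hq, hz⟩

theorem aestronglyMeasurable_potential (hKm : Measurable fun p : ℝ × ℝ => K p.1 p.2)
    (hs : Continuous s) (hy : Continuous y) (hf : IntegrableOn f (Ioo a b)) (t x : ℝ) :
    AEStronglyMeasurable (fun z => K (t - s z) (x - y z) * f z) (volume.restrict (Ioo a b)) := by
  refine AEStronglyMeasurable.mul ?_ hf.aestronglyMeasurable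
  exact (hKm.comp ((measurable_const.sub hs.measurable).prodMk
    (measurable_const.sub hy.measurable))).aestronglyMeasurable

theorem integrableOn_potential (hKm : Measurable fun p : ℝ × ℝ => K p.1 p.2)
    (hK : ∀ p : ℝ × ℝ, p ≠ 0 → ContinuousAt (fun p : ℝ × ℝ => K p.1 p.2) p)
    (hs : Continuous s) (hy : Continuous y) (hf : IntegrableOn f (Ioo a b)) {p : ℝ × ℝ}
    (hp : ∀ z ∈ Icc a b, (p.1 - s z, p.2 - y z) ≠ 0) :
    IntegrableOn (fun z => K (p.1 - s z) (p.2 - y z) * f z) (Ioo a b) := by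
  obtain ⟨ε, hε, C, hC⟩ := exists_local_bound hK hs hy hp
  refine Integrable.mono' (hf.norm.const_mul C)
    (aestronglyMeasurable_potential hKm hs hy hf _ _) ?_
  refine (ae_restrict_iff' measurableSet_Ioo).2 (Eventually.of_forall fun z hz => ?_)
  rw [norm_mul]
  gcongr
  exact (hC p (Metric.mem_ball_self hε) z (Ioo_subset_Icc_self hz)).2

theorem continuousAt_potential (hKm : Measurable fun p : ℝ × ℝ => K p.1 p.2)
    (hK : ∀ p : ℝ × ℝ, p ≠ 0 → ContinuousAt (fun p : ℝ × ℝ => K p.1 p.2) p)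
    (hs : Continuous s) (hy : Continuous y) (hf : IntegrableOn f (Ioo a b)) {p : ℝ × ℝ}
    (hp : ∀ z ∈ Icc a b, (p.1 - s z, p.2 - y z) ≠ 0) :
    ContinuousAt (fun q : ℝ × ℝ => curvePotential K s y f a b q.1 q.2) p := by
  obtain ⟨ε, hε, C, hC⟩ := exists_local_bound hK hs hy hp
  unfold curvePotential
  refine continuousAt_of_dominated (bound := fun z => C * ‖f z‖)
    (Eventually.of_forall fun q => aestronglyMeasurable_potential hKm hs hy hf _ _) ?_
    (hf.norm.const_mul C) ?_
  · filter_upwards [Metric.ball_mem_nhds p hε] with q hq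
    refine (ae_restrict_iff' measurableSet_Ioo).2 (Eventually.of_forall fun z hz => ?_)
    rw [norm_mul]
    gcongr
    exact (hC q hq z (Ioo_subset_Icc_self hz)).2
  · refine (ae_restrict_iff' measurableSet_Ioo).2 (Eventually.of_forall fun z hz => ?_)
    refine ContinuousAt.mul ?_ continuousAt_const
    have : ContinuousAt (fun q : ℝ × ℝ => (q.1 - s z, q.2 - y z)) p := by fun_prop
    exact ContinuousAt.comp (g := fun p : ℝ × ℝ => K p.1 p.2) (x := p)
      (hK _ (hp z (Ioo_subset_Icc_self hz))) this

theorem hasDerivAt_potential_right (hKm : Measurable fun p : ℝ × ℝ => K p.1 p.2)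
    (hK : ∀ p : ℝ × ℝ, p ≠ 0 → ContinuousAt (fun p : ℝ × ℝ => K p.1 p.2) p)
    (hKm' : Measurable fun p : ℝ × ℝ => K' p.1 p.2)
    (hK' : ∀ p : ℝ × ℝ, p ≠ 0 → ContinuousAt (fun p : ℝ × ℝ => K' p.1 p.2) p)
    (hd : ∀ t x, HasDerivAt (fun x => K t x) (K' t x) x)
    (hs : Continuous s) (hy : Continuous y) (hf : IntegrableOn f (Ioo a b)) {t x : ℝ}
    (hp : ∀ z ∈ Icc a b, (t - s z, x - y z) ≠ 0) :
    HasDerivAt (fun x => curvePotential K s y f a b t x) (curvePotential K' s y f a b t x) x := by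
  obtain ⟨ε, hε, C, hC⟩ := exists_local_bound (p := (t, x)) hK' hs hy hp
  unfold curvePotential
  refine (hasDerivAt_integral_of_dominated_loc_of_deriv_le (bound := fun z => C * ‖f z‖)
    (F := fun x z => K (t - s z) (x - y z) * f z) (F' := fun x z => K' (t - s z) (x - y z) * f z)
    (Metric.ball_mem_nhds x hε)
    (Eventually.of_forall fun q => aestronglyMeasurable_potential hKm hs hy hf _ _)
    (integrableOn_potential (p := (t, x)) hKm hK hs hy hf hp)
    (aestronglyMeasurable_potential hKm' hs hy hf _ _) ?_ (hf.norm.const_mul C) ?_).2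
  · refine (ae_restrict_iff' measurableSet_Ioo).2 (Eventually.of_forall fun z hz x' hx' => ?_)
    rw [norm_mul]
    gcongr
    refine (hC (t, x') ?_ z (Ioo_subset_Icc_self hz)).2
    simpa [Prod.dist_eq, hε] using hx'
  · refine Eventually.of_forall fun z x' _ => ?_
    exact HasDerivAt.mul_const (HasDerivAt.comp_sub_const x' (y z) (hd _ _)) _

theorem hasDerivAt_potential_left (hKm : Measurable fun p : ℝ × ℝ => K p.1 p.2)
    (hK : ∀ p : ℝ × ℝ, p ≠ 0 → ContinuousAt (fun p : ℝ × ℝ => K p.1 p.2) p)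
    (hKm' : Measurable fun p : ℝ × ℝ => K' p.1 p.2)
    (hK' : ∀ p : ℝ × ℝ, p ≠ 0 → ContinuousAt (fun p : ℝ × ℝ => K' p.1 p.2) p)
    (hd : ∀ t x, (t, x) ≠ 0 → HasDerivAt (fun t => K t x) (K' t x) t)
    (hs : Continuous s) (hy : Continuous y) (hf : IntegrableOn f (Ioo a b)) {t x : ℝ}
    (hp : ∀ z ∈ Icc a b, (t - s z, x - y z) ≠ 0) :
    HasDerivAt (fun t => curvePotential K s y f a b t x) (curvePotential K' s y f a b t x) t := by
  obtain ⟨ε, hε, C, hC⟩ := exists_local_bound (p := (t, x)) hK' hs hy hp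
  unfold curvePotential
  have hball : ∀ t' ∈ Metric.ball t ε, (t', x) ∈ Metric.ball (t, x) ε := fun t' ht' => by
    simpa [Prod.dist_eq, hε] using ht'
  refine (hasDerivAt_integral_of_dominated_loc_of_deriv_le (bound := fun z => C * ‖f z‖)
    (F := fun t z => K (t - s z) (x - y z) * f z) (F' := fun t z => K' (t - s z) (x - y z) * f z)
    (Metric.ball_mem_nhds t hε)
    (Eventually.of_forall fun q => aestronglyMeasurable_potential hKm hs hy hf _ _)
    (integrableOn_potential (p := (t, x)) hKm hK hs hy hf hp)
    (aestronglyMeasurable_potential hKm' hs hy hf _ _) ?_ (hf.norm.const_mul C) ?_).2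
  · refine (ae_restrict_iff' measurableSet_Ioo).2 (Eventually.of_forall fun z hz t' ht' => ?_)
    rw [norm_mul]
    gcongr
    exact (hC (t', x) (hball t' ht') z (Ioo_subset_Icc_self hz)).2
  · refine (ae_restrict_iff' measurableSet_Ioo).2 (Eventually.of_forall fun z hz t' ht' => ?_)
    exact HasDerivAt.mul_const (HasDerivAt.comp_sub_const t' (s z)
      (hd _ _ (hC (t', x) (hball t' ht') z (Ioo_subset_Icc_self hz)).1)) _

end Potential

/-! ### Linear Volterra systems -/

/-- Convolution of an integrable kernel with a bounded density that is continuous off the origin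
is continuous. -/
theorem continuous_convolution_of_integrable {κ c : ℝ → ℝ} (hκ : Integrable κ)
    (hcm : Measurable c) {B : ℝ} (hcB : ∀ t, |c t| ≤ B) (hc : ∀ t, t ≠ 0 → ContinuousAt c t) :
    Continuous fun t => ∫ s, κ (t - s) * c s := by
  have : (fun t => ∫ s, κ (t - s) * c s) = fun t => ∫ τ, κ τ * c (t - τ) := by
    ext t
    rw [← integral_sub_left_eq_self (fun τ => κ τ * c (t - τ)) volume t]
    simp
  rw [this, continuous_iff_continuousAt]
  intro t
  refine continuousAt_of_dominated (bound := fun τ => ‖κ τ‖ * B) (Eventually.of_forall fun t => ?_)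
    (Eventually.of_forall fun t => Eventually.of_forall fun τ => ?_) (hκ.norm.mul_const B) ?_
  · exact hκ.aestronglyMeasurable.mul
      (hcm.comp (measurable_const.sub measurable_id)).aestronglyMeasurable
  · rw [norm_mul]
    gcongr
    exact hcB _
  · have : ∀ᵐ τ : ℝ, τ ≠ t := by simp [ae_iff]
    filter_upwards [this] with τ hτ
    refine continuousAt_const.mul ?_
    exact ContinuousAt.comp (f := fun t : ℝ => t - τ) (hc (t - τ) (sub_ne_zero.2 hτ.symm))
      (by fun_prop)

theorem abs_convolution_le {κ c : ℝ → ℝ} (hκ : Integrable κ) {B : ℝ} (hcB : ∀ t, |c t| ≤ B)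
    (t : ℝ) : |∫ s, κ (t - s) * c s| ≤ (∫ τ, |κ τ|) * B := by
  have : (∫ τ, |κ τ|) * B = ∫ s, |κ (t - s)| * B := by
    rw [integral_mul_const, integral_sub_left_eq_self (fun τ => |κ τ|) volume t]
  rw [this, ← Real.norm_eq_abs]
  refine norm_integral_le_of_norm_le ((hκ.abs.mul_const B).comp_sub_left t)
    (Eventually.of_forall fun s => ?_)
  rw [norm_mul]
  have := hcB s
  gcongr
  · exact le_rfl
  · exact this

theorem integrable_convolution {κ c : ℝ → ℝ} (hκ : Integrable κ) (hcm : Measurable c) {B : ℝ}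
    (hcB : ∀ t, |c t| ≤ B) (t : ℝ) : Integrable fun s => κ (t - s) * c s := by
  refine Integrable.mono' ((hκ.abs.mul_const B).comp_sub_left t)
    ((hκ.comp_sub_left t).aestronglyMeasurable.mul hcm.aestronglyMeasurable)
    (Eventually.of_forall fun s => ?_)
  rw [norm_mul]
  have := hcB s
  gcongr
  · exact le_rfl
  · exact this

/-- A causal kernel lives on t > 0, where e^{-nt} decreases to 0. Dominated convergence then makes
its weighted L¹ norm as small as required. -/
theorem tendsto_integral_exp_mul_abs {k : ℝ → ℝ} (hk0 : ∀ t ≤ 0, k t = 0)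
    (hk : Integrable fun t => Real.exp (-t) * k t) :
    Tendsto (fun n : ℕ => ∫ t, |Real.exp (-(n * t)) * k t|) atTop (𝓝 0) := by
  have h0 : ∫ _ : ℝ, (0 : ℝ) = 0 := by simp
  rw [← h0]
  have hkm : AEStronglyMeasurable k volume := by
    have : k = fun t => Real.exp t * (Real.exp (-t) * k t) := by
      ext t; rw [← mul_assoc, ← Real.exp_add]; simp
    rw [this]
    exact Real.measurable_exp.aestronglyMeasurable.mul hk.aestronglyMeasurable
  refine tendsto_integral_filter_of_dominated_convergence
    (fun t => ‖Real.exp (-t) * k t‖) (Eventually.of_forall fun n => ?_) ?_ hk.norm ?_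
  · exact ((Real.measurable_exp.comp (measurable_const.mul measurable_id).neg).aestronglyMeasurable.mul
      hkm).norm
  · filter_upwards [eventually_ge_atTop 1] with n hn
    refine Eventually.of_forall fun t => ?_
    rcases le_or_gt t 0 with h | h
    · simp [hk0 t h]
    · rw [Real.norm_eq_abs, abs_abs, abs_mul, norm_mul, Real.abs_exp,
        Real.norm_of_nonneg (Real.exp_pos _).le, Real.norm_eq_abs (k t)]
      gcongr
      have : (1 : ℝ) ≤ n := by exact_mod_cast hn
      nlinarith
  · refine Eventually.of_forall fun t => ?_
    rcases le_or_gt t 0 with h | h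
    · simp [hk0 t h]
    · have : Tendsto (fun n : ℕ => |Real.exp (-(n * t)) * k t|) atTop (𝓝 |0 * k t|) := by
        refine (Tendsto.mul_const _ ?_).abs
        refine Real.tendsto_exp_neg_atTop_nhds_zero.comp ?_
        exact tendsto_natCast_atTop_atTop.atTop_mul_const h
      simpa using this

/-- A system of linear Volterra equations of the second kind with integrable kernels has a solution,
continuous on `(0, ∞)` and of at most exponential growth. -/
theorem exists_volterra_solution {ι : Type*} [Fintype ι] (k : ι → ι → ℝ → ℝ)
    (hk0 : ∀ i j, ∀ t ≤ 0, k i j t = 0)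
    (hk : ∀ i j, Integrable fun t => Real.exp (-t) * k i j t)
    (f : ι → ℝ → ℝ) (hf : ∀ i, ContinuousOn (f i) (Ioi 0)) {M : ℝ} (hM0 : 0 ≤ M)
    (hM : ∀ i, ∀ t > 0, |f i t| ≤ M) :
    ∃ y : ι → ℝ → ℝ, (∀ i, ∀ t ≤ 0, y i t = 0) ∧ (∀ i, ContinuousOn (y i) (Ioi 0)) ∧
      (∀ i, Measurable (y i)) ∧
      (∃ C L : ℝ, 0 ≤ C ∧ 0 ≤ L ∧ ∀ i t, |y i t| ≤ C * Real.exp (L * t)) ∧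
      ∀ i, ∀ t > 0, y i t = f i t + ∑ j, ∫ s, k i j (t - s) * y j s := by
  classical
  -- The weight n is chosen so large that all the weighted kernels together have L¹ norm below 1/2,
  -- the contraction constant used below.
  obtain ⟨n, hn⟩ : ∃ n : ℕ, 1 ≤ n ∧
      ∑ i, ∑ j, ∫ t, |Real.exp (-(n * t)) * k i j t| < 1 / 2 := by
    have : Tendsto (fun n : ℕ => ∑ i, ∑ j, ∫ t, |Real.exp (-(n * t)) * k i j t|) atTop
        (𝓝 (∑ i : ι, ∑ j : ι, (0 : ℝ))) :=
      tendsto_finsetSum _ fun i _ => tendsto_finsetSum _ fun j _ =>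
        tendsto_integral_exp_mul_abs (hk0 i j) (hk i j)
    simp only [Finset.sum_const_zero] at this
    obtain ⟨n, h1, h2⟩ := ((eventually_ge_atTop 1).and
      (this.eventually (gt_mem_nhds (show (0 : ℝ) < 1 / 2 by norm_num)))).exists
    exact ⟨n, h1, h2⟩
  obtain ⟨hn1, hn⟩ := hn
  -- Substituting y = e^{nt} c turns the system into c = e^{-nt} f + κ * c, posed for bounded
  -- continuous c on (0,∞).
  set κ : ι → ι → ℝ → ℝ := fun i j t => Real.exp (-(n * t)) * k i j t with hκdef
  have hκ : ∀ i j, Integrable (κ i j) := fun i j => by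
    refine Integrable.mono (hk i j) ?_ (Eventually.of_forall fun t => ?_)
    · have : κ i j = fun t => Real.exp (t - n * t) * (Real.exp (-t) * k i j t) := by
        ext t
        simp only [hκdef]
        rw [← mul_assoc, ← Real.exp_add]; congr 2; ring
      rw [this]
      exact (by fun_prop : Measurable fun t : ℝ => Real.exp (t - n * t)).aestronglyMeasurable.mul
        (hk i j).aestronglyMeasurable
    · rcases le_or_gt t 0 with h | h
      · simp [hκdef, hk0 i j t h]
      · simp only [hκdef, norm_mul, Real.norm_of_nonneg (Real.exp_pos _).le]
        gcongr
        have : (1 : ℝ) ≤ n := by exact_mod_cast hn1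
        nlinarith
  set N : ι → ι → ℝ := fun i j => ∫ t, |κ i j t| with hN
  have hN0 : ∀ i j, 0 ≤ N i j := fun i j => integral_nonneg fun t => abs_nonneg _
  set S := ∑ i, ∑ j, N i j with hS
  have hS0 : 0 ≤ S := Finset.sum_nonneg fun i _ => Finset.sum_nonneg fun j _ => hN0 i j
  have hNS : ∀ i, ∑ j, N i j ≤ S := fun i =>
    Finset.single_le_sum (f := fun i => ∑ j, N i j)
      (fun i _ => Finset.sum_nonneg fun j _ => hN0 i j) (Finset.mem_univ i)
  -- Extension by zero lets the convolutions run over the whole line. Nothing is required of c at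
  -- the origin, so no compatibility condition at t = 0 arises.
  let ext : ((Ioi (0 : ℝ)) →ᵇ (ι → ℝ)) → ι → ℝ → ℝ := fun c j s =>
    if h : 0 < s then c ⟨s, h⟩ j else 0
  have ext_of_pos : ∀ c j s (h : 0 < s), ext c j s = c ⟨s, h⟩ j := fun c j s h => dif_pos h
  have ext_of_nonpos : ∀ c j s, s ≤ 0 → ext c j s = 0 := fun c j s h => dif_neg (not_lt.2 h)
  have ext_bound : ∀ c j s, |ext c j s| ≤ ‖c‖ := fun c j s => by
    rcases le_or_gt s 0 with h | h
    · rw [ext_of_nonpos c j s h]; simp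
    · rw [ext_of_pos c j s h]
      exact (norm_le_pi_norm _ j).trans (c.norm_coe_le_norm _)
  have ext_cont : ∀ c j, ContinuousOn (ext c j) (Ioi 0) := fun c j => by
    rw [continuousOn_iff_continuous_domRestrict]
    have : (Ioi (0 : ℝ)).domRestrict (ext c j) = fun t => c t j := by
      funext t; exact ext_of_pos c j t t.2
    rw [this]
    exact (continuous_apply j).comp c.continuous
  have ext_contAt : ∀ c j t, t ≠ 0 → ContinuousAt (ext c j) t := fun c j t ht => by
    rcases lt_or_gt_of_ne ht with h | h
    · have : ext c j =ᶠ[𝓝 t] fun _ => 0 := by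
        filter_upwards [gt_mem_nhds h] with s hs
        exact ext_of_nonpos c j s hs.le
      exact continuousAt_const.congr this.symm
    · exact (ext_cont c j).continuousAt (Ioi_mem_nhds h)
  have ext_meas : ∀ c j, Measurable (ext c j) := fun c j => by
    refine measurable_of_restrict_of_restrict_compl (s := Ioi (0 : ℝ)) measurableSet_Ioi
      (continuousOn_iff_continuous_domRestrict.1 (ext_cont c j)).measurable ?_
    have : (Ioi (0 : ℝ))ᶜ.domRestrict (ext c j) = fun _ => 0 := by
      funext t; exact ext_of_nonpos c j t (not_lt.1 t.2)
    rw [this]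
    exact measurable_const
  have ext_sub : ∀ c c' j s, ext c j s - ext c' j s = ext (c - c') j s := fun c c' j s => by
    rcases le_or_gt s 0 with h | h
    · simp [ext_of_nonpos _ j s h]
    · simp [ext_of_pos _ j s h]
  let T : ((Ioi (0 : ℝ)) →ᵇ (ι → ℝ)) → ((Ioi (0 : ℝ)) →ᵇ (ι → ℝ)) := fun c =>
    BoundedContinuousFunction.ofNormedAddCommGroup
      (fun t i => Real.exp (-(n * t.1)) * f i t + ∑ j, ∫ s, κ i j (t - s) * ext c j s)
      (by
        refine continuous_pi fun i => Continuous.add ?_ (continuous_finsetSum _ fun j _ => ?_)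
        · have h1 := continuousOn_iff_continuous_domRestrict.1 (hf i)
          have h2 : Continuous fun t : Ioi (0 : ℝ) => Real.exp (-(n * t.1)) := by fun_prop
          exact h2.mul h1
        · exact (continuous_convolution_of_integrable (hκ i j) (ext_meas c j) (ext_bound c j)
            (ext_contAt c j)).comp continuous_subtype_val)
      (M + S * ‖c‖)
      (by
        intro t
        have h0 : 0 ≤ M + S * ‖c‖ := by positivity
        rw [pi_norm_le_iff_of_nonneg h0]
        intro i
        refine (norm_add_le _ _).trans (add_le_add ?_ ?_)
        · rw [norm_mul, Real.norm_of_nonneg (Real.exp_pos _).le]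
          have h1 : Real.exp (-(n * t.1)) ≤ 1 := by
            rw [Real.exp_le_one_iff]
            have := t.2.out
            have : 0 ≤ (n : ℝ) * t.1 := by positivity
            linarith
          have h2 := hM i t t.2
          calc _ ≤ 1 * M := by gcongr; exact h2
            _ = M := one_mul M
        · refine (norm_sum_le _ _).trans ?_
          calc _ ≤ ∑ j, N i j * ‖c‖ := Finset.sum_le_sum fun j _ =>
                abs_convolution_le (hκ i j) (ext_bound c j) t
            _ ≤ S * ‖c‖ := by
                rw [← Finset.sum_mul]
                have := hNS i
                gcongr)
  have T_apply : ∀ c t i, T c t i =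
      Real.exp (-(n * t.1)) * f i t + ∑ j, ∫ s, κ i j (t - s) * ext c j s := fun c t i => rfl
  have hT : ContractingWith (1 / 2) T := by
    refine ⟨by norm_num, LipschitzWith.of_dist_le_mul fun c c' => ?_⟩
    rw [dist_eq_norm, dist_eq_norm]
    have h0 : 0 ≤ ((1 / 2 : NNReal) : ℝ) * ‖c - c'‖ := by positivity
    rw [BoundedContinuousFunction.norm_le h0]
    intro t
    rw [pi_norm_le_iff_of_nonneg h0]
    intro i
    have : (T c - T c') t i = ∑ j, ∫ s, κ i j (t - s) * ext (c - c') j s := by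
      rw [BoundedContinuousFunction.sub_apply, Pi.sub_apply, T_apply, T_apply, add_sub_add_left_eq_sub,
        ← Finset.sum_sub_distrib]
      refine Finset.sum_congr rfl fun j _ => ?_
      rw [← integral_sub (integrable_convolution (hκ i j) (ext_meas c j) (ext_bound c j) t)
        (integrable_convolution (hκ i j) (ext_meas c' j) (ext_bound c' j) t)]
      congr 1; ext s
      rw [← ext_sub]; ring
    rw [this]
    refine (norm_sum_le _ _).trans ?_
    calc _ ≤ ∑ j, N i j * ‖c - c'‖ := Finset.sum_le_sum fun j _ =>
          abs_convolution_le (hκ i j) (ext_bound _ j) t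
      _ ≤ S * ‖c - c'‖ := by
          rw [← Finset.sum_mul]
          have := hNS i
          gcongr
      _ ≤ ((1 / 2 : NNReal) : ℝ) * ‖c - c'‖ := by
          gcongr
          simpa using hn.le
  set c := hT.fixedPoint with hc
  have hfix : T c = c := hT.fixedPoint_isFixedPt
  refine ⟨fun i t => Real.exp (n * t) * ext c i t, fun i t ht => ?_, fun i => ?_, fun i => ?_,
    ⟨‖c‖, n, norm_nonneg _, Nat.cast_nonneg _, fun i t => ?_⟩, fun i t ht => ?_⟩
  · simp only [ext_of_nonpos c i t ht, mul_zero]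
  · exact (by fun_prop : Continuous fun t : ℝ => Real.exp (n * t)).continuousOn.mul (ext_cont c i)
  · exact (by fun_prop : Measurable fun t : ℝ => Real.exp (n * t)).mul (ext_meas c i)
  · rw [abs_mul, Real.abs_exp, mul_comm]
    have := ext_bound c i t
    gcongr
  -- The fixed point equation is multiplied by e^{nt}, and the factor e^{n(t-(t-s))} = e^{ns}
  -- restores y inside the convolution.
  · have h1 := congrFun (congrArg (fun c : (Ioi (0 : ℝ)) →ᵇ (ι → ℝ) => c ⟨t, ht⟩) hfix) i
    simp only [T_apply] at h1
    simp only [ext_of_pos c i t ht]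
    rw [← h1, mul_add, ← mul_assoc, ← Real.exp_add, Finset.mul_sum]
    congr 1
    · simp
    · refine Finset.sum_congr rfl fun j _ => ?_
      rw [← integral_const_mul]
      congr 1; ext s
      simp only [hκdef]
      have : Real.exp (n * t) * Real.exp (-(n * (t - s))) = Real.exp (n * s) := by
        rw [← Real.exp_add]; congr 1; ring
      rw [← this]; ring

/-! ### Layer potentials and the jump relation -/

/-- Admissible densities of layer potentials. -/
structure IsDensity (a : ℝ → ℝ) : Prop where
  zero : ∀ s ≤ 0, a s = 0
  cont : ContinuousOn a (Ioi 0)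
  meas : Measurable a
  bdd : ∀ T, ∃ M, 0 ≤ M ∧ ∀ s ≤ T, |a s| ≤ M

/-- The layer potential at the origin. -/
noncomputable def layer (K : ℝ → ℝ → ℝ) (a : ℝ → ℝ) (t x : ℝ) : ℝ := ∫ s, K (t - s) x * a s

section Layer

variable {K K' : ℝ → ℝ → ℝ} {a : ℝ → ℝ}

theorem IsDensity.integrableOn (ha : IsDensity a) (T : ℝ) : IntegrableOn a (Ioo 0 T) := by
  obtain ⟨M, hM0, hM⟩ := ha.bdd T
  refine Measure.integrableOn_of_bounded (M := M) (by simp) ha.meas.aestronglyMeasurable ?_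
  exact (ae_restrict_iff' measurableSet_Ioo).2 (Eventually.of_forall fun s hs => hM s hs.2.le)

theorem IsDensity.continuousAt (ha : IsDensity a) {t : ℝ} (ht : t ≠ 0) : ContinuousAt a t := by
  rcases lt_or_gt_of_ne ht with h | h
  · have : a =ᶠ[𝓝 t] fun _ => 0 := by
      filter_upwards [gt_mem_nhds h] with s hs
      exact ha.zero s hs.le
    exact continuousAt_const.congr this.symm
  · exact ha.cont.continuousAt (Ioi_mem_nhds h)

/-- By causality of the kernel and of the density, the integral sees only 0 < s < t. The free
endpoint T allows t to vary while the carrier stays fixed. -/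
theorem layer_eq_curvePotential (hK0 : ∀ t ≤ 0, ∀ x, K t x = 0) (ha : IsDensity a) {t T : ℝ}
    (htT : t ≤ T) (x : ℝ) :
    layer K a t x = curvePotential K (fun s => s) (fun _ => 0) a 0 T t x := by
  simp only [layer, curvePotential, sub_zero]
  rw [setIntegral_eq_integral_of_forall_compl_eq_zero]
  intro s hs
  rcases le_or_gt s 0 with h | h
  · rw [ha.zero s h, mul_zero]
  · have : T ≤ s := by by_contra h'; exact hs ⟨h, not_le.1 h'⟩
    rw [hK0 _ (by linarith), zero_mul]

theorem layer_of_nonpos (hK0 : ∀ t ≤ 0, ∀ x, K t x = 0) (ha : IsDensity a) {t : ℝ}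
    (ht : t ≤ 0) (x : ℝ) : layer K a t x = 0 := by
  rw [layer_eq_curvePotential hK0 ha ht]
  simp [curvePotential]

theorem continuousAt_layer (hK0 : ∀ t ≤ 0, ∀ x, K t x = 0)
    (hKm : Measurable fun p : ℝ × ℝ => K p.1 p.2)
    (hK : ∀ p : ℝ × ℝ, p ≠ 0 → ContinuousAt (fun p : ℝ × ℝ => K p.1 p.2) p)
    (ha : IsDensity a) {p : ℝ × ℝ} (hx : p.2 ≠ 0) :
    ContinuousAt (fun q : ℝ × ℝ => layer K a q.1 q.2) p := by
  have : (fun q : ℝ × ℝ => layer K a q.1 q.2) =ᶠ[𝓝 p] fun q =>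
      curvePotential K (fun s => s) (fun _ => 0) a 0 (p.1 + 1) q.1 q.2 := by
    filter_upwards [(continuous_fst.tendsto p).eventually (gt_mem_nhds (lt_add_one p.1))] with q hq
    exact layer_eq_curvePotential hK0 ha hq.le _
  refine ContinuousAt.congr ?_ this.symm
  exact continuousAt_potential hKm hK continuous_id continuous_const (ha.integrableOn _)
    fun z _ h => hx (by simpa using congrArg Prod.snd h)

theorem hasDerivAt_layer_right (hK0 : ∀ t ≤ 0, ∀ x, K t x = 0) (hK0' : ∀ t ≤ 0, ∀ x, K' t x = 0)
    (hKm : Measurable fun p : ℝ × ℝ => K p.1 p.2)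
    (hK : ∀ p : ℝ × ℝ, p ≠ 0 → ContinuousAt (fun p : ℝ × ℝ => K p.1 p.2) p)
    (hKm' : Measurable fun p : ℝ × ℝ => K' p.1 p.2)
    (hK' : ∀ p : ℝ × ℝ, p ≠ 0 → ContinuousAt (fun p : ℝ × ℝ => K' p.1 p.2) p)
    (hd : ∀ t x, HasDerivAt (fun x => K t x) (K' t x) x)
    (ha : IsDensity a) {t x : ℝ} (hx : x ≠ 0) :
    HasDerivAt (fun x => layer K a t x) (layer K' a t x) x := by
  simp only [layer_eq_curvePotential hK0 ha (le_refl t), layer_eq_curvePotential hK0' ha (le_refl t)]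
  exact hasDerivAt_potential_right hKm hK hKm' hK' hd continuous_id continuous_const
    (ha.integrableOn _) fun z _ h => hx (by simpa using congrArg Prod.snd h)

theorem hasDerivAt_layer_left (hK0 : ∀ t ≤ 0, ∀ x, K t x = 0) (hK0' : ∀ t ≤ 0, ∀ x, K' t x = 0)
    (hKm : Measurable fun p : ℝ × ℝ => K p.1 p.2)
    (hK : ∀ p : ℝ × ℝ, p ≠ 0 → ContinuousAt (fun p : ℝ × ℝ => K p.1 p.2) p)
    (hKm' : Measurable fun p : ℝ × ℝ => K' p.1 p.2)
    (hK' : ∀ p : ℝ × ℝ, p ≠ 0 → ContinuousAt (fun p : ℝ × ℝ => K' p.1 p.2) p)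
    (hd : ∀ t x, (t, x) ≠ 0 → HasDerivAt (fun t => K t x) (K' t x) t)
    (ha : IsDensity a) {t x : ℝ} (hx : x ≠ 0) :
    HasDerivAt (fun t => layer K a t x) (layer K' a t x) t := by
  have : (fun t => layer K a t x) =ᶠ[𝓝 t] fun q =>
      curvePotential K (fun s => s) (fun _ => 0) a 0 (t + 1) q x := by
    filter_upwards [gt_mem_nhds (lt_add_one t)] with q hq
    exact layer_eq_curvePotential hK0 ha hq.le _
  refine HasDerivAt.congr_of_eventuallyEq ?_ this
  rw [layer_eq_curvePotential hK0' ha (lt_add_one t).le]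
  exact hasDerivAt_potential_left hKm hK hKm' hK' hd continuous_id continuous_const
    (ha.integrableOn _) fun z _ h => hx (by simpa using congrArg Prod.snd h)

theorem layer_neg {ε : ℝ} (hK : ∀ t x, K t (-x) = ε * K t x) (t x : ℝ) :
    layer K a t (-x) = ε * layer K a t x := by
  simp only [layer, hK, mul_assoc]
  exact integral_const_mul _ _

theorem layer_eq_conv (t x : ℝ) : layer K a t x = ∫ τ, K τ x * a (t - τ) := by
  rw [layer, ← integral_sub_left_eq_self (fun τ => K τ x * a (t - τ)) volume t]
  simp

/-- Under τ = x²θ the kernel becomes the fixed first passage density at level one, of total mass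
one, and x survives only in the argument of the density `a`. The uniform bound and the limit x ↓ 0
both follow from this form. -/
theorem layer_heatKx_of_pos (t : ℝ) {x : ℝ} (hx : 0 < x) :
    layer heatKx a t x = -∫ θ, heatK 1 θ 1 * a (t - x ^ 2 * θ) := by
  have hx2 : 0 < x ^ 2 := by positivity
  have h := Measure.integral_comp_mul_left (fun τ => heatKx τ x * a (t - τ)) (x ^ 2)
  rw [abs_of_pos (by positivity), smul_eq_mul, eq_inv_mul_iff_mul_eq₀ hx2.ne'] at h
  rw [layer_eq_conv, ← h, ← integral_const_mul, ← integral_neg]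
  congr 1; ext θ
  rw [← heatK_one_scale hx θ, heatKx]; ring

theorem abs_layer_heatKx_le {t M : ℝ} (hM : ∀ s ≤ t, |a s| ≤ M) {x : ℝ} (hx : 0 < x) :
    |layer heatKx a t x| ≤ M := by
  rw [layer_heatKx_of_pos t hx, abs_neg]
  have : M = ∫ θ, heatK 1 θ 1 * M := by rw [integral_mul_const, integral_heatK_one_one, one_mul]
  rw [this, ← Real.norm_eq_abs]
  refine norm_integral_le_of_norm_le (integrable_heatK_one_one.mul_const M)
    (Eventually.of_forall fun θ => ?_)
  rcases le_or_gt θ 0 with h | h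
  · simp [heatK_of_nonpos 1 h]
  · rw [norm_mul, Real.norm_of_nonneg (heatK_nonneg _ _ _)]
    have := heatK_nonneg 1 θ 1
    gcongr
    exact hM _ (by have : 0 ≤ x ^ 2 * θ := by positivity
                   linarith)

/-- Jump relation: the spatial derivative of a layer potential recovers the density. -/
theorem tendsto_layer_heatKx (ha : IsDensity a) {t : ℝ} (ht : 0 < t) :
    Tendsto (fun x => layer heatKx a t x) (𝓝[>] 0) (𝓝 (-a t)) := by
  obtain ⟨M, hM0, hM⟩ := ha.bdd t
  have h1 : Tendsto (fun x : ℝ => -∫ θ, heatK 1 θ 1 * a (t - x ^ 2 * θ)) (𝓝[>] 0)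
      (𝓝 (-∫ θ, heatK 1 θ 1 * a t)) := by
    refine Tendsto.neg ?_
    refine tendsto_integral_filter_of_dominated_convergence (fun θ => heatK 1 θ 1 * M)
      (Eventually.of_forall fun x => ?_) (Eventually.of_forall fun x => Eventually.of_forall fun θ => ?_)
      (integrable_heatK_one_one.mul_const M) (Eventually.of_forall fun θ => ?_)
    · exact integrable_heatK_one_one.aestronglyMeasurable.mul
        (ha.meas.comp (by fun_prop)).aestronglyMeasurable
    · rcases le_or_gt θ 0 with h | h
      · simp [heatK_of_nonpos 1 h]
      · rw [norm_mul, Real.norm_of_nonneg (heatK_nonneg _ _ _)]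
        have := heatK_nonneg 1 θ 1
        gcongr
        exact hM _ (by have : 0 ≤ x ^ 2 * θ := by positivity
                       linarith)
    · refine Tendsto.const_mul _ ?_
      have h2 : Tendsto (fun x : ℝ => t - x ^ 2 * θ) (𝓝[>] 0) (𝓝 t) := by
        refine tendsto_nhdsWithin_of_tendsto_nhds ?_
        refine Continuous.tendsto' (by fun_prop) _ _ ?_
        simp
      exact (ha.continuousAt ht.ne').tendsto.comp h2
  rw [integral_mul_const, integral_heatK_one_one, one_mul] at h1
  refine h1.congr' ?_
  filter_upwards [self_mem_nhdsWithin] with x hx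
  exact (layer_heatKx_of_pos t hx).symm

/-- The dominating function does not depend on x, so a single layer, unlike its derivative, is
continuous across the wall. The factor e^t compensates the weight: the density vanishes once τ ≥ t,
and e^{-τ}e^t ≥ 1 before that. -/
theorem norm_heatK_zero_mul_le (ha : IsDensity a) {t M : ℝ} (hM : ∀ s ≤ t, |a s| ≤ M) (x τ : ℝ) :
    ‖heatK 0 τ x * a (t - τ)‖ ≤ Real.exp (-τ) * heatK 0 τ 0 * (Real.exp t * M) := by
  have hM0 : 0 ≤ M := (abs_nonneg _).trans (hM t le_rfl)
  rcases le_or_gt τ 0 with h | h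
  · simp [heatK_of_nonpos 0 h]
  rw [norm_mul, Real.norm_of_nonneg (heatK_nonneg _ _ _)]
  have h0 := heatK_nonneg 0 τ 0
  rcases le_or_gt t τ with h' | h'
  · rw [ha.zero _ (by linarith)]
    simp only [norm_zero, mul_zero]
    positivity
  · have h1 := hM (t - τ) (by linarith)
    have h2 : 1 ≤ Real.exp (-τ) * Real.exp t := by
      rw [← Real.exp_add, Real.one_le_exp_iff]; linarith
    calc _ ≤ heatK 0 τ 0 * M := by
          have := heatK_le_zero_right 0 τ x
          gcongr
          exact h1
      _ ≤ (heatK 0 τ 0 * M) * (Real.exp (-τ) * Real.exp t) :=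
          le_mul_of_one_le_right (by positivity) h2
      _ = _ := by ring

theorem abs_layer_heatK_le (ha : IsDensity a) {t M : ℝ} (hM : ∀ s ≤ t, |a s| ≤ M) (x : ℝ) :
    |layer (heatK 0) a t x| ≤ (∫ τ, Real.exp (-τ) * heatK 0 τ 0) * (Real.exp t * M) := by
  rw [layer_eq_conv, ← integral_mul_const, ← Real.norm_eq_abs]
  exact norm_integral_le_of_norm_le (integrable_exp_mul_heatK_zero.mul_const _)
    (Eventually.of_forall fun τ => norm_heatK_zero_mul_le ha hM x τ)

theorem continuous_layer_heatK_right (ha : IsDensity a) (t : ℝ) :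
    Continuous fun x => layer (heatK 0) a t x := by
  obtain ⟨M, hM0, hM⟩ := ha.bdd t
  simp only [layer_eq_conv]
  refine continuous_of_dominated (fun x => ?_)
    (fun x => Eventually.of_forall fun τ => norm_heatK_zero_mul_le ha hM x τ)
    (integrable_exp_mul_heatK_zero.mul_const _) (Eventually.of_forall fun τ => ?_)
  · exact ((measurable_heatK 0).comp (measurable_id.prodMk measurable_const)).aestronglyMeasurable.mul
      (ha.meas.comp (by fun_prop)).aestronglyMeasurable
  · refine Continuous.mul ?_ continuous_const
    exact continuous_iff_continuousAt.2 fun x => (hasDerivAt_heatK_right 0 τ x).continuousAt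

end Layer

/-! ### Potentials of the initial datum and the approximate identity -/

theorem integral_comp_affine {g : ℝ → ℝ} {ε : ℝ} (hε : ε = 1 ∨ ε = -1) (c : ℝ) :
    ∫ z, g (c - ε * z) = ∫ z, g z := by
  rcases hε with rfl | rfl
  · simp only [one_mul]; exact integral_sub_left_eq_self g volume c
  · simp only [neg_mul, one_mul, sub_neg_eq_add]
    exact integral_add_left_eq_self g c

theorem integrable_comp_affine {g : ℝ → ℝ} (hg : Integrable g) {ε : ℝ} (hε : ε = 1 ∨ ε = -1)
    (c : ℝ) : Integrable fun z => g (c - ε * z) := by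
  rcases hε with rfl | rfl
  · simp only [one_mul]; exact hg.comp_sub_left c
  · simp only [neg_mul, one_mul, sub_neg_eq_add]
    exact hg.comp_add_left c

/-- The direct potential and both mirror images have carriers c ± z, so a change of variable
compares each of them with the L¹ norm of the kernel, uniformly in x. -/
theorem abs_curvePotential_affine_le {K : ℝ → ℝ → ℝ} {w : ℝ → ℝ} {t : ℝ} (hK : Integrable (K t))
    (hw : ∀ z ∈ Ioo (0 : ℝ) 1, |w z| ≤ 1) {ε : ℝ} (hε : ε = 1 ∨ ε = -1) (c x : ℝ) :
    |curvePotential K (fun _ => 0) (fun z => c + ε * z) w 0 1 t x| ≤ ∫ z, |K t z| := by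
  have h1 := integrable_comp_affine hK.abs hε (x - c)
  unfold curvePotential
  simp only [sub_zero]
  calc _ ≤ ∫ z in Ioo (0 : ℝ) 1, |K t (x - c - ε * z)| := by
        rw [← Real.norm_eq_abs]
        refine norm_integral_le_of_norm_le h1.integrableOn ?_
        refine (ae_restrict_iff' measurableSet_Ioo).2 (Eventually.of_forall fun z hz => ?_)
        rw [norm_mul, sub_add_eq_sub_sub]
        exact mul_le_of_le_one_right (norm_nonneg _) (hw z hz)
    _ ≤ ∫ z, |K t (x - c - ε * z)| :=
        setIntegral_le_integral h1 (Eventually.of_forall fun z => abs_nonneg _)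
    _ = _ := integral_comp_affine (g := fun z => |K t z|) hε (x - c)

theorem integrable_of_scale {g : ℝ → ℝ} {c : ℝ} (hc : 0 < c) (h : Integrable fun w => g (c * w)) :
    Integrable g := (integrable_comp_mul_left_iff g hc.ne').1 h

theorem heatK_zero_scale {t : ℝ} (ht : 0 < t) (w : ℝ) :
    heatK 0 t (√t * w) = (√t)⁻¹ * heatK 0 1 w := by
  have := heatK_space_scale 0 ht w
  have h := (Real.sqrt_pos.2 ht).ne'
  field_simp
  simpa using this

theorem heatKx_scale {t : ℝ} (ht : 0 < t) (w : ℝ) :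
    heatKx t (√t * w) = t⁻¹ * heatKx 1 w := by
  have := heatK_space_scale 1 ht w
  rw [heatKx, heatKx, neg_mul, neg_mul, mul_right_comm, this]
  ring

theorem integrable_heatK {t : ℝ} (ht : 0 < t) : Integrable (heatK 0 t) := by
  refine integrable_of_scale (Real.sqrt_pos.2 ht) ?_
  simp only [heatK_zero_scale ht]
  exact integrable_heatK_time_one.const_mul _

theorem integral_heatK {t : ℝ} (ht : 0 < t) : ∫ z, heatK 0 t z = 1 := by
  have hs := Real.sqrt_pos.2 ht
  have h := Measure.integral_comp_mul_left (heatK 0 t) (√t)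
  simp only [heatK_zero_scale ht] at h
  rw [integral_const_mul, integral_heatK_time_one, abs_of_pos (by positivity), smul_eq_mul] at h
  exact (mul_left_cancel₀ (inv_ne_zero hs.ne') h).symm

theorem integrable_heatKx {t : ℝ} (ht : 0 < t) : Integrable (heatKx t) := by
  refine integrable_of_scale (Real.sqrt_pos.2 ht) ?_
  simp only [heatKx_scale ht]
  exact integrable_heatKx_time_one.const_mul _

theorem integral_abs_heatKx {t : ℝ} (ht : 0 < t) :
    ∫ z, |heatKx t z| = (√t)⁻¹ * ∫ z, |heatKx 1 z| := by
  have hs := Real.sqrt_pos.2 ht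
  have h := Measure.integral_comp_mul_left (fun z => |heatKx t z|) (√t)
  simp only [heatKx_scale ht, abs_mul] at h
  rw [integral_const_mul, abs_of_pos (by positivity), abs_of_pos (by positivity), smul_eq_mul,
    eq_inv_mul_iff_mul_eq₀ hs.ne'] at h
  rw [← h, ← mul_assoc]
  congr 1
  have := Real.sq_sqrt ht.le
  field_simp
  exact this

/-- The heat kernel is an approximate identity. -/
theorem tendsto_heatK_approx {w : ℝ → ℝ} {x M : ℝ} (hwm : Measurable w) (hM : ∀ z, |w z| ≤ M)
    (hc : ContinuousAt w x) :
    Tendsto (fun t => ∫ z, heatK 0 t (x - z) * w z) (𝓝[>] 0) (𝓝 (w x)) := by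
  have h1 : Tendsto (fun t => ∫ v, heatK 0 1 v * w (x - √t * v)) (𝓝[>] 0)
      (𝓝 (∫ v, heatK 0 1 v * w x)) := by
    refine tendsto_integral_filter_of_dominated_convergence (fun v => heatK 0 1 v * M)
      (Eventually.of_forall fun t => ?_) (Eventually.of_forall fun t => Eventually.of_forall fun v => ?_)
      (integrable_heatK_time_one.mul_const M) (Eventually.of_forall fun v => ?_)
    · exact integrable_heatK_time_one.aestronglyMeasurable.mul
        (hwm.comp (by fun_prop)).aestronglyMeasurable
    · rw [norm_mul, Real.norm_of_nonneg (heatK_nonneg _ _ _)]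
      have := heatK_nonneg 0 1 v
      gcongr
      exact hM _
    · refine Tendsto.const_mul _ ?_
      have h2 : Tendsto (fun t : ℝ => x - √t * v) (𝓝[>] 0) (𝓝 x) := by
        refine tendsto_nhdsWithin_of_tendsto_nhds ?_
        refine Continuous.tendsto' (by fun_prop) _ _ ?_
        simp
      exact hc.tendsto.comp h2
  rw [integral_mul_const, integral_heatK_time_one, one_mul] at h1
  refine h1.congr' ?_
  filter_upwards [self_mem_nhdsWithin] with t ht
  have ht : 0 < t := ht
  have hs := Real.sqrt_pos.2 ht
  have h := Measure.integral_comp_mul_left (fun z => heatK 0 t z * w (x - z)) (√t)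
  simp only [heatK_zero_scale ht, mul_assoc] at h
  rw [integral_const_mul, abs_of_pos (by positivity), smul_eq_mul] at h
  rw [mul_left_cancel₀ (inv_ne_zero hs.ne') h,
    ← integral_sub_left_eq_self (fun z => heatK 0 t z * w (x - z)) volume x]
  simp

/-! ### The heat potential of the strip -/

/-- Kernels that vanish for nonpositive times and are continuous away from the origin. -/
structure IsKernel (K : ℝ → ℝ → ℝ) : Prop where
  zero : ∀ t ≤ 0, ∀ x, K t x = 0
  meas : Measurable fun p : ℝ × ℝ => K p.1 p.2
  cont : ∀ p : ℝ × ℝ, p ≠ 0 → ContinuousAt (fun p : ℝ × ℝ => K p.1 p.2) p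

theorem isKernel_heatK (j : ℕ) : IsKernel (heatK j) :=
  ⟨fun _ ht x => heatK_of_nonpos j ht x, measurable_heatK j, fun _ hp => continuousAt_heatK j hp⟩

theorem isKernel_heatKx : IsKernel heatKx :=
  ⟨fun _ ht x => heatKx_of_nonpos ht x, measurable_heatKx, fun _ hp => continuousAt_heatKx hp⟩

theorem isKernel_heatKxx : IsKernel heatKxx :=
  ⟨fun _ ht x => heatKxx_of_nonpos ht x, measurable_heatKxx, fun _ hp => continuousAt_heatKxx hp⟩

theorem IsKernel.const_mul {K : ℝ → ℝ → ℝ} (hK : IsKernel K) (c : ℝ) :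
    IsKernel fun t x => c * K t x :=
  ⟨fun t ht x => by simp [hK.zero t ht x], hK.meas.const_mul c,
    fun p hp => continuousAt_const.mul (hK.cont p hp)⟩

/-- The potential of the initial density `w` on `(0, 1)` and of its reflections at `0` and `1`. -/
noncomputable def initialPotential (K : ℝ → ℝ → ℝ) (w : ℝ → ℝ) (t x : ℝ) : ℝ :=
  curvePotential K (fun _ => 0) (fun z => 0 + 1 * z) w 0 1 t x +
  curvePotential K (fun _ => 0) (fun z => 0 + -1 * z) w 0 1 t x +
  curvePotential K (fun _ => 0) (fun z => 2 + -1 * z) w 0 1 t x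

/-- The heat potential on `(0, 1)` with initial density `w` and boundary layers `a`, `b`. -/
noncomputable def stripPotential (K : ℝ → ℝ → ℝ) (w a b : ℝ → ℝ) (t x : ℝ) : ℝ :=
  initialPotential K w t x + 2 * layer K a t x + 2 * layer K b t (x - 1)

section Strip

variable {K K' : ℝ → ℝ → ℝ} {w a b : ℝ → ℝ}

theorem continuousAt_initialPotential (hK : IsKernel K) (hw : IntegrableOn w (Ioo 0 1))
    {p : ℝ × ℝ} (hp : p.1 ≠ 0) :
    ContinuousAt (fun q : ℝ × ℝ => initialPotential K w q.1 q.2) p := by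
  have h : ∀ c ε : ℝ, ContinuousAt
      (fun q : ℝ × ℝ => curvePotential K (fun _ => 0) (fun z => c + ε * z) w 0 1 q.1 q.2) p :=
    fun c ε => continuousAt_potential hK.meas hK.cont continuous_const (by fun_prop) hw
      fun z _ h => hp (by simpa using congrArg Prod.fst h)
  exact ((h 0 1).add (h 0 (-1))).add (h 2 (-1))

theorem continuousAt_stripPotential (hK : IsKernel K) (hw : IntegrableOn w (Ioo 0 1))
    (ha : IsDensity a) (hb : IsDensity b) {p : ℝ × ℝ} (hp : p.1 ≠ 0) (hx : p.2 ∈ Ioo (0 : ℝ) 1) :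
    ContinuousAt (fun q : ℝ × ℝ => stripPotential K w a b q.1 q.2) p := by
  have h1 := continuousAt_layer hK.zero hK.meas hK.cont ha hx.1.ne'
  have h2 : ContinuousAt (fun q : ℝ × ℝ => layer K b q.1 (q.2 - 1)) p :=
    ContinuousAt.comp (g := fun q : ℝ × ℝ => layer K b q.1 q.2)
      (f := fun q : ℝ × ℝ => (q.1, q.2 - 1)) (x := p)
      (continuousAt_layer hK.zero hK.meas hK.cont hb (p := (p.1, p.2 - 1)) (by
        simp only; linarith [hx.2])) (by fun_prop)
  exact ((continuousAt_initialPotential hK hw hp).add (continuousAt_const.mul h1)).add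
    (continuousAt_const.mul h2)

theorem hasDerivAt_stripPotential_right (hK : IsKernel K) (hK' : IsKernel K')
    (hd : ∀ t x, HasDerivAt (fun x => K t x) (K' t x) x) (hw : IntegrableOn w (Ioo 0 1))
    (ha : IsDensity a) (hb : IsDensity b) {t x : ℝ} (ht : t ≠ 0) (hx : x ∈ Ioo (0 : ℝ) 1) :
    HasDerivAt (fun x => stripPotential K w a b t x) (stripPotential K' w a b t x) x := by
  have h : ∀ c ε : ℝ, HasDerivAt
      (fun x => curvePotential K (fun _ => 0) (fun z => c + ε * z) w 0 1 t x)
      (curvePotential K' (fun _ => 0) (fun z => c + ε * z) w 0 1 t x) x :=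
    fun c ε => hasDerivAt_potential_right hK.meas hK.cont hK'.meas hK'.cont hd continuous_const
      (by fun_prop) hw fun z _ h => ht (by simpa using congrArg Prod.fst h)
  have h1 := hasDerivAt_layer_right hK.zero hK'.zero hK.meas hK.cont hK'.meas hK'.cont hd ha
    (t := t) hx.1.ne'
  have h2 := HasDerivAt.comp_sub_const x 1 (hasDerivAt_layer_right hK.zero hK'.zero hK.meas hK.cont
    hK'.meas hK'.cont hd hb (t := t) (x := x - 1) (by linarith [hx.2]))
  exact ((((h 0 1).add (h 0 (-1))).add (h 2 (-1))).add (h1.const_mul 2)).add (h2.const_mul 2)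

theorem hasDerivAt_stripPotential_left (hK : IsKernel K) (hK' : IsKernel K')
    (hd : ∀ t x, (t, x) ≠ 0 → HasDerivAt (fun t => K t x) (K' t x) t)
    (hw : IntegrableOn w (Ioo 0 1))
    (ha : IsDensity a) (hb : IsDensity b) {t x : ℝ} (ht : t ≠ 0) (hx : x ∈ Ioo (0 : ℝ) 1) :
    HasDerivAt (fun t => stripPotential K w a b t x) (stripPotential K' w a b t x) t := by
  have h : ∀ c ε : ℝ, HasDerivAt
      (fun t => curvePotential K (fun _ => 0) (fun z => c + ε * z) w 0 1 t x)
      (curvePotential K' (fun _ => 0) (fun z => c + ε * z) w 0 1 t x) t :=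
    fun c ε => hasDerivAt_potential_left hK.meas hK.cont hK'.meas hK'.cont hd continuous_const
      (by fun_prop) hw fun z _ h => ht (by simpa using congrArg Prod.fst h)
  have h1 := hasDerivAt_layer_left hK.zero hK'.zero hK.meas hK.cont hK'.meas hK'.cont hd ha
    (t := t) hx.1.ne'
  have h2 := hasDerivAt_layer_left hK.zero hK'.zero hK.meas hK.cont
    hK'.meas hK'.cont hd hb (t := t) (x := x - 1) (by linarith [hx.2])
  exact ((((h 0 1).add (h 0 (-1))).add (h 2 (-1))).add (h1.const_mul 2)).add (h2.const_mul 2)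

theorem curvePotential_reflect {ε : ℝ} (hK : ∀ t x, K t (-x) = ε * K t x) (c δ : ℝ) (t x : ℝ) :
    curvePotential K (fun _ => 0) (fun z => c + δ * z) w 0 1 t (1 - x) =
      ε * curvePotential K (fun _ => 0) (fun z => (1 - c - δ) + δ * z) (fun z => w (1 - z))
        0 1 t x := by
  unfold curvePotential
  rw [← integral_Ioc_eq_integral_Ioo, ← integral_Ioc_eq_integral_Ioo,
    ← intervalIntegral.integral_of_le zero_le_one, ← intervalIntegral.integral_of_le zero_le_one,
    ← intervalIntegral.integral_const_mul]
  have := intervalIntegral.integral_comp_sub_left (a := 0) (b := 1)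
    (fun z => K (t - 0) (1 - x - (c + δ * z)) * w z) 1
  simp only [sub_zero, sub_self] at this ⊢
  rw [← this]
  refine intervalIntegral.integral_congr fun z _ => ?_
  rw [← mul_assoc, ← hK]
  congr 2
  ring

/-- The reflection x ↦ 1 - x fixes the carrier z and exchanges the two image carriers -z and 2 - z,
so the family of images is invariant. -/
theorem initialPotential_reflect {ε : ℝ} (hK : ∀ t x, K t (-x) = ε * K t x) (t x : ℝ) :
    initialPotential K w t (1 - x) = ε * initialPotential K (fun z => w (1 - z)) t x := by
  unfold initialPotential
  rw [curvePotential_reflect hK, curvePotential_reflect hK, curvePotential_reflect hK]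
  norm_num
  ring

/-- This reduces the boundary behaviour at 1 to that at 0, with the two layers exchanged and the
datum reflected. The sign ε is 1 for the potential itself and -1 for its spatial derivative. -/
theorem stripPotential_reflect {ε : ℝ} (hK : ∀ t x, K t (-x) = ε * K t x) (t x : ℝ) :
    stripPotential K w a b t (1 - x) = ε * stripPotential K (fun z => w (1 - z)) b a t x := by
  unfold stripPotential
  rw [initialPotential_reflect hK, show (1 - x : ℝ) = -(x - 1) by ring, layer_neg hK,
    show (-(x - 1) - 1 : ℝ) = -x by ring, layer_neg hK]
  ring

theorem abs_initialPotential_heatK_le (hw : ∀ z ∈ Ioo (0 : ℝ) 1, |w z| ≤ 1) {t : ℝ} (ht : 0 < t)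
    (x : ℝ) : |initialPotential (heatK 0) w t x| ≤ 3 := by
  have h : ∀ c ε : ℝ, ε = 1 ∨ ε = -1 →
      |curvePotential (heatK 0) (fun _ => 0) (fun z => c + ε * z) w 0 1 t x| ≤ 1 := fun c ε hε => by
    refine (abs_curvePotential_affine_le (integrable_heatK ht) hw hε c x).trans ?_
    simp only [abs_of_nonneg (heatK_nonneg _ _ _)]
    exact (integral_heatK ht).le
  unfold initialPotential
  have h1 := h 0 1 (Or.inl rfl)
  have h2 := h 0 (-1) (Or.inr rfl)
  have h3 := h 2 (-1) (Or.inr rfl)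
  refine (abs_add_three _ _ _).trans ?_
  linarith

theorem abs_initialPotential_heatKx_le (hw : ∀ z ∈ Ioo (0 : ℝ) 1, |w z| ≤ 1) {t : ℝ} (ht : 0 < t)
    (x : ℝ) : |initialPotential heatKx w t x| ≤ 3 * (∫ z, |heatKx 1 z|) * (√t)⁻¹ := by
  have h : ∀ c ε : ℝ, ε = 1 ∨ ε = -1 →
      |curvePotential heatKx (fun _ => 0) (fun z => c + ε * z) w 0 1 t x| ≤
        (√t)⁻¹ * ∫ z, |heatKx 1 z| := fun c ε hε => by
    refine (abs_curvePotential_affine_le (integrable_heatKx ht) hw hε c x).trans ?_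
    exact (integral_abs_heatKx ht).le
  unfold initialPotential
  have h1 := h 0 1 (Or.inl rfl)
  have h2 := h 0 (-1) (Or.inr rfl)
  have h3 := h 2 (-1) (Or.inr rfl)
  refine (abs_add_three _ _ _).trans ?_
  linarith

theorem exists_abs_heatKx_le : ∃ C : ℝ, 0 ≤ C ∧ ∀ t x : ℝ, 1 ≤ |x| → |heatKx t x| ≤ C := by
  obtain ⟨C, hC0, hC⟩ := exists_heatK_mul_pow_le 1
  refine ⟨C, hC0, fun t x hx => le_trans ?_ (hC t x)⟩
  rw [heatKx, abs_mul, abs_neg, abs_of_nonneg (heatK_nonneg _ _ _), mul_comm]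
  have := heatK_nonneg 1 t x
  gcongr
  exact le_self_pow₀ hx (by norm_num)

/-- The flux of the reflected initial potential through the boundary is bounded, uniformly in
time. -/
theorem exists_abs_initialPotential_heatKx_zero_le :
    ∃ C : ℝ, 0 ≤ C ∧ ∀ w : ℝ → ℝ, (∀ z ∈ Ioo (0 : ℝ) 1, |w z| ≤ 1) → ∀ t,
      |initialPotential heatKx w t 0| ≤ C := by
  obtain ⟨C, hC0, hC⟩ := exists_abs_heatKx_le
  refine ⟨C, hC0, fun w hw t => ?_⟩
  -- At the wall the derivatives of the datum and of its image at -z cancel by oddness. What remains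
  -- is the image at 2 - z, at distance at least 1, where `heatKx` is bounded for all times; without
  -- the cancellation the bound would be of order t^{-1/2}.
  have h1 : curvePotential heatKx (fun _ => 0) (fun z => 0 + 1 * z) w 0 1 t 0 +
      curvePotential heatKx (fun _ => 0) (fun z => 0 + -1 * z) w 0 1 t 0 = 0 := by
    unfold curvePotential
    rw [← eq_neg_iff_add_eq_zero, ← integral_neg]
    congr 1; ext z
    rw [← neg_mul, ← heatKx_neg]
    congr 2; ring
  rw [initialPotential, h1, zero_add, curvePotential, ← Real.norm_eq_abs]
  refine (norm_setIntegral_le_of_norm_le_const (C := C) (by simp) fun z hz => ?_).trans ?_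
  · rw [norm_mul, ← mul_one C]
    gcongr
    · refine hC _ _ ?_
      rw [abs_of_neg (by linarith [hz.2])]
      linarith [hz.2]
    · exact hw z hz
  · simp

theorem tendsto_stripPotential_left (hw : IntegrableOn w (Ioo 0 1)) (ha : IsDensity a)
    (hb : IsDensity b) {t : ℝ} (ht : 0 < t) :
    Tendsto (fun x => stripPotential (heatK 0) w a b t x) (𝓝[>] 0)
      (𝓝 (stripPotential (heatK 0) w a b t 0)) := by
  have h1 : ContinuousAt (fun x => initialPotential (heatK 0) w t x) 0 :=
    ContinuousAt.comp (g := fun q : ℝ × ℝ => initialPotential (heatK 0) w q.1 q.2)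
      (f := fun x : ℝ => (t, x)) (x := 0)
      (continuousAt_initialPotential (isKernel_heatK 0) hw ht.ne') (by fun_prop)
  have h2 := (continuous_layer_heatK_right ha t).continuousAt (x := 0)
  have h3 : ContinuousAt (fun x => layer (heatK 0) b t (x - 1)) 0 :=
    ((continuous_layer_heatK_right hb t).comp (continuous_id.sub continuous_const)).continuousAt
  exact ((h1.add (continuousAt_const.mul h2)).add (continuousAt_const.mul h3)).tendsto.mono_left
    nhdsWithin_le_nhds

/-- Only the layer on the near wall jumps. The far layer is at distance 1, where the derivative
kernel at -1 equals `heatK 1` at 1. Half of this limit is the flux that enters the boundary system.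
-/
theorem tendsto_stripPotential_heatKx_left (hw : IntegrableOn w (Ioo 0 1)) (ha : IsDensity a)
    (hb : IsDensity b) {t : ℝ} (ht : 0 < t) :
    Tendsto (fun x => stripPotential heatKx w a b t x) (𝓝[>] 0)
      (𝓝 (initialPotential heatKx w t 0 - 2 * a t + 2 * ∫ s, heatK 1 (t - s) 1 * b s)) := by
  have h1 : ContinuousAt (fun x => initialPotential heatKx w t x) 0 :=
    ContinuousAt.comp (g := fun q : ℝ × ℝ => initialPotential heatKx w q.1 q.2)
      (f := fun x : ℝ => (t, x)) (x := 0)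
      (continuousAt_initialPotential isKernel_heatKx hw ht.ne') (by fun_prop)
  have h2 := tendsto_layer_heatKx ha ht
  have h3 : ContinuousAt (fun x => layer heatKx b t (x - 1)) 0 :=
    ContinuousAt.comp (g := fun q : ℝ × ℝ => layer heatKx b q.1 q.2)
      (f := fun x : ℝ => (t, x - 1)) (x := 0)
      (continuousAt_layer isKernel_heatKx.zero isKernel_heatKx.meas isKernel_heatKx.cont hb
        (p := (t, 0 - 1)) (by norm_num)) (by fun_prop)
  have h4 : layer heatKx b t (0 - 1) = ∫ s, heatK 1 (t - s) 1 * b s := by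
    simp [layer, heatKx, heatK_neg]
  have h3 := h3.tendsto
  rw [h4] at h3
  have := ((h1.tendsto.mono_left nhdsWithin_le_nhds).add (h2.const_mul 2)).add
    ((h3.mono_left nhdsWithin_le_nhds).const_mul 2)
  rwa [mul_neg, ← sub_eq_add_neg] at this

/-- Only the direct potential survives, by the approximate identity. At an interior point the image
carriers and the walls are at positive distance, so their potentials are continuous across t = 0,
where they vanish. -/
theorem tendsto_stripPotential_zero (hwm : Measurable w) (hw : ∀ z, |w z| ≤ 1)
    (hw0 : ∀ z ∉ Ioo (0 : ℝ) 1, w z = 0)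
    (ha : IsDensity a) (hb : IsDensity b) {x : ℝ} (hx : x ∈ Ioo (0 : ℝ) 1) (hc : ContinuousAt w x) :
    Tendsto (fun t => stripPotential (heatK 0) w a b t x) (𝓝[>] 0) (𝓝 (w x)) := by
  have hK := isKernel_heatK 0
  have hwi : IntegrableOn w (Ioo 0 1) :=
    Measure.integrableOn_of_bounded (M := 1) (by simp) hwm.aestronglyMeasurable
      (Eventually.of_forall hw)
  have h1 : Tendsto (fun t => curvePotential (heatK 0) (fun _ => 0) (fun z => 0 + 1 * z) w 0 1 t x)
      (𝓝[>] 0) (𝓝 (w x)) := by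
    refine (tendsto_heatK_approx hwm hw hc).congr fun t => ?_
    simp only [curvePotential, sub_zero, zero_add, one_mul]
    rw [setIntegral_eq_integral_of_forall_compl_eq_zero]
    intro z hz
    rw [hw0 z hz, mul_zero]
  have h2 : ∀ c : ℝ, (∀ z ∈ Icc (0 : ℝ) 1, x - (c + -1 * z) ≠ 0) →
      Tendsto (fun t => curvePotential (heatK 0) (fun _ => 0) (fun z => c + -1 * z) w 0 1 t x)
      (𝓝[>] 0) (𝓝 0) := fun c h => by
    have h3 : ContinuousAt (fun t => curvePotential (heatK 0) (fun _ => 0)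
        (fun z => c + -1 * z) w 0 1 t x) 0 :=
      ContinuousAt.comp (g := fun q : ℝ × ℝ => curvePotential (heatK 0) (fun _ => 0)
        (fun z => c + -1 * z) w 0 1 q.1 q.2) (f := fun t : ℝ => (t, x)) (x := 0)
        (continuousAt_potential hK.meas hK.cont continuous_const (by fun_prop) hwi
          fun z hz h' => h z hz (congrArg Prod.snd h')) (by fun_prop)
    have h4 : curvePotential (heatK 0) (fun _ => 0) (fun z => c + -1 * z) w 0 1 0 x = 0 := by
      simp [curvePotential, heatK_of_nonpos]
    have := h3.tendsto.mono_left (nhdsWithin_le_nhds (s := Ioi 0))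
    rwa [h4] at this
  have h5 : ∀ (a : ℝ → ℝ) (x : ℝ), IsDensity a → x ≠ 0 →
      Tendsto (fun t => layer (heatK 0) a t x) (𝓝[>] 0) (𝓝 0) := fun a x ha hx => by
    have h3 : ContinuousAt (fun t => layer (heatK 0) a t x) 0 :=
      ContinuousAt.comp (g := fun q : ℝ × ℝ => layer (heatK 0) a q.1 q.2)
        (f := fun t : ℝ => (t, x)) (x := 0)
        (continuousAt_layer hK.zero hK.meas hK.cont ha (p := (0, x)) hx) (by fun_prop)
    have := h3.tendsto.mono_left (nhdsWithin_le_nhds (s := Ioi 0))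
    rwa [layer_of_nonpos hK.zero ha le_rfl] at this
  have h6 := h2 0 fun z hz => by have := hz.1; have := hx.1; intro h; linarith
  have h7 := h2 2 fun z hz => by have := hz.2; have := hx.2; intro h; linarith
  have := (((h1.add h6).add h7).add ((h5 a x ha hx.1.ne').const_mul 2)).add
    ((h5 b (x - 1) hb (by linarith [hx.2])).const_mul 2)
  simp only [mul_zero, add_zero] at this
  exact this

end Strip

/-! ### Integration on rectangles and slices -/

theorem integrable_prod_of_continuousOn {f : ℝ → ℝ → ℝ} {a b c d : ℝ}
    (hf : ContinuousOn (fun p : ℝ × ℝ => f p.1 p.2) (Icc a b ×ˢ Icc c d)) :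
    Integrable (Function.uncurry f)
      ((volume.restrict (Ioc a b)).prod (volume.restrict (Ioc c d))) := by
  rw [Measure.prod_restrict]
  exact (hf.integrableOn_compact (isCompact_Icc.prod isCompact_Icc)).mono_set
    (prod_mono Ioc_subset_Icc_self Ioc_subset_Icc_self)

theorem intervalIntegral_swap_of_continuousOn {f : ℝ → ℝ → ℝ} {a b c d : ℝ} (hab : a ≤ b)
    (hcd : c ≤ d) (hf : ContinuousOn (fun p : ℝ × ℝ => f p.1 p.2) (Icc a b ×ˢ Icc c d)) :
    ∫ x in a..b, ∫ y in c..d, f x y = ∫ y in c..d, ∫ x in a..b, f x y := by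
  simp only [intervalIntegral.integral_of_le hab, intervalIntegral.integral_of_le hcd]
  exact integral_integral_swap (integrable_prod_of_continuousOn hf)

theorem intervalIntegrable_integral_of_continuousOn {f : ℝ → ℝ → ℝ} {a b c d : ℝ} (hab : a ≤ b)
    (hcd : c ≤ d) (hf : ContinuousOn (fun p : ℝ × ℝ => f p.1 p.2) (Icc a b ×ˢ Icc c d)) :
    IntervalIntegrable (fun y => ∫ x in a..b, f x y) volume c d := by
  rw [intervalIntegrable_iff_integrableOn_Ioc_of_le hcd]
  simp only [intervalIntegral.integral_of_le hab]
  exact (integrable_prod_of_continuousOn hf).integral_prod_right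

theorem continuousOn_slice_left {f : ℝ → ℝ → ℝ} {S T : Set ℝ} {y : ℝ} (hy : y ∈ T)
    (hf : ContinuousOn (fun p : ℝ × ℝ => f p.1 p.2) (S ×ˢ T)) :
    ContinuousOn (fun x => f x y) S :=
  ContinuousOn.comp (g := fun p : ℝ × ℝ => f p.1 p.2) (f := fun x => (x, y)) hf
    (by fun_prop) fun _ hx => ⟨hx, hy⟩

theorem continuousOn_slice_right {f : ℝ → ℝ → ℝ} {S T : Set ℝ} {x : ℝ} (hx : x ∈ S)
    (hf : ContinuousOn (fun p : ℝ × ℝ => f p.1 p.2) (S ×ˢ T)) :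
    ContinuousOn (fun y => f x y) T :=
  ContinuousOn.comp (g := fun p : ℝ × ℝ => f p.1 p.2) (f := fun y => (x, y)) hf
    (by fun_prop) fun _ hy => ⟨hx, hy⟩

/-! ### Invariance of the interval [0,1] -/

/-- The cases k = 1 and k = 0 make the cubed negative part twice continuously differentiable, as the
convex dissipation argument needs; the square would not be smooth enough. -/
theorem hasDerivAt_max_neg_zero_pow (k : ℕ) (x : ℝ) :
    HasDerivAt (fun x : ℝ => max (-x) 0 ^ (k + 2)) (-((k + 2 : ℕ) : ℝ) * max (-x) 0 ^ (k + 1)) x := by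
  rcases lt_trichotomy x 0 with h | h | h
  · have e : (fun x : ℝ => max (-x) 0 ^ (k + 2)) =ᶠ[𝓝 x] fun x => (-x) ^ (k + 2) := by
      filter_upwards [gt_mem_nhds h] with y hy
      rw [max_eq_left (by linarith)]
    refine HasDerivAt.congr_of_eventuallyEq ?_ e
    rw [max_eq_left (by linarith)]
    refine ((hasDerivAt_neg x).pow (k + 2)).congr_deriv ?_
    simp; ring
  · subst h
    rw [hasDerivAt_iff_isLittleO_nhds_zero]
    have : (fun h : ℝ => max (-h) 0 ^ (k + 2)) =O[𝓝 0] fun h : ℝ => h ^ (k + 2) := by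
      refine Asymptotics.IsBigO.of_bound 1 (Eventually.of_forall fun h => ?_)
      rw [one_mul, norm_pow, norm_pow]
      gcongr
      rw [Real.norm_eq_abs, Real.norm_eq_abs, abs_of_nonneg (le_max_right _ _)]
      exact max_le (neg_le_abs h) (abs_nonneg h)
    simpa using this.trans_isLittleO (Asymptotics.isLittleO_pow_id (by omega))
  · have e : (fun x : ℝ => max (-x) 0 ^ (k + 2)) =ᶠ[𝓝 x] fun x => 0 := by
      filter_upwards [lt_mem_nhds h] with y hy
      rw [max_eq_right (by linarith)]
      simp
    refine HasDerivAt.congr_of_eventuallyEq ?_ e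
    rw [max_eq_right (by linarith)]
    simpa using hasDerivAt_const x (0 : ℝ)

/-- A classical solution of the coupled system whose flux is regular up to the boundary. -/
structure IsRegularSolution (σ : ℝ) (u₀ : ℝ → ℝ) (vm vp : ℝ) (u ux uxx : ℝ → ℝ → ℝ)
    (um up gm gp ρm ρp : ℝ → ℝ) : Prop where
  cont : ContinuousOn (fun p : ℝ × ℝ => u p.1 p.2) (Ioo 0 1 ×ˢ Ioi 0)
  cont_x : ContinuousOn (fun p : ℝ × ℝ => ux p.1 p.2) (Ioo 0 1 ×ˢ Ioi 0)
  cont_xx : ContinuousOn (fun p : ℝ × ℝ => uxx p.1 p.2) (Ioo 0 1 ×ˢ Ioi 0)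
  deriv_x : ∀ r ∈ Ioo (0 : ℝ) 1, ∀ t > 0, HasDerivAt (fun x => u x t) (ux r t) r
  deriv_xx : ∀ r ∈ Ioo (0 : ℝ) 1, ∀ t > 0, HasDerivAt (fun x => ux x t) (uxx r t) r
  deriv_t : ∀ r ∈ Ioo (0 : ℝ) 1, ∀ t > 0, HasDerivAt (fun s => u r s) (1 / 2 * uxx r t) t
  bdd : ∀ T, ∃ M, ∀ r ∈ Ioo (0 : ℝ) 1, ∀ t ∈ Ioc 0 T, |u r t| ≤ M
  bdd_x : ∀ t₀ > 0, ∀ T, ∃ M, ∀ r ∈ Ioo (0 : ℝ) 1, ∀ t ∈ Icc t₀ T, |ux r t| ≤ M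
  left : ∀ t > 0, Tendsto (fun r => u r t) (𝓝[>] 0) (𝓝 (um t))
  right : ∀ t > 0, Tendsto (fun r => u r t) (𝓝[<] 1) (𝓝 (up t))
  flux_left : ∀ t > 0, Tendsto (fun r => 1 / 2 * ux r t) (𝓝[>] 0) (𝓝 (gm t))
  flux_right : ∀ t > 0, Tendsto (fun r => 1 / 2 * ux r t) (𝓝[<] 1) (𝓝 (-gp t))
  initial : ∀ r ∈ Ioo (0 : ℝ) 1, Tendsto (fun t => u r t) (𝓝[>] 0) (𝓝 (u₀ r))
  cont_gm : ContinuousOn gm (Ioi 0)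
  cont_gp : ContinuousOn gp (Ioi 0)
  gm_eq : ∀ t > 0, gm t = σ⁻¹ * (um t - ρm t)
  gp_eq : ∀ t > 0, gp t = σ⁻¹ * (up t - ρp t)
  deriv_m : ∀ t > 0, HasDerivAt ρm (gm t) t
  deriv_p : ∀ t > 0, HasDerivAt ρp (gp t) t
  init_m : Tendsto ρm (𝓝[>] 0) (𝓝 vm)
  init_p : Tendsto ρp (𝓝[>] 0) (𝓝 vp)

namespace IsRegularSolution

variable {σ vm vp : ℝ} {u₀ : ℝ → ℝ} {u ux uxx : ℝ → ℝ → ℝ} {um up gm gp ρm ρp : ℝ → ℝ}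

/-- The system is invariant under u ↦ 1 - u, so the upper bound is an instance of the lower one. -/
theorem one_sub (h : IsRegularSolution σ u₀ vm vp u ux uxx um up gm gp ρm ρp) :
    IsRegularSolution σ (fun r => 1 - u₀ r) (1 - vm) (1 - vp) (fun r t => 1 - u r t)
      (fun r t => -ux r t) (fun r t => -uxx r t) (fun t => 1 - um t) (fun t => 1 - up t)
      (fun t => -gm t) (fun t => -gp t) (fun t => 1 - ρm t) (fun t => 1 - ρp t) where
  cont := continuousOn_const.sub h.cont
  cont_x := h.cont_x.neg
  cont_xx := h.cont_xx.neg
  deriv_x r hr t ht := (h.deriv_x r hr t ht).const_sub 1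
  deriv_xx r hr t ht := (h.deriv_xx r hr t ht).neg
  deriv_t r hr t ht := ((h.deriv_t r hr t ht).const_sub 1).congr_deriv (by ring)
  bdd T := by
    obtain ⟨M, hM⟩ := h.bdd T
    refine ⟨1 + M, fun r hr t ht => (abs_sub _ _).trans ?_⟩
    rw [abs_one]
    linarith [hM r hr t ht]
  bdd_x t₀ h0 T := by
    obtain ⟨M, hM⟩ := h.bdd_x t₀ h0 T
    exact ⟨M, fun r hr t ht => by rw [abs_neg]; exact hM r hr t ht⟩
  left t ht := (h.left t ht).const_sub 1
  right t ht := (h.right t ht).const_sub 1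
  flux_left t ht := by simpa using (h.flux_left t ht).neg
  flux_right t ht := by simpa using (h.flux_right t ht).neg
  initial r hr := (h.initial r hr).const_sub 1
  cont_gm := h.cont_gm.neg
  cont_gp := h.cont_gp.neg
  gm_eq t ht := by rw [h.gm_eq t ht]; ring
  gp_eq t ht := by rw [h.gp_eq t ht]; ring
  deriv_m t ht := (h.deriv_m t ht).const_sub 1
  deriv_p t ht := (h.deriv_p t ht).const_sub 1
  init_m := h.init_m.const_sub 1
  init_p := h.init_p.const_sub 1

/-- Dissipation of a convex functional on `[l, 1 - l]`. -/
theorem integral_convex_sub_le (h : IsRegularSolution σ u₀ vm vp u ux uxx um up gm gp ρm ρp)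
    {φ φ' φ'' : ℝ → ℝ} (hφ : ∀ x, HasDerivAt φ (φ' x) x) (hφ' : ∀ x, HasDerivAt φ' (φ'' x) x)
    (hc : Continuous φ'') (hpos : ∀ x, 0 ≤ φ'' x) {l t₀ t : ℝ} (hl0 : 0 < l) (hl : l ≤ 1 / 2)
    (ht₀ : 0 < t₀) (htt : t₀ ≤ t) :
    (∫ r in l..1 - l, φ (u r t)) - ∫ r in l..1 - l, φ (u r t₀) ≤
      ∫ s in t₀..t, (φ' (u (1 - l) s) * (1 / 2 * ux (1 - l) s) - φ' (u l s) * (1 / 2 * ux l s)) := by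
  have hφc : Continuous φ := continuous_iff_continuousAt.2 fun x => (hφ x).continuousAt
  have hφc' : Continuous φ' := continuous_iff_continuousAt.2 fun x => (hφ' x).continuousAt
  have hll : l ≤ 1 - l := by linarith
  have hsub : Icc l (1 - l) ⊆ Ioo 0 1 := fun r hr => ⟨by linarith [hr.1], by linarith [hr.2]⟩
  have hsubt : Icc t₀ t ⊆ Ioi 0 := fun s hs => lt_of_lt_of_le ht₀ hs.1
  have hS : Icc l (1 - l) ×ˢ Icc t₀ t ⊆ Ioo 0 1 ×ˢ Ioi 0 := prod_mono hsub hsubt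
  have hlm : l ∈ Ioo (0 : ℝ) 1 := hsub ⟨le_rfl, hll⟩
  have hlm' : 1 - l ∈ Ioo (0 : ℝ) 1 := hsub ⟨hll, le_rfl⟩
  have hcf : ContinuousOn (fun p : ℝ × ℝ => φ' (u p.1 p.2) * (1 / 2 * uxx p.1 p.2))
      (Icc l (1 - l) ×ˢ Icc t₀ t) :=
    (hφc'.comp_continuousOn (h.cont.mono hS)).mul (continuousOn_const.mul (h.cont_xx.mono hS))
  have hint : ∀ t > 0, IntervalIntegrable (fun r => φ (u r t)) volume l (1 - l) := fun t ht => by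
    refine ContinuousOn.intervalIntegrable ?_
    rw [uIcc_of_le hll]
    exact hφc.comp_continuousOn ((continuousOn_slice_left ht h.cont).mono hsub)
  rw [← intervalIntegral.integral_sub (hint t (by linarith)) (hint t₀ ht₀)]
  have e1 : ∫ r in l..1 - l, (φ (u r t) - φ (u r t₀)) =
      ∫ r in l..1 - l, ∫ s in t₀..t, φ' (u r s) * (1 / 2 * uxx r s) := by
    refine intervalIntegral.integral_congr fun r hr => ?_
    rw [uIcc_of_le hll] at hr
    symm
    refine intervalIntegral.integral_eq_sub_of_hasDerivAt (f := fun s => φ (u r s))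
      (fun s hs => ?_) ?_
    · rw [uIcc_of_le htt] at hs
      exact (hφ (u r s)).comp s (h.deriv_t r (hsub hr) s (hsubt hs))
    · refine ContinuousOn.intervalIntegrable ?_
      rw [uIcc_of_le htt]
      exact continuousOn_slice_right (f := fun r s => φ' (u r s) * (1 / 2 * uxx r s)) hr hcf
  rw [e1, intervalIntegral_swap_of_continuousOn hll htt hcf]
  refine intervalIntegral.integral_mono_on htt
    (intervalIntegrable_integral_of_continuousOn hll htt hcf) ?_ fun s hs => ?_
  · refine ContinuousOn.intervalIntegrable ?_
    rw [uIcc_of_le htt]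
    have hu : ∀ r ∈ Ioo (0 : ℝ) 1,
        ContinuousOn (fun s => φ' (u r s) * (1 / 2 * ux r s)) (Icc t₀ t) := fun r hr =>
      (hφc'.comp_continuousOn ((continuousOn_slice_right hr h.cont).mono hsubt)).mul
        (continuousOn_const.mul ((continuousOn_slice_right hr h.cont_x).mono hsubt))
    exact (hu _ hlm').sub (hu _ hlm)
  · have hs0 : 0 < s := hsubt hs
    have c0 := (continuousOn_slice_left (show s ∈ Ioi 0 from hs0) h.cont).mono hsub
    have cx := (continuousOn_slice_left (show s ∈ Ioi 0 from hs0) h.cont_x).mono hsub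
    have cxx := (continuousOn_slice_left (show s ∈ Ioi 0 from hs0) h.cont_xx).mono hsub
    have hibp := intervalIntegral.integral_mul_deriv_eq_deriv_mul (a := l) (b := 1 - l)
      (u := fun r => φ' (u r s)) (v := fun r => 1 / 2 * ux r s)
      (u' := fun r => φ'' (u r s) * ux r s) (v' := fun r => 1 / 2 * uxx r s)
      (fun r hr => by
        rw [uIcc_of_le hll] at hr
        exact (hφ' (u r s)).comp r (h.deriv_x r (hsub hr) s hs0))
      (fun r hr => by
        rw [uIcc_of_le hll] at hr
        exact (h.deriv_xx r (hsub hr) s hs0).const_mul _)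
      (by
        refine ContinuousOn.intervalIntegrable ?_
        rw [uIcc_of_le hll]
        exact (hc.comp_continuousOn c0).mul cx)
      (by
        refine ContinuousOn.intervalIntegrable ?_
        rw [uIcc_of_le hll]
        exact continuousOn_const.mul cxx)
    -- The term discarded by the inequality is ∫ φ''(u) ½ u_x², nonnegative by convexity.
    rw [hibp, sub_le_self_iff]
    refine intervalIntegral.integral_nonneg hll fun r hr => ?_
    nlinarith [hpos (u r s), mul_nonneg (hpos (u r s)) (sq_nonneg (ux r s))]

/-- The functional ∫φ(u) + φ(ρm) + φ(ρp) with φ the cubed negative part does not increase and tends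
to 0 as t ↓ 0. The exchange between strip and reservoirs has the right sign because φ' is monotone
and the flux is a positive multiple of u - ρ. -/
theorem nonneg (h : IsRegularSolution σ u₀ vm vp u ux uxx um up gm gp ρm ρp) (hσ : 0 < σ)
    (h₀ : ∀ r ∈ Ioo (0 : ℝ) 1, 0 ≤ u₀ r) (hvm : 0 ≤ vm) (hvp : 0 ≤ vp) :
    ∀ r ∈ Ioo (0 : ℝ) 1, ∀ t > 0, 0 ≤ u r t := by
  set φ : ℝ → ℝ := fun x => max (-x) 0 ^ 3 with hφdef
  set φ' : ℝ → ℝ := fun x => -3 * max (-x) 0 ^ 2 with hφ'def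
  set φ'' : ℝ → ℝ := fun x => 6 * max (-x) 0 with hφ''def
  have hφ : ∀ x, HasDerivAt φ (φ' x) x := fun x => by
    simpa [hφdef, hφ'def] using hasDerivAt_max_neg_zero_pow 1 x
  have hφ' : ∀ x, HasDerivAt φ' (φ'' x) x := fun x => by
    refine ((hasDerivAt_max_neg_zero_pow 0 x).const_mul (-3)).congr_deriv ?_
    simp only [hφ''def]; norm_num; ring
  have hφ''c : Continuous φ'' := by fun_prop
  have hφ''pos : ∀ x, 0 ≤ φ'' x := fun x => by simp only [hφ''def]; positivity
  have hφc : Continuous φ := by fun_prop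
  have hφc' : Continuous φ' := by fun_prop
  have hφ0 : ∀ x, 0 ≤ φ x := fun x => by simp only [hφdef]; positivity
  have hφz : ∀ x, 0 ≤ x → φ x = 0 := fun x hx => by simp [hφdef, hx]
  have hmono : Monotone φ' := monotone_of_hasDerivAt_nonneg hφ' hφ''pos
  have hmul : ∀ a b, 0 ≤ (φ' a - φ' b) * (σ⁻¹ * (a - b)) := fun a b => by
    rcases le_total a b with hab | hab
    · have h1 := hmono hab
      have : (φ' a - φ' b) * (σ⁻¹ * (a - b)) = (φ' b - φ' a) * (σ⁻¹ * (b - a)) := by ring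
      rw [this]
      exact mul_nonneg (by linarith) (mul_nonneg (inv_nonneg.2 hσ.le) (by linarith))
    · have h1 := hmono hab
      exact mul_nonneg (by linarith) (mul_nonneg (inv_nonneg.2 hσ.le) (by linarith))
  -- The starting time t₀ stays positive here, so that u_x is bounded on [t₀, t] and the interval
  -- can be extended to the walls. The limit t₀ ↓ 0 is taken only afterwards.
  have key : ∀ l, 0 < l → l ≤ 1 / 2 → ∀ t > 0, ∀ t₀, 0 < t₀ → t₀ ≤ t →
      ∫ r in l..1 - l, φ (u r t) ≤ (∫ r in Ioo (0 : ℝ) 1, φ (u r t₀)) + φ (ρm t₀) + φ (ρp t₀) := by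
    intro l hl0 hl t ht t₀ ht₀ htt
    have hsubt : Icc t₀ t ⊆ Ioi 0 := fun s hs => lt_of_lt_of_le ht₀ hs.1
    obtain ⟨M, hM⟩ := h.bdd t
    obtain ⟨B, hB⟩ := h.bdd_x t₀ ht₀ t
    have hbint : ∀ s, 0 < s → s ≤ t → IntegrableOn (fun r => φ (u r s)) (Ioo 0 1) := by
      intro s hs hst
      obtain ⟨P, hP⟩ := (isCompact_Icc (a := -M) (b := M)).exists_bound_of_continuousOn
        hφc.continuousOn
      refine Integrable.mono' (g := fun _ => P) (by simp) ?_ ?_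
      · exact (hφc.comp_continuousOn
          (continuousOn_slice_left (show s ∈ Ioi 0 from hs) h.cont)).aestronglyMeasurable
          measurableSet_Ioo
      · exact (ae_restrict_iff' measurableSet_Ioo).2 (Eventually.of_forall fun r hr =>
          hP _ (abs_le.1 (hM r hr s ⟨hs, hst⟩)))
    -- The first two terms are the boundary terms of the dissipation inequality; the last two are
    -- the time derivatives of φ(ρm) and φ(ρp).
    set R : ℝ → ℝ → ℝ := fun l s => φ' (u (1 - l) s) * (1 / 2 * ux (1 - l) s)
      - φ' (u l s) * (1 / 2 * ux l s) + φ' (ρm s) * gm s + φ' (ρp s) * gp s with hR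
    have cρm : ContinuousOn ρm (Icc t₀ t) := fun s hs =>
      (h.deriv_m s (hsubt hs)).continuousAt.continuousWithinAt
    have cρp : ContinuousOn ρp (Icc t₀ t) := fun s hs =>
      (h.deriv_p s (hsubt hs)).continuousAt.continuousWithinAt
    have cm : ContinuousOn (fun s => φ' (ρm s) * gm s) (Icc t₀ t) :=
      (hφc'.comp_continuousOn cρm).mul (h.cont_gm.mono hsubt)
    have cp : ContinuousOn (fun s => φ' (ρp s) * gp s) (Icc t₀ t) :=
      (hφc'.comp_continuousOn cρp).mul (h.cont_gp.mono hsubt)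
    have cR0 : ∀ m ∈ Ioo (0 : ℝ) 1, ContinuousOn (fun s => φ' (u (1 - m) s) * (1 / 2 * ux (1 - m) s)
        - φ' (u m s) * (1 / 2 * ux m s)) (Icc t₀ t) := fun m hm => by
      have hu : ∀ r ∈ Ioo (0 : ℝ) 1,
          ContinuousOn (fun s => φ' (u r s) * (1 / 2 * ux r s)) (Icc t₀ t) := fun r hr =>
        (hφc'.comp_continuousOn ((continuousOn_slice_right hr h.cont).mono hsubt)).mul
          (continuousOn_const.mul ((continuousOn_slice_right hr h.cont_x).mono hsubt))
      exact (hu _ ⟨by linarith [hm.2], by linarith [hm.1]⟩).sub (hu _ hm)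
    have cR : ∀ m ∈ Ioo (0 : ℝ) 1, ContinuousOn (R m) (Icc t₀ t) := fun m hm =>
      ((cR0 m hm).add cm).add cp
    have step : ∀ m, 0 < m → m ≤ l → ∫ r in l..1 - l, φ (u r t) ≤
        (∫ r in Ioo (0 : ℝ) 1, φ (u r t₀)) + φ (ρm t₀) + φ (ρp t₀) + ∫ s in t₀..t, R m s := by
      intro m hm0 hml
      have hmm : m ∈ Ioo (0 : ℝ) 1 := ⟨hm0, by linarith⟩
      have h1 := h.integral_convex_sub_le hφ hφ' hφ''c hφ''pos hm0 (hml.trans hl) ht₀ htt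
      have h2 : ∫ r in l..1 - l, φ (u r t) ≤ ∫ r in m..1 - m, φ (u r t) := by
        rw [intervalIntegral.integral_of_le (by linarith), intervalIntegral.integral_of_le (by linarith)]
        refine setIntegral_mono_set ((hbint t ht le_rfl).mono_set fun r hr =>
          ⟨by linarith [hr.1], by linarith [hr.2]⟩) (Eventually.of_forall fun r => hφ0 _) ?_
        exact (Ioc_subset_Ioc hml (by linarith)).eventuallyLE
      have h3 : ∫ r in m..1 - m, φ (u r t₀) ≤ ∫ r in Ioo (0 : ℝ) 1, φ (u r t₀) := by
        rw [intervalIntegral.integral_of_le (by linarith)]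
        refine setIntegral_mono_set (hbint t₀ ht₀ htt) (Eventually.of_forall fun r => hφ0 _) ?_
        exact LE.le.eventuallyLE fun r hr => ⟨by linarith [hr.1], by linarith [hr.2]⟩
      have hFTC : ∀ ρ g : ℝ → ℝ, (∀ t > 0, HasDerivAt ρ (g t) t) →
          ContinuousOn (fun s => φ' (ρ s) * g s) (Icc t₀ t) →
          ∫ s in t₀..t, φ' (ρ s) * g s = φ (ρ t) - φ (ρ t₀) := fun ρ g hd hc => by
        refine intervalIntegral.integral_eq_sub_of_hasDerivAt (f := fun s => φ (ρ s))
          (fun s hs => ?_) ?_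
        · rw [uIcc_of_le htt] at hs
          exact (hφ (ρ s)).comp s (hd s (hsubt hs))
        · refine ContinuousOn.intervalIntegrable ?_
          rwa [uIcc_of_le htt]
      have h4 := hFTC ρm gm h.deriv_m cm
      have h5 := hFTC ρp gp h.deriv_p cp
      have h6 : ∫ s in t₀..t, R m s = (∫ s in t₀..t, (φ' (u (1 - m) s) * (1 / 2 * ux (1 - m) s)
          - φ' (u m s) * (1 / 2 * ux m s))) + (∫ s in t₀..t, φ' (ρm s) * gm s) +
          ∫ s in t₀..t, φ' (ρp s) * gp s := by
        have i0 := (cR0 m hmm).intervalIntegrable_of_Icc (μ := volume) htt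
        have i1 := cm.intervalIntegrable_of_Icc (μ := volume) htt
        have i2 := cp.intervalIntegrable_of_Icc (μ := volume) htt
        rw [← intervalIntegral.integral_add i0 i1, ← intervalIntegral.integral_add (i0.add i1) i2]
      rw [h6, h4, h5]
      linarith [hφ0 (ρm t), hφ0 (ρp t)]
    set R0 : ℝ → ℝ := fun s => φ' (up s) * (-gp s) - φ' (um s) * gm s
      + φ' (ρm s) * gm s + φ' (ρp s) * gp s with hR0
    have hone : Tendsto (fun m : ℝ => 1 - m) (𝓝[>] 0) (𝓝[<] 1) := by
      refine tendsto_nhdsWithin_iff.2 ⟨tendsto_nhdsWithin_of_tendsto_nhds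
        (Continuous.tendsto' (by fun_prop) _ _ (by simp)), ?_⟩
      filter_upwards [self_mem_nhdsWithin] with m hm
      have : (0 : ℝ) < m := hm
      simpa using this
    have hlim : Tendsto (fun m => ∫ s in t₀..t, R m s) (𝓝[>] 0) (𝓝 (∫ s in t₀..t, R0 s)) := by
      obtain ⟨P, hP⟩ := (isCompact_Icc (a := -M) (b := M)).exists_bound_of_continuousOn
        hφc'.continuousOn
      obtain ⟨Q, hQ⟩ := isCompact_Icc.exists_bound_of_continuousOn cm
      obtain ⟨Q', hQ'⟩ := isCompact_Icc.exists_bound_of_continuousOn cp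
      have hmem : ∀ᶠ m : ℝ in 𝓝[>] 0, m ∈ Ioo (0 : ℝ) 1 := Ioo_mem_nhdsGT one_pos
      refine intervalIntegral.tendsto_integral_filter_of_dominated_convergence
        (fun _ => P * (1 / 2 * B) + P * (1 / 2 * B) + Q + Q') ?_ ?_ (by simp) ?_
      · filter_upwards [hmem] with m hm
        rw [uIoc_of_le htt]
        exact ((cR m hm).mono Ioc_subset_Icc_self).aestronglyMeasurable measurableSet_Ioc
      · filter_upwards [hmem] with m hm
        refine Eventually.of_forall fun s hs => ?_
        rw [uIoc_of_le htt] at hs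
        have hs' := Ioc_subset_Icc_self hs
        have hb : ∀ r ∈ Ioo (0 : ℝ) 1, ‖φ' (u r s) * (1 / 2 * ux r s)‖ ≤ P * (1 / 2 * B) := by
          intro r hr
          have h1 := hP _ (abs_le.1 (hM r hr s ⟨hsubt hs', hs.2⟩))
          have h2 := hB r hr s hs'
          have h3 : 0 ≤ P := (norm_nonneg _).trans h1
          rw [norm_mul]
          gcongr
          rw [norm_mul, Real.norm_of_nonneg (by norm_num)]
          gcongr
          exact h2
        have h1m : 1 - m ∈ Ioo (0 : ℝ) 1 := ⟨by linarith [hm.2], by linarith [hm.1]⟩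
        refine (norm_add_le _ _).trans (add_le_add ((norm_add_le _ _).trans (add_le_add
          ((norm_sub_le _ _).trans (add_le_add (hb _ h1m) (hb _ hm))) (hQ s hs'))) (hQ' s hs'))
      · refine Eventually.of_forall fun s hs => ?_
        rw [uIoc_of_le htt] at hs
        have hs0 : 0 < s := hsubt (Ioc_subset_Icc_self hs)
        have t1 := (((hφc'.tendsto _).comp (h.right s hs0)).mul (h.flux_right s hs0)).comp hone
        have t2 := (((hφc'.tendsto _).comp (h.left s hs0)).mul (h.flux_left s hs0))
        exact ((t1.sub t2).add_const _).add_const _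
    -- In the limit the terms pair up, wall by wall, into -(φ'(u) - φ'(ρ)) g with g = σ⁻¹(u - ρ).
    have hneg : ∫ s in t₀..t, R0 s ≤ 0 := by
      have : 0 ≤ ∫ s in t₀..t, -R0 s := by
        refine intervalIntegral.integral_nonneg htt fun s hs => ?_
        have hs0 : 0 < s := hsubt hs
        have e1 := hmul (um s) (ρm s)
        have e2 := hmul (up s) (ρp s)
        rw [← h.gm_eq s hs0] at e1
        rw [← h.gp_eq s hs0] at e2
        simp only [hR0]
        linarith
      rw [intervalIntegral.integral_neg] at this
      linarith
    have := le_of_tendsto_of_tendsto tendsto_const_nhds (hlim.const_add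
      ((∫ r in Ioo (0 : ℝ) 1, φ (u r t₀)) + φ (ρm t₀) + φ (ρp t₀))) (by
        filter_upwards [Ioc_mem_nhdsGT hl0] with m hm
        exact step m hm.1 hm.2)
    linarith
  have hzero : ∀ l, 0 < l → l ≤ 1 / 2 → ∀ t > 0, ∫ r in l..1 - l, φ (u r t) ≤ 0 := by
    intro l hl0 hl t ht
    obtain ⟨M, hM⟩ := h.bdd t
    obtain ⟨P, hP⟩ := (isCompact_Icc (a := -M) (b := M)).exists_bound_of_continuousOn
      hφc.continuousOn
    have hmem : ∀ᶠ s : ℝ in 𝓝[>] 0, s ∈ Ioc 0 t := Ioc_mem_nhdsGT ht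
    have l1 : Tendsto (fun s => ∫ r in Ioo (0 : ℝ) 1, φ (u r s)) (𝓝[>] 0)
        (𝓝 (∫ r in Ioo (0 : ℝ) 1, (0 : ℝ))) := by
      refine tendsto_integral_filter_of_dominated_convergence (fun _ => P) ?_ ?_ (by simp) ?_
      · filter_upwards [hmem] with s hs
        exact (hφc.comp_continuousOn
          (continuousOn_slice_left (show s ∈ Ioi 0 from hs.1) h.cont)).aestronglyMeasurable
          measurableSet_Ioo
      · filter_upwards [hmem] with s hs
        exact (ae_restrict_iff' measurableSet_Ioo).2 (Eventually.of_forall fun r hr =>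
          hP _ (abs_le.1 (hM r hr s hs)))
      · refine (ae_restrict_iff' measurableSet_Ioo).2 (Eventually.of_forall fun r hr => ?_)
        have := (hφc.tendsto _).comp (h.initial r hr)
        rwa [hφz _ (h₀ r hr)] at this
    have l2 := (hφc.tendsto _).comp h.init_m
    have l3 := (hφc.tendsto _).comp h.init_p
    rw [hφz _ hvm] at l2
    rw [hφz _ hvp] at l3
    simp only [integral_zero] at l1
    have l4 := (l1.add l2).add l3
    simp only [add_zero] at l4
    refine ge_of_tendsto l4 ?_
    filter_upwards [hmem] with s hs
    exact key l hl0 hl t ht s hs.1 hs.2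
  intro r hr t ht
  by_contra hneg
  have hneg : u r t < 0 := not_le.1 hneg
  obtain ⟨l, hl0, hl, hrl⟩ : ∃ l, 0 < l ∧ l < 1 / 2 ∧ r ∈ Icc l (1 - l) := by
    have h1 := min_le_left (1 / 4) (min r (1 - r))
    have h2 := (min_le_right (1 / 4) (min r (1 - r))).trans (min_le_left _ _)
    have h3 := (min_le_right (1 / 4) (min r (1 - r))).trans (min_le_right _ _)
    exact ⟨min (1 / 4) (min r (1 - r)),
      lt_min (by norm_num) (lt_min hr.1 (by linarith [hr.2])), by linarith, h2, by linarith⟩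
  have hsub : Icc l (1 - l) ⊆ Ioo 0 1 := fun r hr => ⟨by linarith [hr.1], by linarith [hr.2]⟩
  have hpos : 0 < ∫ r in l..1 - l, φ (u r t) := by
    refine intervalIntegral.integral_pos (by linarith) ?_ (fun r _ => hφ0 _) ⟨r, hrl, ?_⟩
    · exact hφc.comp_continuousOn
        ((continuousOn_slice_left (show t ∈ Ioi 0 from ht) h.cont).mono hsub)
    · simp only [hφdef]
      rw [max_eq_left (by linarith)]
      have : 0 < -u r t := by linarith
      positivity
  linarith [hzero l hl0 hl.le t ht]

end IsRegularSolution

/-! ### Uniqueness: the time integral of a null solution -/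

/-- Bounded weak solutions of the coupled system with zero initial data. -/
structure IsNullSolution (σ : ℝ) (d dx dxx : ℝ → ℝ → ℝ) (bm bp δm δp : ℝ → ℝ) : Prop where
  cont : ContinuousOn (fun p : ℝ × ℝ => d p.1 p.2) (Ioo 0 1 ×ˢ Ioi 0)
  cont_x : ContinuousOn (fun p : ℝ × ℝ => dx p.1 p.2) (Ioo 0 1 ×ˢ Ioi 0)
  cont_xx : ContinuousOn (fun p : ℝ × ℝ => dxx p.1 p.2) (Ioo 0 1 ×ˢ Ioi 0)
  deriv_x : ∀ r ∈ Ioo (0 : ℝ) 1, ∀ t > 0, HasDerivAt (fun x => d x t) (dx r t) r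
  deriv_xx : ∀ r ∈ Ioo (0 : ℝ) 1, ∀ t > 0, HasDerivAt (fun x => dx x t) (dxx r t) r
  deriv_t : ∀ r ∈ Ioo (0 : ℝ) 1, ∀ t > 0, HasDerivAt (fun s => d r s) (1 / 2 * dxx r t) t
  bdd : ∃ C, ∀ r ∈ Ioo (0 : ℝ) 1, ∀ t > 0, |d r t| ≤ C
  left : ∀ t > 0, Tendsto (fun r => d r t) (𝓝[>] 0) (𝓝 (bm t))
  right : ∀ t > 0, Tendsto (fun r => d r t) (𝓝[<] 1) (𝓝 (bp t))
  cont_bm : ContinuousOn bm (Ioi 0)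
  cont_bp : ContinuousOn bp (Ioi 0)
  initial : ∀ r ∈ Ioo (0 : ℝ) 1, Tendsto (fun t => d r t) (𝓝[>] 0) (𝓝 0)
  zero_m : δm 0 = 0
  zero_p : δp 0 = 0
  cont_m : ContinuousOn δm (Ici 0)
  cont_p : ContinuousOn δp (Ici 0)
  deriv_m : ∀ t > 0, HasDerivAt δm (σ⁻¹ * (bm t - δm t)) t
  deriv_p : ∀ t > 0, HasDerivAt δp (σ⁻¹ * (bp t - δp t)) t
  flux_left : ∀ t > 0, ∃ J : ℝ → ℝ, (∀ᶠ l in 𝓝[>] 0,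
    Tendsto (fun t₀ => ∫ s in t₀..t, 1 / 2 * dx l s) (𝓝[>] 0) (𝓝 (J l))) ∧
    Tendsto J (𝓝[>] 0) (𝓝 (δm t))
  flux_right : ∀ t > 0, ∃ J : ℝ → ℝ, (∀ᶠ l in 𝓝[<] 1,
    Tendsto (fun t₀ => ∫ s in t₀..t, 1 / 2 * dx l s) (𝓝[>] 0) (𝓝 (J l))) ∧
    Tendsto J (𝓝[<] 1) (𝓝 (-δp t))

namespace IsNullSolution

variable {σ : ℝ} {d dx dxx : ℝ → ℝ → ℝ} {bm bp δm δp : ℝ → ℝ}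

theorem intervalIntegrable_right (h : IsNullSolution σ d dx dxx bm bp δm δp) {t : ℝ}
    (ht : 0 < t) {a b : ℝ} (ha : a ∈ Icc (0 : ℝ) 1) (hb : b ∈ Icc (0 : ℝ) 1) :
    IntervalIntegrable (fun y => d y t) volume a b := by
  obtain ⟨C, hC⟩ := h.bdd
  have h1 : IntegrableOn (fun y => d y t) (Ioo 0 1) := by
    refine Integrable.mono' (g := fun _ => C) (by simp) ?_ ?_
    · exact (continuousOn_slice_left (show t ∈ Ioi 0 from ht) h.cont).aestronglyMeasurable
        measurableSet_Ioo
    · exact (ae_restrict_iff' measurableSet_Ioo).2 (Eventually.of_forall fun r hr => hC r hr t ht)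
  have h2 : IntervalIntegrable (fun y => d y t) volume 0 1 := by
    rwa [intervalIntegrable_iff_integrableOn_Ioo_of_le zero_le_one]
  exact h2.mono_set (by rw [uIcc_of_le zero_le_one]; exact uIcc_subset_Icc ha hb)

theorem intervalIntegrable_left (h : IsNullSolution σ d dx dxx bm bp δm δp) {r : ℝ}
    (hr : r ∈ Ioo (0 : ℝ) 1) {t : ℝ} (ht : 0 ≤ t) :
    IntervalIntegrable (fun s => d r s) volume 0 t := by
  obtain ⟨C, hC⟩ := h.bdd
  rw [intervalIntegrable_iff_integrableOn_Ioo_of_le ht]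
  refine Integrable.mono' (g := fun _ => C) (by simp) ?_ ?_
  · exact ((continuousOn_slice_right hr h.cont).mono fun s hs => hs.1).aestronglyMeasurable
      measurableSet_Ioo
  · exact (ae_restrict_iff' measurableSet_Ioo).2 (Eventually.of_forall fun s hs => hC r hr s hs.1)

/-- Half the spatial derivative of the time integral of a null solution. -/
noncomputable def flux (d : ℝ → ℝ → ℝ) (δm : ℝ → ℝ) (r t : ℝ) : ℝ := δm t + ∫ y in (0 : ℝ)..r, d y t

theorem continuousOn_flux (h : IsNullSolution σ d dx dxx bm bp δm δp) {t : ℝ} (ht : 0 < t) :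
    ContinuousOn (fun r => flux d δm r t) (Icc 0 1) := by
  refine continuousOn_const.add ?_
  have := intervalIntegral.continuousOn_primitive_interval' (μ := volume)
    (h.intervalIntegrable_right ht (left_mem_Icc.2 zero_le_one) (right_mem_Icc.2 zero_le_one))
    (a := 0) left_mem_uIcc
  rwa [uIcc_of_le zero_le_one] at this

theorem hasDerivAt_flux (h : IsNullSolution σ d dx dxx bm bp δm δp) {t : ℝ} (ht : 0 < t) {r : ℝ}
    (hr : r ∈ Ioo (0 : ℝ) 1) : HasDerivAt (fun r => flux d δm r t) (d r t) r := by
  have hc := continuousOn_slice_left (show t ∈ Ioi 0 from ht) h.cont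
  have := intervalIntegral.integral_hasDerivAt_right
    (h.intervalIntegrable_right ht (left_mem_Icc.2 zero_le_one) (Ioo_subset_Icc_self hr))
    (hc.stronglyMeasurableAtFilter isOpen_Ioo r hr) (hc.continuousAt (Ioo_mem_nhds hr.1 hr.2))
  exact this.const_add (δm t)

/-- Conservation of mass on the rectangle [l,r] × [t₀,t]: both sides come from integrating d_t = ½
d_rr over it in the two orders. -/
theorem integral_flux_sub (h : IsNullSolution σ d dx dxx bm bp δm δp) {l r : ℝ}
    (hl : l ∈ Ioo (0 : ℝ) 1) (hr : r ∈ Ioo (0 : ℝ) 1) (hlr : l ≤ r) {t₀ t : ℝ} (ht₀ : 0 < t₀)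
    (htt : t₀ ≤ t) :
    ∫ s in t₀..t, 1 / 2 * dx r s = (∫ s in t₀..t, 1 / 2 * dx l s) +
      ((∫ y in l..r, d y t) - ∫ y in l..r, d y t₀) := by
  have hsub : Icc l r ⊆ Ioo 0 1 := fun y hy => ⟨hl.1.trans_le hy.1, hy.2.trans_lt hr.2⟩
  have hsubt : Icc t₀ t ⊆ Ioi 0 := fun s hs => lt_of_lt_of_le ht₀ hs.1
  have hS := prod_mono hsub hsubt
  have hcxx : ContinuousOn (fun p : ℝ × ℝ => 1 / 2 * dxx p.1 p.2) (Icc l r ×ˢ Icc t₀ t) :=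
    continuousOn_const.mul (h.cont_xx.mono hS)
  have hix : ∀ y ∈ Ioo (0 : ℝ) 1, IntervalIntegrable (fun s => 1 / 2 * dx y s) volume t₀ t :=
    fun y hy => (continuousOn_const.mul
      ((continuousOn_slice_right hy h.cont_x).mono hsubt)).intervalIntegrable_of_Icc htt
  have hlI := Ioo_subset_Icc_self hl
  have hrI := Ioo_subset_Icc_self hr
  rw [← sub_eq_iff_eq_add', ← intervalIntegral.integral_sub (hix r hr) (hix l hl),
    ← intervalIntegral.integral_sub (h.intervalIntegrable_right (ht₀.trans_le htt) hlI hrI)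
      (h.intervalIntegrable_right ht₀ hlI hrI)]
  have e1 : ∫ s in t₀..t, (1 / 2 * dx r s - 1 / 2 * dx l s) =
      ∫ s in t₀..t, ∫ y in l..r, 1 / 2 * dxx y s := by
    refine intervalIntegral.integral_congr fun s hs => ?_
    rw [uIcc_of_le htt] at hs
    symm
    refine intervalIntegral.integral_eq_sub_of_hasDerivAt (f := fun y => 1 / 2 * dx y s)
      (fun y hy => ?_) ?_
    · rw [uIcc_of_le hlr] at hy
      exact (h.deriv_xx y (hsub hy) s (hsubt hs)).const_mul _
    · exact (continuousOn_slice_left (f := fun r s => 1 / 2 * dxx r s) hs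
        hcxx).intervalIntegrable_of_Icc hlr
  have e2 : ∫ y in l..r, (d y t - d y t₀) = ∫ y in l..r, ∫ s in t₀..t, 1 / 2 * dxx y s := by
    refine intervalIntegral.integral_congr fun y hy => ?_
    rw [uIcc_of_le hlr] at hy
    symm
    refine intervalIntegral.integral_eq_sub_of_hasDerivAt (f := fun s => d y s)
      (fun s hs => ?_) ?_
    · rw [uIcc_of_le htt] at hs
      exact h.deriv_t y (hsub hy) s (hsubt hs)
    · exact (continuousOn_slice_right (f := fun r s => 1 / 2 * dxx r s) hy
        hcxx).intervalIntegrable_of_Icc htt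
  rw [e1, e2, intervalIntegral_swap_of_continuousOn hlr htt hcxx]

theorem tendsto_integral_initial (h : IsNullSolution σ d dx dxx bm bp δm δp) {l r : ℝ}
    (hl : l ∈ Ioo (0 : ℝ) 1) (hr : r ∈ Ioo (0 : ℝ) 1) (hlr : l ≤ r) :
    Tendsto (fun t₀ => ∫ y in l..r, d y t₀) (𝓝[>] 0) (𝓝 0) := by
  obtain ⟨C, hC⟩ := h.bdd
  have hsub : Ioc l r ⊆ Ioo 0 1 := fun y hy => ⟨hl.1.trans hy.1, hy.2.trans_lt hr.2⟩
  have : Tendsto (fun t₀ => ∫ y in l..r, d y t₀) (𝓝[>] 0) (𝓝 (∫ y in l..r, (0 : ℝ))) := by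
    refine intervalIntegral.tendsto_integral_filter_of_dominated_convergence (fun _ => C)
      ?_ ?_ (by simp) ?_
    · filter_upwards [self_mem_nhdsWithin] with s hs
      rw [uIoc_of_le hlr]
      exact ((continuousOn_slice_left (show s ∈ Ioi 0 from hs) h.cont).mono
        hsub).aestronglyMeasurable measurableSet_Ioc
    · filter_upwards [self_mem_nhdsWithin] with s hs
      refine Eventually.of_forall fun y hy => ?_
      rw [uIoc_of_le hlr] at hy
      exact hC y (hsub hy) s hs
    · refine Eventually.of_forall fun y hy => ?_
      rw [uIoc_of_le hlr] at hy
      exact h.initial y (hsub hy)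
  simpa using this

/-- Once the time-integrated flux converges at one l, mass conservation transports the convergence
to every interior r. The weak boundary condition then fixes the additive constant as δm(t). -/
theorem tendsto_integral_dx (h : IsNullSolution σ d dx dxx bm bp δm δp) {r t : ℝ}
    (hr : r ∈ Ioo (0 : ℝ) 1) (ht : 0 < t) :
    Tendsto (fun t₀ => ∫ s in t₀..t, 1 / 2 * dx r s) (𝓝[>] 0) (𝓝 (flux d δm r t)) := by
  obtain ⟨J, hJ, hJ0⟩ := h.flux_left t ht
  have hstep : ∀ l, l ∈ Ioo 0 r →
      Tendsto (fun t₀ => ∫ s in t₀..t, 1 / 2 * dx l s) (𝓝[>] 0) (𝓝 (J l)) →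
      Tendsto (fun t₀ => ∫ s in t₀..t, 1 / 2 * dx r s) (𝓝[>] 0)
        (𝓝 (J l + ∫ y in l..r, d y t)) := fun l hl hlim => by
    have hl' : l ∈ Ioo (0 : ℝ) 1 := ⟨hl.1, hl.2.trans hr.2⟩
    have h1 := hlim.add ((h.tendsto_integral_initial hl' hr hl.2.le).const_sub
      (∫ y in l..r, d y t))
    rw [sub_zero] at h1
    refine h1.congr' ?_
    filter_upwards [Ioc_mem_nhdsGT ht] with t₀ ht₀
    exact (h.integral_flux_sub hl' hr hl.2.le ht₀.1 ht₀.2).symm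
  have hev : ∀ᶠ l in 𝓝[>] (0 : ℝ), l ∈ Ioo 0 r ∧
      Tendsto (fun t₀ => ∫ s in t₀..t, 1 / 2 * dx l s) (𝓝[>] 0) (𝓝 (J l)) :=
    Filter.Eventually.and (Ioo_mem_nhdsGT hr.1) hJ
  obtain ⟨l₁, hl₁, hlim₁⟩ := hev.exists
  have h1 := hstep l₁ hl₁ hlim₁
  -- The value found from l₁ is the same for every admissible l by uniqueness of limits, so it can
  -- be evaluated by letting l ↓ 0.
  suffices hval : J l₁ + ∫ y in l₁..r, d y t = flux d δm r t by rwa [hval] at h1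
  have h2 : Tendsto (fun l => J l + ∫ y in l..r, d y t) (𝓝[>] 0)
      (𝓝 (J l₁ + ∫ y in l₁..r, d y t)) := by
    refine tendsto_const_nhds.congr' ?_
    filter_upwards [hev] with l hl
    exact tendsto_nhds_unique h1 (hstep l hl.1 hl.2)
  have h3 : Tendsto (fun l => J l + (flux d δm r t - flux d δm l t)) (𝓝[>] 0)
      (𝓝 (δm t + (flux d δm r t - flux d δm 0 t))) := by
    refine hJ0.add (Tendsto.const_sub _ ?_)
    exact ((h.continuousOn_flux ht 0 (left_mem_Icc.2 zero_le_one)).mono_of_mem_nhdsWithin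
      (Icc_mem_nhdsGT one_pos)).tendsto
  have h4 : δm t + (flux d δm r t - flux d δm 0 t) = flux d δm r t := by simp [flux]
  rw [h4] at h3
  refine tendsto_nhds_unique h2 (h3.congr' ?_)
  filter_upwards [hev] with l hl
  have hl' : l ∈ Icc (0 : ℝ) 1 := ⟨hl.1.1.le, (hl.1.2.trans hr.2).le⟩
  have h0 : (0 : ℝ) ∈ Icc (0 : ℝ) 1 := left_mem_Icc.2 zero_le_one
  rw [flux, flux, add_sub_add_left_eq_sub, intervalIntegral.integral_interval_sub_left
    (h.intervalIntegrable_right ht h0 (Ioo_subset_Icc_self hr))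
    (h.intervalIntegrable_right ht h0 hl')]

/-- The limits from the two walls must agree, which expresses that strip and reservoirs together
hold zero excess mass: δm + ∫d + δp = 0. -/
theorem flux_one (h : IsNullSolution σ d dx dxx bm bp δm δp) {t : ℝ} (ht : 0 < t) :
    flux d δm 1 t = -δp t := by
  obtain ⟨J, hJ, hJ1⟩ := h.flux_right t ht
  have h1 : Tendsto (fun r => flux d δm r t) (𝓝[<] 1) (𝓝 (flux d δm 1 t)) :=
    ((h.continuousOn_flux ht 1 (right_mem_Icc.2 zero_le_one)).mono_of_mem_nhdsWithin
      (Icc_mem_nhdsLT one_pos)).tendsto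
  refine tendsto_nhds_unique h1 (hJ1.congr' ?_)
  filter_upwards [hJ, Ioo_mem_nhdsLT (show (0 : ℝ) < 1 from one_pos)] with r hr hr'
  exact tendsto_nhds_unique hr (h.tendsto_integral_dx hr' ht)

theorem integral_sub_eq_integral_flux (h : IsNullSolution σ d dx dxx bm bp δm δp) {l r t : ℝ}
    (hl : l ∈ Ioo (0 : ℝ) 1) (hr : r ∈ Ioo (0 : ℝ) 1) (hlr : l ≤ r) (ht : 0 < t) :
    (∫ s in (0 : ℝ)..t, d r s) - ∫ s in (0 : ℝ)..t, d l s = 2 * ∫ y in l..r, flux d δm y t := by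
  obtain ⟨C, hC⟩ := h.bdd
  have hsub : Icc l r ⊆ Ioo 0 1 := fun y hy => ⟨hl.1.trans_le hy.1, hy.2.trans_lt hr.2⟩
  have hprim : ∀ y ∈ Ioo (0 : ℝ) 1, Tendsto (fun t₀ => ∫ s in t₀..t, d y s) (𝓝[>] 0)
      (𝓝 (∫ s in (0 : ℝ)..t, d y s)) := fun y hy => by
    have hi := h.intervalIntegrable_left hy ht.le
    have hc := intervalIntegral.continuousOn_primitive_interval' (μ := volume) hi
      (a := t) right_mem_uIcc
    rw [uIcc_of_le ht.le] at hc
    have := ((hc 0 (left_mem_Icc.2 ht.le)).mono_of_mem_nhdsWithin (Icc_mem_nhdsGT ht)).tendsto.neg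
    rw [← intervalIntegral.integral_symm] at this
    exact this.congr fun x => (intervalIntegral.integral_symm _ _).symm
  have e : ∀ t₀ ∈ Ioc 0 t, (∫ s in t₀..t, d r s) - ∫ s in t₀..t, d l s =
      2 * ∫ y in l..r, ∫ s in t₀..t, 1 / 2 * dx y s := fun t₀ ht₀ => by
    have hsubt : Icc t₀ t ⊆ Ioi 0 := fun s hs => lt_of_lt_of_le ht₀.1 hs.1
    have hcx : ContinuousOn (fun p : ℝ × ℝ => 1 / 2 * dx p.1 p.2) (Icc l r ×ˢ Icc t₀ t) :=
      continuousOn_const.mul (h.cont_x.mono (prod_mono hsub hsubt))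
    have hi : ∀ y ∈ Ioo (0 : ℝ) 1, IntervalIntegrable (fun s => d y s) volume t₀ t := fun y hy =>
      ((continuousOn_slice_right hy h.cont).mono hsubt).intervalIntegrable_of_Icc ht₀.2
    rw [← intervalIntegral.integral_sub (hi r hr) (hi l hl),
      intervalIntegral_swap_of_continuousOn hlr ht₀.2 hcx, ← intervalIntegral.integral_const_mul]
    refine intervalIntegral.integral_congr fun s hs => ?_
    rw [uIcc_of_le ht₀.2] at hs
    rw [intervalIntegral.integral_const_mul, ← mul_assoc]
    norm_num
    symm
    refine intervalIntegral.integral_eq_sub_of_hasDerivAt (f := fun y => d y s) (fun y hy => ?_) ?_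
    · rw [uIcc_of_le hlr] at hy
      exact h.deriv_x y (hsub hy) s (hsubt hs)
    · exact ((continuousOn_slice_left (show s ∈ Ioi 0 from hsubt hs)
        h.cont_x).mono hsub).intervalIntegrable_of_Icc hlr
  have h1 := (hprim r hr).sub (hprim l hl)
  refine tendsto_nhds_unique h1 ?_
  have h2 : Tendsto (fun t₀ => ∫ y in l..r, ∫ s in t₀..t, 1 / 2 * dx y s) (𝓝[>] 0)
      (𝓝 (∫ y in l..r, flux d δm y t)) := by
    -- A bound uniform in y and in small t₀ is needed although d_r may blow up as t ↓ 0. The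
    -- integrated flux at the base point l is bounded because it converges, and mass conservation
    -- bounds the deviation at y by 2C.
    have hb : ∀ᶠ t₀ in 𝓝[>] 0, |∫ s in t₀..t, 1 / 2 * dx l s| < |flux d δm l t| + 1 :=
      (h.tendsto_integral_dx hl ht).abs.eventually (gt_mem_nhds (lt_add_one _))
    refine intervalIntegral.tendsto_integral_filter_of_dominated_convergence
      (fun _ => |flux d δm l t| + 1 + (C + C)) ?_ ?_ (by simp) ?_
    · filter_upwards [Ioc_mem_nhdsGT ht] with t₀ ht₀
      have hsubt : Icc t₀ t ⊆ Ioi 0 := fun s hs => lt_of_lt_of_le ht₀.1 hs.1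
      have hcx : ContinuousOn (fun p : ℝ × ℝ => 1 / 2 * dx p.2 p.1) (Icc t₀ t ×ˢ Icc l r) :=
        continuousOn_const.mul (h.cont_x.comp (g := fun p : ℝ × ℝ => dx p.1 p.2)
          (f := fun p : ℝ × ℝ => (p.2, p.1)) (by fun_prop) fun p hp => ⟨hsub hp.2, hsubt hp.1⟩)
      have := intervalIntegrable_integral_of_continuousOn (f := fun s y => 1 / 2 * dx y s)
        ht₀.2 hlr hcx
      rw [uIoc_of_le hlr]
      exact this.aestronglyMeasurable
    · filter_upwards [Ioc_mem_nhdsGT ht, hb] with t₀ ht₀ hbt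
      refine Eventually.of_forall fun y hy => ?_
      rw [uIoc_of_le hlr] at hy
      have hy' := hsub (Ioc_subset_Icc_self hy)
      have hd : ∀ s > 0, |∫ z in l..y, d z s| ≤ C := fun s hs => by
        have h3 := intervalIntegral.norm_integral_le_of_norm_le_const (a := l) (b := y) (C := C)
          (f := fun z => d z s) fun z hz => by
            rw [uIoc_of_le hy.1.le] at hz
            exact hC z (hsub ⟨hz.1.le, hz.2.trans hy.2⟩) s hs
        have h4 : 0 ≤ C := (abs_nonneg _).trans (hC y hy' s hs)
        have h5 : |y - l| ≤ 1 := by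
          rw [abs_of_nonneg (by linarith [hy.1])]; linarith [hy'.2, hl.1]
        exact h3.trans (mul_le_of_le_one_right h4 h5)
      rw [h.integral_flux_sub hl hy' hy.1.le ht₀.1 ht₀.2]
      exact (norm_add_le _ _).trans (add_le_add hbt.le
        ((norm_sub_le _ _).trans (add_le_add (hd t ht) (hd t₀ ht₀.1))))
    · refine Eventually.of_forall fun y hy => ?_
      rw [uIoc_of_le hlr] at hy
      exact h.tendsto_integral_dx (hsub (Ioc_subset_Icc_self hy)) ht
  refine (h2.const_mul 2).congr' ?_
  filter_upwards [Ioc_mem_nhdsGT ht] with t₀ ht₀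
  exact (e t₀ ht₀).symm

/-- The time integral of a null solution, continued to the closed interval. -/
noncomputable def primitive (d : ℝ → ℝ → ℝ) (bm δm : ℝ → ℝ) (r t : ℝ) : ℝ :=
  (∫ s in (0 : ℝ)..t, bm s) + 2 * ∫ y in (0 : ℝ)..r, flux d δm y t

theorem continuousOn_primitive (h : IsNullSolution σ d dx dxx bm bp δm δp) {t : ℝ} (ht : 0 < t) :
    ContinuousOn (fun r => primitive d bm δm r t) (Icc 0 1) := by
  refine continuousOn_const.add (continuousOn_const.mul ?_)
  have := intervalIntegral.continuousOn_primitive_interval' (μ := volume)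
    ((h.continuousOn_flux ht).intervalIntegrable_of_Icc zero_le_one) (a := 0) left_mem_uIcc
  rwa [uIcc_of_le zero_le_one] at this

theorem intervalIntegrable_flux (h : IsNullSolution σ d dx dxx bm bp δm δp) {t : ℝ} (ht : 0 < t)
    {a b : ℝ} (ha : a ∈ Icc (0 : ℝ) 1) (hb : b ∈ Icc (0 : ℝ) 1) :
    IntervalIntegrable (fun y => flux d δm y t) volume a b :=
  ((h.continuousOn_flux ht).mono (uIcc_subset_Icc ha hb)).intervalIntegrable

theorem hasDerivAt_primitive (h : IsNullSolution σ d dx dxx bm bp δm δp) {t : ℝ} (ht : 0 < t)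
    {r : ℝ} (hr : r ∈ Ioo (0 : ℝ) 1) :
    HasDerivAt (fun r => primitive d bm δm r t) (2 * flux d δm r t) r := by
  have hc := (h.continuousOn_flux ht).mono Ioo_subset_Icc_self
  have := intervalIntegral.integral_hasDerivAt_right
    (h.intervalIntegrable_flux ht (left_mem_Icc.2 zero_le_one) (Ioo_subset_Icc_self hr))
    (hc.stronglyMeasurableAtFilter isOpen_Ioo r hr) (hc.continuousAt (Ioo_mem_nhds hr.1 hr.2))
  exact (this.const_mul 2).const_add _

theorem tendsto_time_integral (h : IsNullSolution σ d dx dxx bm bp δm δp) {F : Filter ℝ}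
    [F.IsCountablyGenerated] (hF : ∀ᶠ r in F, r ∈ Ioo (0 : ℝ) 1) {b : ℝ → ℝ} {t : ℝ} (ht : 0 < t)
    (hb : ∀ s > 0, Tendsto (fun r => d r s) F (𝓝 (b s))) :
    Tendsto (fun r => ∫ s in (0 : ℝ)..t, d r s) F (𝓝 (∫ s in (0 : ℝ)..t, b s)) := by
  obtain ⟨C, hC⟩ := h.bdd
  refine intervalIntegral.tendsto_integral_filter_of_dominated_convergence (fun _ => C)
    ?_ ?_ (by simp) ?_
  · filter_upwards [hF] with r hr
    rw [uIoc_of_le ht.le]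
    exact (h.intervalIntegrable_left hr ht.le).aestronglyMeasurable
  · filter_upwards [hF] with r hr
    refine Eventually.of_forall fun s hs => ?_
    rw [uIoc_of_le ht.le] at hs
    exact hC r hr s hs.1
  · refine Eventually.of_forall fun s hs => ?_
    rw [uIoc_of_le ht.le] at hs
    exact hb s hs.1

/-- Both sides have increment 2∫F between interior points, so they differ by a constant. Dominated
convergence identifies the value at the wall as the time integral of the boundary values. -/
theorem primitive_eq (h : IsNullSolution σ d dx dxx bm bp δm δp) {t : ℝ} (ht : 0 < t)
    {r : ℝ} (hr : r ∈ Ioo (0 : ℝ) 1) : primitive d bm δm r t = ∫ s in (0 : ℝ)..t, d r s := by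
  have h0 : ∀ᶠ l in 𝓝[>] (0 : ℝ), l ∈ Ioo (0 : ℝ) 1 := Ioo_mem_nhdsGT one_pos
  have h1 := (h.tendsto_time_integral h0 ht h.left).add_const
    (2 * ∫ y in (0 : ℝ)..r, flux d δm y t)
  have h2 : Tendsto (fun l => (∫ s in (0 : ℝ)..t, d r s) +
      (primitive d bm δm l t - primitive d bm δm 0 t)) (𝓝[>] 0)
      (𝓝 ((∫ s in (0 : ℝ)..t, d r s) + (primitive d bm δm 0 t - primitive d bm δm 0 t))) := by
    refine Tendsto.const_add _ (Tendsto.sub_const ?_ _)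
    exact ((h.continuousOn_primitive ht 0 (left_mem_Icc.2 zero_le_one)).mono_of_mem_nhdsWithin
      (Icc_mem_nhdsGT one_pos)).tendsto
  rw [sub_self, add_zero] at h2
  refine tendsto_nhds_unique h1 (h2.congr' ?_)
  filter_upwards [Ioo_mem_nhdsGT hr.1] with l hl
  have hl' : l ∈ Ioo (0 : ℝ) 1 := ⟨hl.1, hl.2.trans hr.2⟩
  have z0 : (0 : ℝ) ∈ Icc (0 : ℝ) 1 := left_mem_Icc.2 zero_le_one
  have h3 := h.integral_sub_eq_integral_flux hl' hr hl.2.le ht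
  rw [← intervalIntegral.integral_interval_sub_left
    (h.intervalIntegrable_flux ht z0 (Ioo_subset_Icc_self hr))
    (h.intervalIntegrable_flux ht z0 (Ioo_subset_Icc_self hl'))] at h3
  simp only [primitive, intervalIntegral.integral_same]
  linarith

theorem primitive_one (h : IsNullSolution σ d dx dxx bm bp δm δp) {t : ℝ} (ht : 0 < t) :
    primitive d bm δm 1 t = ∫ s in (0 : ℝ)..t, bp s := by
  have h0 : ∀ᶠ l in 𝓝[<] (1 : ℝ), l ∈ Ioo (0 : ℝ) 1 := Ioo_mem_nhdsLT one_pos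
  have h1 := h.tendsto_time_integral h0 ht h.right
  have h2 : Tendsto (fun r => primitive d bm δm r t) (𝓝[<] 1) (𝓝 (primitive d bm δm 1 t)) :=
    ((h.continuousOn_primitive ht 1 (right_mem_Icc.2 zero_le_one)).mono_of_mem_nhdsWithin
      (Icc_mem_nhdsLT one_pos)).tendsto
  refine tendsto_nhds_unique h2 (h1.congr' ?_)
  filter_upwards [h0] with r hr
  exact (h.primitive_eq ht hr).symm

end IsNullSolution

/-! ### Uniqueness: the energy -/

/-- This is the time integral of σδ' = b - δ. It is what makes the cross terms between strip and
reservoirs cancel in the derivative of the energy. -/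
theorem integral_eq_of_relaxation {σ C : ℝ} (hσ : 0 < σ) {b δ : ℝ → ℝ} (hb : ContinuousOn b (Ioi 0))
    (hbC : ∀ t > 0, |b t| ≤ C) (hδ : ContinuousOn δ (Ici 0)) (h0 : δ 0 = 0)
    (hd : ∀ t > 0, HasDerivAt δ (σ⁻¹ * (b t - δ t)) t) {t : ℝ} (ht : 0 < t) :
    ∫ s in (0 : ℝ)..t, b s = σ * δ t + ∫ s in (0 : ℝ)..t, δ s := by
  have hbi : IntervalIntegrable b volume 0 t := by
    rw [intervalIntegrable_iff_integrableOn_Ioo_of_le ht.le]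
    refine Integrable.mono' (g := fun _ => C) (by simp) ?_ ?_
    · exact (hb.mono fun s hs => hs.1).aestronglyMeasurable measurableSet_Ioo
    · exact (ae_restrict_iff' measurableSet_Ioo).2 (Eventually.of_forall fun s hs => hbC s hs.1)
  have hδi : IntervalIntegrable δ volume 0 t :=
    (hδ.mono Icc_subset_Ici_self).intervalIntegrable_of_Icc ht.le
  have h1 := intervalIntegral.integral_eq_sub_of_hasDerivAt_of_le ht.le
    (hδ.mono Icc_subset_Ici_self) (fun s hs => hd s hs.1) ((hbi.sub hδi).const_mul σ⁻¹)
  rw [intervalIntegral.integral_const_mul, intervalIntegral.integral_sub hbi hδi, h0, sub_zero] at h1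
  field_simp at h1
  linarith

namespace IsNullSolution

variable {σ : ℝ} {d dx dxx : ℝ → ℝ → ℝ} {bm bp δm δp : ℝ → ℝ}

/-- Integration by parts with d = F_r and D_r = 2F. It reaches the walls because D and F are
continuous on [0,1], although d_r may not extend there. -/
theorem integral_primitive_mul (h : IsNullSolution σ d dx dxx bm bp δm δp) {t : ℝ} (ht : 0 < t) :
    ∫ r in (0 : ℝ)..1, primitive d bm δm r t * d r t =
      (∫ s in (0 : ℝ)..t, bp s) * (-δp t) - (∫ s in (0 : ℝ)..t, bm s) * δm t -
        ∫ r in (0 : ℝ)..1, 2 * flux d δm r t * flux d δm r t := by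
  have := intervalIntegral.integral_mul_deriv_eq_deriv_mul_of_hasDerivAt (a := 0) (b := 1)
    (u := fun r => primitive d bm δm r t) (v := fun r => flux d δm r t)
    (u' := fun r => 2 * flux d δm r t) (v' := fun r => d r t)
    (by rw [uIcc_of_le zero_le_one]; exact h.continuousOn_primitive ht)
    (by rw [uIcc_of_le zero_le_one]; exact h.continuousOn_flux ht)
    (fun r hr => h.hasDerivAt_primitive ht (by simpa using hr))
    (fun r hr => h.hasDerivAt_flux ht (by simpa using hr))
    ((h.intervalIntegrable_flux ht (left_mem_Icc.2 zero_le_one)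
      (right_mem_Icc.2 zero_le_one)).const_mul 2)
    (h.intervalIntegrable_right ht (left_mem_Icc.2 zero_le_one) (right_mem_Icc.2 zero_le_one))
  rw [this, h.primitive_one ht, h.flux_one ht]
  simp [primitive, flux]

theorem hasDerivAt_time_integral (h : IsNullSolution σ d dx dxx bm bp δm δp) {r t : ℝ}
    (hr : r ∈ Ioo (0 : ℝ) 1) (ht : 0 < t) :
    HasDerivAt (fun t => ∫ s in (0 : ℝ)..t, d r s) (d r t) t := by
  have hc := continuousOn_slice_right hr h.cont
  exact intervalIntegral.integral_hasDerivAt_right (h.intervalIntegrable_left hr ht.le)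
    (hc.stronglyMeasurableAtFilter isOpen_Ioi t ht) (hc.continuousAt (Ioi_mem_nhds ht))

theorem abs_time_integral_le {C : ℝ}
    (hC : ∀ r ∈ Ioo (0 : ℝ) 1, ∀ t > 0, |d r t| ≤ C) {r t : ℝ}
    (hr : r ∈ Ioo (0 : ℝ) 1) (ht : 0 < t) : |∫ s in (0 : ℝ)..t, d r s| ≤ C * t := by
  have := intervalIntegral.norm_integral_le_of_norm_le_const (a := 0) (b := t) (C := C)
    (f := fun s => d r s) fun s hs => by
      rw [uIoc_of_le ht.le] at hs
      exact hC r hr s hs.1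
  simpa [abs_of_pos ht] using this

theorem hasDerivAt_primitive_density {δ : ℝ → ℝ} (hδ : ContinuousOn δ (Ici 0)) {t : ℝ}
    (ht : 0 < t) : HasDerivAt (fun t => ∫ s in (0 : ℝ)..t, δ s) (δ t) t := by
  have hc : ContinuousOn δ (Ioi 0) := hδ.mono Ioi_subset_Ici_self
  exact intervalIntegral.integral_hasDerivAt_right
    ((hδ.mono Icc_subset_Ici_self).intervalIntegrable_of_Icc ht.le)
    (hc.stronglyMeasurableAtFilter isOpen_Ioi t ht) (hc.continuousAt (Ioi_mem_nhds ht))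

theorem tendsto_primitive_density {δ : ℝ → ℝ} (hδ : ContinuousOn δ (Ici 0)) :
    Tendsto (fun t => ∫ s in (0 : ℝ)..t, δ s) (𝓝[>] 0) (𝓝 0) := by
  have := intervalIntegral.continuousOn_primitive_interval' (μ := volume) (a := 0) (b₁ := 0)
    (b₂ := 1) ((hδ.mono Icc_subset_Ici_self).intervalIntegrable_of_Icc zero_le_one) left_mem_uIcc
  rw [uIcc_of_le zero_le_one] at this
  have := ((this 0 (left_mem_Icc.2 zero_le_one)).mono_of_mem_nhdsWithin
    (Icc_mem_nhdsGT one_pos)).tendsto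
  simpa using this

/-- Energy of the time-integrated null solution. -/
noncomputable def energy (d : ℝ → ℝ → ℝ) (δm δp : ℝ → ℝ) (t : ℝ) : ℝ :=
  (∫ r in Ioo (0 : ℝ) 1, 1 / 2 * (∫ s in (0 : ℝ)..t, d r s) ^ 2) +
    1 / 2 * (∫ s in (0 : ℝ)..t, δm s) ^ 2 + 1 / 2 * (∫ s in (0 : ℝ)..t, δp s) ^ 2

theorem aestronglyMeasurable_time_integral (h : IsNullSolution σ d dx dxx bm bp δm δp) {t : ℝ}
    (ht : 0 < t) : AEStronglyMeasurable (fun r => ∫ s in (0 : ℝ)..t, d r s)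
      (volume.restrict (Ioo 0 1)) :=
  (((h.continuousOn_primitive ht).mono Ioo_subset_Icc_self).congr
    fun _ hr => (h.primitive_eq ht hr).symm).aestronglyMeasurable measurableSet_Ioo

/-- The derivative is ∫Dd + δm∫δm + δp∫δp. After integration by parts, inserting ∫b = σδ + ∫δ at
each wall cancels the mixed products and leaves -2∫F² - σδm² - σδp². -/
theorem exists_hasDerivAt_energy (h : IsNullSolution σ d dx dxx bm bp δm δp) (hσ : 0 < σ) {t : ℝ}
    (ht : 0 < t) : ∃ e ≤ 0, HasDerivAt (energy d δm δp) e t := by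
  obtain ⟨C, hC⟩ := h.bdd
  have hC0 : 0 ≤ C := (abs_nonneg _).trans (hC (1 / 2) (by norm_num) t ht)
  have hball : ∀ t' ∈ Metric.ball t (t / 2), 0 < t' ∧ t' ≤ 2 * t := fun t' ht' => by
    rw [Metric.mem_ball, Real.dist_eq, abs_lt] at ht'
    constructor <;> linarith [ht'.1, ht'.2]
  have h1 : HasDerivAt (fun t => ∫ r in Ioo (0 : ℝ) 1, 1 / 2 * (∫ s in (0 : ℝ)..t, d r s) ^ 2)
      (∫ r in Ioo (0 : ℝ) 1, (∫ s in (0 : ℝ)..t, d r s) * d r t) t := by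
    refine (hasDerivAt_integral_of_dominated_loc_of_deriv_le
      (F := fun t r => 1 / 2 * (∫ s in (0 : ℝ)..t, d r s) ^ 2)
      (F' := fun t r => (∫ s in (0 : ℝ)..t, d r s) * d r t)
      (bound := fun _ => C * (2 * t) * C)
      (Metric.ball_mem_nhds t (half_pos ht)) ?_ ?_ ?_ ?_ (integrable_const _) ?_).2
    · filter_upwards [lt_mem_nhds ht] with s hs
      exact ((h.aestronglyMeasurable_time_integral hs).pow 2).const_mul _
    · refine Integrable.mono' (g := fun _ => 1 / 2 * (C * t) ^ 2) (integrable_const _)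
        (((h.aestronglyMeasurable_time_integral ht).pow 2).const_mul _) ?_
      refine (ae_restrict_iff' measurableSet_Ioo).2 (Eventually.of_forall fun r hr => ?_)
      rw [norm_mul, norm_pow, Real.norm_of_nonneg (by norm_num)]
      gcongr
      exact abs_time_integral_le hC hr ht
    · exact (h.aestronglyMeasurable_time_integral ht).mul
        ((continuousOn_slice_left (show t ∈ Ioi 0 from ht) h.cont).aestronglyMeasurable
        measurableSet_Ioo)
    · refine (ae_restrict_iff' measurableSet_Ioo).2 (Eventually.of_forall fun r hr t' ht' => ?_)
      obtain ⟨h0, h2⟩ := hball t' ht'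
      rw [norm_mul]
      gcongr
      · exact (abs_time_integral_le hC hr h0).trans (by gcongr)
      · exact hC r hr t' h0
    · refine (ae_restrict_iff' measurableSet_Ioo).2 (Eventually.of_forall fun r hr t' ht' => ?_)
      refine (((h.hasDerivAt_time_integral hr (hball t' ht').1).pow 2).const_mul
        (1 / 2)).congr_deriv ?_
      norm_num
      ring
  have h2 := ((hasDerivAt_primitive_density h.cont_m ht).pow 2).const_mul (1 / 2)
  have h3 := ((hasDerivAt_primitive_density h.cont_p ht).pow 2).const_mul (1 / 2)
  refine ⟨_, ?_, (h1.add h2).add h3⟩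
  have e1 : ∫ r in Ioo (0 : ℝ) 1, (∫ s in (0 : ℝ)..t, d r s) * d r t =
      ∫ r in (0 : ℝ)..1, primitive d bm δm r t * d r t := by
    rw [intervalIntegral.integral_of_le zero_le_one, integral_Ioc_eq_integral_Ioo]
    refine setIntegral_congr_fun measurableSet_Ioo fun r hr => ?_
    rw [h.primitive_eq ht hr]
  have hbm : ∀ t > 0, |bm t| ≤ C := fun t ht =>
    le_of_tendsto (h.left t ht).abs (by
      filter_upwards [Ioo_mem_nhdsGT (show (0 : ℝ) < 1 from one_pos)] with r hr
      exact hC r hr t ht)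
  have hbp : ∀ t > 0, |bp t| ≤ C := fun t ht =>
    le_of_tendsto (h.right t ht).abs (by
      filter_upwards [Ioo_mem_nhdsLT (show (0 : ℝ) < 1 from one_pos)] with r hr
      exact hC r hr t ht)
  rw [e1, h.integral_primitive_mul ht,
    integral_eq_of_relaxation hσ h.cont_bm hbm h.cont_m h.zero_m h.deriv_m ht,
    integral_eq_of_relaxation hσ h.cont_bp hbp h.cont_p h.zero_p h.deriv_p ht]
  have h4 : 0 ≤ ∫ r in (0 : ℝ)..1, 2 * flux d δm r t * flux d δm r t :=
    intervalIntegral.integral_nonneg zero_le_one fun r _ => by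
      nlinarith [sq_nonneg (flux d δm r t)]
  norm_num
  nlinarith [mul_nonneg hσ.le (sq_nonneg (δm t)), mul_nonneg hσ.le (sq_nonneg (δp t))]

theorem tendsto_energy (h : IsNullSolution σ d dx dxx bm bp δm δp) :
    Tendsto (energy d δm δp) (𝓝[>] 0) (𝓝 0) := by
  obtain ⟨C, hC⟩ := h.bdd
  have h1 : Tendsto (fun t => ∫ r in Ioo (0 : ℝ) 1, 1 / 2 * (∫ s in (0 : ℝ)..t, d r s) ^ 2)
      (𝓝[>] 0) (𝓝 0) := by
    refine squeeze_zero_norm' (a := fun t => 1 / 2 * (C * t) ^ 2) ?_ ?_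
    · filter_upwards [self_mem_nhdsWithin] with t ht
      refine (norm_setIntegral_le_of_norm_le_const (C := 1 / 2 * (C * t) ^ 2) (by simp)
        fun r hr => ?_).trans (by simp)
      rw [norm_mul, norm_pow, Real.norm_of_nonneg (by norm_num)]
      gcongr
      exact abs_time_integral_le hC hr ht
    · refine tendsto_nhdsWithin_of_tendsto_nhds (Continuous.tendsto' (by fun_prop) _ _ (by simp))
  have h2 := ((tendsto_primitive_density h.cont_m).pow 2).const_mul (1 / 2)
  have h3 := ((tendsto_primitive_density h.cont_p).pow 2).const_mul (1 / 2)
  have := (h1.add h2).add h3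
  norm_num at this
  unfold energy
  norm_num
  exact this

theorem energy_terms_nonneg (t : ℝ) :
    0 ≤ ∫ r in Ioo (0 : ℝ) 1, 1 / 2 * (∫ s in (0 : ℝ)..t, d r s) ^ 2 :=
  integral_nonneg fun r => by positivity

theorem energy_nonpos (h : IsNullSolution σ d dx dxx bm bp δm δp) (hσ : 0 < σ) {t : ℝ}
    (ht : 0 < t) : energy d δm δp t ≤ 0 := by
  choose! e he hde using fun t (ht : 0 < t) => h.exists_hasDerivAt_energy hσ ht
  have hanti : AntitoneOn (energy d δm δp) (Ioi 0) := by
    refine antitoneOn_of_hasDerivWithinAt_nonpos (convex_Ioi 0)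
      (fun s hs => (hde s hs).continuousAt.continuousWithinAt) (f' := e) ?_ ?_
    · intro s hs
      rw [interior_Ioi] at hs
      exact (hde s hs).hasDerivWithinAt
    · intro s hs
      rw [interior_Ioi] at hs
      exact he s hs
  refine ge_of_tendsto h.tendsto_energy ?_
  filter_upwards [Ioc_mem_nhdsGT ht] with s hs
  exact hanti hs.1 ht hs.2

theorem eq_zero_of_primitive_eq_zero {f g : ℝ → ℝ} (hd : ∀ t > 0, HasDerivAt f (g t) t)
    (hf : ∀ t > 0, f t = 0) {t : ℝ} (ht : 0 < t) : g t = 0 := by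
  have : f =ᶠ[𝓝 t] fun _ => 0 := by
    filter_upwards [lt_mem_nhds ht] with s hs
    exact hf s hs
  exact (hd t ht).unique ((hasDerivAt_const t (0 : ℝ)).congr_of_eventuallyEq this)

theorem reservoir_left_eq_zero (h : IsNullSolution σ d dx dxx bm bp δm δp) (hσ : 0 < σ) {t : ℝ}
    (ht : 0 < t) : δm t = 0 := by
  refine eq_zero_of_primitive_eq_zero (fun t ht => hasDerivAt_primitive_density h.cont_m ht)
    (fun t ht => ?_) ht
  have h1 := h.energy_nonpos hσ ht
  have h2 := energy_terms_nonneg (d := d) t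
  unfold energy at h1
  nlinarith [sq_nonneg (∫ s in (0 : ℝ)..t, δm s), sq_nonneg (∫ s in (0 : ℝ)..t, δp s)]

theorem reservoir_right_eq_zero (h : IsNullSolution σ d dx dxx bm bp δm δp) (hσ : 0 < σ) {t : ℝ}
    (ht : 0 < t) : δp t = 0 := by
  refine eq_zero_of_primitive_eq_zero (fun t ht => hasDerivAt_primitive_density h.cont_p ht)
    (fun t ht => ?_) ht
  have h1 := h.energy_nonpos hσ ht
  have h2 := energy_terms_nonneg (d := d) t
  unfold energy at h1
  nlinarith [sq_nonneg (∫ s in (0 : ℝ)..t, δm s), sq_nonneg (∫ s in (0 : ℝ)..t, δp s)]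

theorem eq_zero (h : IsNullSolution σ d dx dxx bm bp δm δp) (hσ : 0 < σ) {r t : ℝ}
    (hr : r ∈ Ioo (0 : ℝ) 1) (ht : 0 < t) : d r t = 0 := by
  refine eq_zero_of_primitive_eq_zero (fun t ht => h.hasDerivAt_time_integral hr ht)
    (fun t ht => ?_) ht
  have h1 := h.energy_nonpos hσ ht
  unfold energy at h1
  by_contra hne
  -- The continuous representative of D on [0,1] is used, so that a nonzero value at one point
  -- forces a positive integral.
  have hpos : 0 < ∫ r in (0 : ℝ)..1, 1 / 2 * primitive d bm δm r t ^ 2 := by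
    refine intervalIntegral.integral_pos one_pos
      (continuousOn_const.mul ((h.continuousOn_primitive ht).pow 2)) (fun r _ => by positivity)
      ⟨r, Ioo_subset_Icc_self hr, ?_⟩
    rw [h.primitive_eq ht hr]
    positivity
  rw [intervalIntegral.integral_of_le zero_le_one, integral_Ioc_eq_integral_Ioo,
    setIntegral_congr_fun (g := fun r => 1 / 2 * (∫ s in (0 : ℝ)..t, d r s) ^ 2) measurableSet_Ioo
      fun r hr => by simp only [h.primitive_eq ht hr]] at hpos
  nlinarith [sq_nonneg (∫ s in (0 : ℝ)..t, δm s), sq_nonneg (∫ s in (0 : ℝ)..t, δp s)]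

end IsNullSolution

/-! ### The difference of two solutions -/

theorem tendsto_integral_deriv_sub {u u' : ℝ → ℝ → ℝ} (h : IsC21 u) (h' : IsC21 u') {l t J J' : ℝ}
    (hl : l ∈ Ioo (0 : ℝ) 1) (ht : 0 < t)
    (hJ : Tendsto (fun t₀ : ℝ => ∫ s in t₀..t, (1 / 2 : ℝ) * deriv (fun x => u x s) l)
      (𝓝[>] 0) (𝓝 J))
    (hJ' : Tendsto (fun t₀ : ℝ => ∫ s in t₀..t, (1 / 2 : ℝ) * deriv (fun x => u' x s) l)
      (𝓝[>] 0) (𝓝 J')) :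
    Tendsto (fun t₀ : ℝ => ∫ s in t₀..t,
      1 / 2 * (deriv (fun x => u' x s) l - deriv (fun x => u x s) l)) (𝓝[>] 0) (𝓝 (J' - J)) := by
  refine (hJ'.sub hJ).congr' ?_
  filter_upwards [Ioc_mem_nhdsGT ht] with t₀ ht₀
  have hsubt : Icc t₀ t ⊆ Ioi 0 := fun s hs => lt_of_lt_of_le ht₀.1 hs.1
  have hi : ∀ v : ℝ → ℝ → ℝ, IsC21 v →
      IntervalIntegrable (fun s => (1 / 2 : ℝ) * deriv (fun x => v x s) l) volume t₀ t :=
    fun v hv => (continuousOn_const.mul ((continuousOn_slice_right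
      (f := fun r t => deriv (fun x => v x t) r) hl hv.continuousOn_r).mono
      hsubt)).intervalIntegrable_of_Icc ht₀.2
  rw [← intervalIntegral.integral_sub (hi u' h') (hi u h)]
  simp only [mul_sub]

theorem IsSolution.isNullSolution_sub {σ : ℝ} {u₀ : ℝ → ℝ} {vm vp : ℝ} {u u' : ℝ → ℝ → ℝ}
    {ρm ρp ρm' ρp' : ℝ → ℝ} (h : IsSolution σ u₀ vm vp u ρm ρp)
    (h' : IsSolution σ u₀ vm vp u' ρm' ρp') :
    IsNullSolution σ (fun r t => u' r t - u r t)
      (fun r t => deriv (fun x => u' x t) r - deriv (fun x => u x t) r)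
      (fun r t => deriv (fun y => deriv (fun x => u' x t) y) r -
        deriv (fun y => deriv (fun x => u x t) y) r)
      (fun t => u' 0 t - u 0 t) (fun t => u' 1 t - u 1 t) (fun t => ρm' t - ρm t)
      (fun t => ρp' t - ρp t) where
  cont := h'.mem_U.continuousOn.sub h.mem_U.continuousOn
  cont_x := h'.mem_U.continuousOn_r.sub h.mem_U.continuousOn_r
  cont_xx := h'.mem_U.continuousOn_rr.sub h.mem_U.continuousOn_rr
  deriv_x r hr t ht := (h'.mem_U.differentiableAt_r r hr t ht).hasDerivAt.sub
    (h.mem_U.differentiableAt_r r hr t ht).hasDerivAt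
  deriv_xx r hr t ht := (h'.mem_U.differentiableAt_rr r hr t ht).hasDerivAt.sub
    (h.mem_U.differentiableAt_rr r hr t ht).hasDerivAt
  deriv_t r hr t ht := by
    refine ((h'.mem_U.differentiableAt_t r hr t ht).hasDerivAt.sub
      (h.mem_U.differentiableAt_t r hr t ht).hasDerivAt).congr_deriv ?_
    rw [h.heat r hr t ht, h'.heat r hr t ht]; ring
  bdd := by
    obtain ⟨C, hC⟩ := h.bounded
    obtain ⟨C', hC'⟩ := h'.bounded
    exact ⟨C' + C, fun r hr t ht =>
      (abs_sub _ _).trans (add_le_add (hC' r hr t ht) (hC r hr t ht))⟩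
  left t ht := (h'.boundary_left t ht).sub (h.boundary_left t ht)
  right t ht := (h'.boundary_right t ht).sub (h.boundary_right t ht)
  cont_bm := h'.boundary_left_cont.sub h.boundary_left_cont
  cont_bp := h'.boundary_right_cont.sub h.boundary_right_cont
  initial r hr := by simpa using (h'.initial r hr).sub (h.initial r hr)
  zero_m := by rw [h.reservoir_left_zero, h'.reservoir_left_zero, sub_self]
  zero_p := by rw [h.reservoir_right_zero, h'.reservoir_right_zero, sub_self]
  cont_m := h'.mem_H_left.2.sub h.mem_H_left.2
  cont_p := h'.mem_H_right.2.sub h.mem_H_right.2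
  deriv_m t ht := ((h'.ode_left t ht).sub (h.ode_left t ht)).congr_deriv (by ring)
  deriv_p t ht := ((h'.ode_right t ht).sub (h.ode_right t ht)).congr_deriv (by ring)
  flux_left t ht := by
    obtain ⟨L, ⟨J, hJ, hJL⟩, hL⟩ := h.flux_left t ht
    obtain ⟨L', ⟨J', hJ', hJL'⟩, hL'⟩ := h'.flux_left t ht
    have e : ρm' t - ρm t = L' - L := by
      rw [hL, hL', h.reservoir_left_zero, h'.reservoir_left_zero]; ring
    refine ⟨fun l => J' l - J l, ?_, e ▸ hJL'.sub hJL⟩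
    filter_upwards [hJ, hJ', Ioo_mem_nhdsGT (show (0 : ℝ) < 1 from one_pos)] with l hl hl' hl1
    exact tendsto_integral_deriv_sub h.mem_U h'.mem_U hl1 ht hl hl'
  flux_right t ht := by
    obtain ⟨L, ⟨J, hJ, hJL⟩, hL⟩ := h.flux_right t ht
    obtain ⟨L', ⟨J', hJ', hJL'⟩, hL'⟩ := h'.flux_right t ht
    have e : -(ρp' t - ρp t) = L' - L := by
      rw [hL, hL', h.reservoir_right_zero, h'.reservoir_right_zero]; ring
    refine ⟨fun l => J' l - J l, ?_, e ▸ hJL'.sub hJL⟩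
    filter_upwards [hJ, hJ', Ioo_mem_nhdsLT (show (0 : ℝ) < 1 from one_pos)] with l hl hl' hl1
    exact tendsto_integral_deriv_sub h.mem_U h'.mem_U hl1 ht hl hl'

/-! ### The boundary integral system -/

/-- Kernels admissible in the Volterra system. -/
structure IsVolterraKernel (κ : ℝ → ℝ) : Prop where
  zero : ∀ t ≤ 0, κ t = 0
  int : Integrable fun t => Real.exp (-t) * κ t

namespace IsVolterraKernel

variable {κ κ' : ℝ → ℝ}

theorem neg (h : IsVolterraKernel κ) : IsVolterraKernel fun t => -κ t :=
  ⟨fun t ht => by rw [h.zero t ht, neg_zero], by simpa using h.int.neg⟩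

theorem sub (h : IsVolterraKernel κ) (h' : IsVolterraKernel κ') :
    IsVolterraKernel fun t => κ t - κ' t :=
  ⟨fun t ht => by rw [h.zero t ht, h'.zero t ht, sub_zero],
    (h.int.sub h'.int).congr (Eventually.of_forall fun t => (mul_sub _ _ _).symm)⟩

theorem const_mul (h : IsVolterraKernel κ) (c : ℝ) : IsVolterraKernel fun t => c * κ t :=
  ⟨fun t ht => by rw [h.zero t ht, mul_zero], by
    simpa only [mul_left_comm] using h.int.const_mul c⟩

/-- Only 0 < s < t contributes. There the density is bounded by M, and removing the weight from the
kernel costs at most e^t. -/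
theorem integrable_mul (h : IsVolterraKernel κ) {y : ℝ → ℝ} (hy : IsDensity y) (t : ℝ) :
    Integrable fun s => κ (t - s) * y s := by
  obtain ⟨M, hM0, hM⟩ := hy.bdd t
  have h1 : Integrable fun s => Real.exp (-(t - s)) * κ (t - s) := h.int.comp_sub_left t
  have h2 : (fun s => κ (t - s)) =
      fun s => Real.exp (t - s) * (Real.exp (-(t - s)) * κ (t - s)) := by
    ext s; rw [← mul_assoc, ← Real.exp_add]; simp
  refine Integrable.mono' (h1.norm.const_mul (Real.exp t * M)) ?_ (Eventually.of_forall fun s => ?_)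
  · rw [show (fun s => κ (t - s) * y s) = (fun s => κ (t - s)) * y from rfl]
    refine AEStronglyMeasurable.mul ?_ hy.meas.aestronglyMeasurable
    rw [h2]
    exact (by fun_prop : Measurable fun s : ℝ => Real.exp (t - s)).aestronglyMeasurable.mul
      h1.aestronglyMeasurable
  · rcases le_or_gt s 0 with hs | hs
    · rw [hy.zero s hs, mul_zero, norm_zero]; positivity
    · rcases le_or_gt t s with hts | hts
      · rw [h.zero _ (by linarith), zero_mul, norm_zero]; positivity
      · have e : ‖κ (t - s)‖ = Real.exp (t - s) * ‖Real.exp (-(t - s)) * κ (t - s)‖ := by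
          conv_lhs => rw [congrFun h2 s]
          rw [norm_mul, Real.norm_of_nonneg (Real.exp_pos (t - s)).le]
        rw [norm_mul, e]
        have h3 : ‖y s‖ ≤ M := hM s hts.le
        have h4 : Real.exp (t - s) ≤ Real.exp t := Real.exp_le_exp.2 (by linarith)
        calc _ ≤ Real.exp t * ‖Real.exp (-(t - s)) * κ (t - s)‖ * M := by gcongr
          _ = _ := by ring

end IsVolterraKernel

theorem IsDensity.intervalIntegrable {a : ℝ → ℝ} (ha : IsDensity a) (l r : ℝ) :
    IntervalIntegrable a volume l r := by
  obtain ⟨M, hM0, hM⟩ := ha.bdd (max l r)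
  rw [intervalIntegrable_iff]
  refine Measure.integrableOn_of_bounded (M := M) (by simp [uIoc]) ha.meas.aestronglyMeasurable ?_
  exact (ae_restrict_iff' measurableSet_uIoc).2 (Eventually.of_forall fun s hs => hM s hs.2)

/-- The Heaviside function. -/
noncomputable def heaviside (t : ℝ) : ℝ := (Ioi (0 : ℝ)).indicator 1 t

theorem isVolterraKernel_heaviside : IsVolterraKernel heaviside := by
  refine ⟨fun t ht => by simp [heaviside, ht], ?_⟩
  have : (fun t => Real.exp (-t) * heaviside t) =
      (Ioi (0 : ℝ)).indicator fun t => Real.exp (-t) := by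
    ext t
    by_cases h : 0 < t <;> simp [heaviside, h]
  rw [this, integrable_indicator_iff measurableSet_Ioi]
  exact integrableOn_exp_neg_Ioi 0

/-- This puts the accumulated reservoir content into convolution form, so that it fits the Volterra
system. -/
theorem integral_heaviside_mul {y : ℝ → ℝ} (hy : IsDensity y) {t : ℝ} (ht : 0 < t) :
    ∫ s, heaviside (t - s) * y s = ∫ s in (0 : ℝ)..t, y s := by
  rw [intervalIntegral.integral_of_le ht.le, integral_Ioc_eq_integral_Ioo,
    ← integral_indicator measurableSet_Ioo]
  congr 1; ext s
  by_cases h1 : 0 < s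
  · by_cases h2 : s < t
    · simp [heaviside, h1, h2]
    · simp [heaviside, h2]
  · rw [hy.zero s (not_lt.1 h1)]
    simp [h1]

theorem isVolterraKernel_heatK_zero : IsVolterraKernel fun t => heatK 0 t 0 :=
  ⟨fun _ ht => heatK_of_nonpos 0 ht 0, integrable_exp_mul_heatK_zero⟩

theorem isVolterraKernel_heatK_one (j : ℕ) : IsVolterraKernel fun t => heatK j t 1 :=
  ⟨fun _ ht => heatK_of_nonpos j ht 1, integrable_exp_mul_heatK j⟩

theorem continuousOn_initialPotential_time {K : ℝ → ℝ → ℝ} (hK : IsKernel K) {w : ℝ → ℝ}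
    (hw : IntegrableOn w (Ioo 0 1)) (x : ℝ) :
    ContinuousOn (fun t => initialPotential K w t x) (Ioi 0) := fun t ht =>
  (ContinuousAt.comp (g := fun q : ℝ × ℝ => initialPotential K w q.1 q.2)
    (f := fun t : ℝ => (t, x)) (x := t)
    (continuousAt_initialPotential hK hw (p := (t, x)) (show t ≠ 0 from (ne_of_gt ht)))
    (by fun_prop)).continuousWithinAt

/-- The boundary layers and reservoir fluxes solving the coupled boundary system. -/
theorem exists_boundary_densities {σ : ℝ} (hσ : 0 < σ) {w : ℝ → ℝ} (hwm : Measurable w)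
    (hw : ∀ z, |w z| ≤ 1) {vm vp : ℝ} (hvm : |vm| ≤ 1) (hvp : |vp| ≤ 1) :
    ∃ a b gm gp : ℝ → ℝ, IsDensity a ∧ IsDensity b ∧ IsDensity gm ∧ IsDensity gp ∧
      (∀ t > 0, gm t = σ⁻¹ * (stripPotential (heatK 0) w a b t 0 -
        (vm + ∫ s in (0 : ℝ)..t, gm s))) ∧
      (∀ t > 0, gp t = σ⁻¹ * (stripPotential (heatK 0) w a b t 1 -
        (vp + ∫ s in (0 : ℝ)..t, gp s))) ∧
      (∀ t > 0, gm t = 1 / 2 * initialPotential heatKx w t 0 - a t + ∫ s, heatK 1 (t - s) 1 * b s) ∧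
      ∀ t > 0, gp t = -(1 / 2) * initialPotential heatKx w t 1 - b t +
        ∫ s, heatK 1 (t - s) 1 * a s := by
  have hwi : IntegrableOn w (Ioo 0 1) :=
    Measure.integrableOn_of_bounded (M := 1) (by simp) hwm.aestronglyMeasurable
      (Eventually.of_forall hw)
  have hA := isVolterraKernel_heatK_zero.const_mul (2 * σ⁻¹)
  have hB := (isVolterraKernel_heatK_one 0).const_mul (2 * σ⁻¹)
  have hI := isVolterraKernel_heaviside.const_mul (-σ⁻¹)
  have hH := isVolterraKernel_heatK_one 1
  have hZ : IsVolterraKernel fun _ => 0 := ⟨fun _ _ => rfl, by simp⟩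
  set A : ℝ → ℝ := fun t => 2 * σ⁻¹ * heatK 0 t 0 with hAdef
  set B : ℝ → ℝ := fun t => 2 * σ⁻¹ * heatK 0 t 1 with hBdef
  set I : ℝ → ℝ := fun t => -σ⁻¹ * heaviside t with hIdef
  set H : ℝ → ℝ := fun t => heatK 1 t 1 with hHdef
  set qm : ℝ → ℝ := fun t => σ⁻¹ * (initialPotential (heatK 0) w t 0 - vm) with hqm
  set qp : ℝ → ℝ := fun t => σ⁻¹ * (initialPotential (heatK 0) w t 1 - vp) with hqp
  set pm : ℝ → ℝ := fun t => 1 / 2 * initialPotential heatKx w t 0 with hpm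
  set pp : ℝ → ℝ := fun t => -(1 / 2) * initialPotential heatKx w t 1 with hpp
  -- The unknowns are (a, b, gm, gp). The last two rows are the relaxation laws. The flux conditions
  -- a = pm + H*b - gm and b = pp + H*a - gp would contain gm and gp undifferentiated and outside
  -- any integral, so the relaxation laws are substituted for them; this gives the first two rows.
  let k : Fin 4 → Fin 4 → ℝ → ℝ :=
    ![![fun t => -A t, fun t => H t - B t, fun t => -I t, fun _ => 0],
      ![fun t => H t - B t, fun t => -A t, fun _ => 0, fun t => -I t],
      ![A, B, I, fun _ => 0], ![B, A, fun _ => 0, I]]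
  let f : Fin 4 → ℝ → ℝ := ![fun t => pm t - qm t, fun t => pp t - qp t, qm, qp]
  have hk : ∀ i j, IsVolterraKernel (k i j) := by
    intro i j
    fin_cases i <;> fin_cases j
    exacts [hA.neg, hH.sub hB, hI.neg, hZ, hH.sub hB, hA.neg, hZ, hI.neg, hA, hB, hI, hZ,
      hB, hA, hZ, hI]
  obtain ⟨C, hC0, hC⟩ := exists_abs_initialPotential_heatKx_zero_le
  have bpm : ∀ t > 0, |pm t| ≤ C := fun t _ => by
    rw [hpm]; simp only
    rw [abs_mul, abs_of_pos (by norm_num)]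
    linarith [hC w (fun z _ => hw z) t, abs_nonneg (initialPotential heatKx w t 0)]
  have bpp : ∀ t > 0, |pp t| ≤ C := fun t _ => by
    have e := initialPotential_reflect (w := w) (K := heatKx) (ε := -1)
      (fun t x => by rw [heatKx_neg]; ring) t 0
    rw [sub_zero] at e
    rw [hpp]; simp only
    rw [e, abs_mul, abs_mul, abs_neg, abs_neg, abs_one, one_mul, abs_of_pos (by norm_num)]
    linarith [hC (fun z => w (1 - z)) (fun z _ => hw _) t,
      abs_nonneg (initialPotential heatKx (fun z => w (1 - z)) t 0)]
  have bq : ∀ x v : ℝ, |v| ≤ 1 → ∀ t > 0,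
      |σ⁻¹ * (initialPotential (heatK 0) w t x - v)| ≤ σ⁻¹ * 4 := fun x v hv t ht => by
    rw [abs_mul, abs_of_pos (inv_pos.2 hσ)]
    gcongr
    have := abs_initialPotential_heatK_le (fun z _ => hw z) ht x
    exact (abs_sub _ _).trans (by linarith)
  have cq : ∀ x v : ℝ, ContinuousOn
      (fun t => σ⁻¹ * (initialPotential (heatK 0) w t x - v)) (Ioi 0) := fun x v =>
    continuousOn_const.mul ((continuousOn_initialPotential_time (isKernel_heatK 0) hwi x).sub
      continuousOn_const)
  have cp : ∀ c x : ℝ, ContinuousOn (fun t => c * initialPotential heatKx w t x) (Ioi 0) :=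
    fun c x => continuousOn_const.mul (continuousOn_initialPotential_time isKernel_heatKx hwi x)
  have hf : ∀ i, ContinuousOn (f i) (Ioi 0) := by
    intro i
    fin_cases i
    exacts [(cp _ _).sub (cq _ _), (cp _ _).sub (cq _ _), cq _ _, cq _ _]
  have hσ4 : 0 ≤ σ⁻¹ * 4 := by positivity
  have hfb : ∀ i, ∀ t > 0, |f i t| ≤ C + σ⁻¹ * 4 := by
    intro i t ht
    fin_cases i
    · exact (abs_sub _ _).trans (add_le_add (bpm t ht) (bq 0 vm hvm t ht))
    · exact (abs_sub _ _).trans (add_le_add (bpp t ht) (bq 1 vp hvp t ht))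
    · exact (bq 0 vm hvm t ht).trans (le_add_of_nonneg_left hC0)
    · exact (bq 1 vp hvp t ht).trans (le_add_of_nonneg_left hC0)
  obtain ⟨y, hy0, hyc, hym, ⟨D, L, hD, hL, hyb⟩, hy⟩ := exists_volterra_solution k
    (fun i j => (hk i j).zero) (fun i j => (hk i j).int) f hf (add_nonneg hC0 hσ4) hfb
  have hdens : ∀ i, IsDensity (y i) := fun i => ⟨hy0 i, hyc i, hym i, fun T =>
    ⟨D * Real.exp (L * T), by positivity, fun s hs => (hyb i s).trans (by gcongr)⟩⟩
  have y0 := fun t ht => hy 0 t ht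
  have y1 := fun t ht => hy 1 t ht
  have y2 := fun t ht => hy 2 t ht
  have y3 := fun t ht => hy 3 t ht
  simp only [Fin.sum_univ_four] at y0 y1 y2 y3
  set a := y 0
  set b := y 1
  set gm := y 2
  set gp := y 3
  have da : IsDensity a := hdens 0
  have db : IsDensity b := hdens 1
  have dm : IsDensity gm := hdens 2
  have dp : IsDensity gp := hdens 3
  have y0' : ∀ t > 0, a t = (pm t - qm t) + ((∫ s, -A (t - s) * a s) +
      (∫ s, (H (t - s) - B (t - s)) * b s) + (∫ s, -I (t - s) * gm s) + ∫ s, 0 * gp s) := y0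
  have y1' : ∀ t > 0, b t = (pp t - qp t) + ((∫ s, (H (t - s) - B (t - s)) * a s) +
      (∫ s, -A (t - s) * b s) + (∫ s, 0 * gm s) + ∫ s, -I (t - s) * gp s) := y1
  have y2' : ∀ t > 0, gm t = qm t + ((∫ s, A (t - s) * a s) +
      (∫ s, B (t - s) * b s) + (∫ s, I (t - s) * gm s) + ∫ s, 0 * gp s) := y2
  have y3' : ∀ t > 0, gp t = qp t + ((∫ s, B (t - s) * a s) +
      (∫ s, A (t - s) * b s) + (∫ s, 0 * gm s) + ∫ s, I (t - s) * gp s) := y3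
  have hsplit : ∀ y, IsDensity y → ∀ t, ∫ s, (H (t - s) - B (t - s)) * y s =
      (∫ s, H (t - s) * y s) - ∫ s, B (t - s) * y s := fun y hy t => by
    simp only [sub_mul]
    exact integral_sub (hH.integrable_mul hy t) (hB.integrable_mul hy t)
  simp only [neg_mul, integral_neg, zero_mul, integral_zero, add_zero, hsplit _ da, hsplit _ db]
    at y0' y1' y2' y3'
  have eA : ∀ y t, ∫ s, A (t - s) * y s = σ⁻¹ * (2 * layer (heatK 0) y t 0) := fun y t => by
    simp only [hAdef, layer, ← integral_const_mul]
    congr 1; ext s; ring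
  have eB : ∀ y t, ∫ s, B (t - s) * y s = σ⁻¹ * (2 * layer (heatK 0) y t 1) := fun y t => by
    simp only [hBdef, layer, ← integral_const_mul]
    congr 1; ext s; ring
  have eI : ∀ y, IsDensity y → ∀ t > 0,
      ∫ s, I (t - s) * y s = -σ⁻¹ * ∫ s in (0 : ℝ)..t, y s := fun y hy t ht => by
    rw [← integral_heaviside_mul hy ht, ← integral_const_mul]
    simp only [hIdef, mul_assoc]
  -- The right layer is evaluated at x - 1, that is at -1 on the left wall, whereas the kernel B
  -- uses distance 1. Evenness reconciles the two.
  have eneg : layer (heatK 0) b = fun t x => layer (heatK 0) b t (-x) := by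
    ext t x
    rw [layer_neg (ε := 1) (fun t x => by rw [heatK_neg, one_mul]), one_mul]
  refine ⟨a, b, gm, gp, da, db, dm, dp, fun t ht => ?_, fun t ht => ?_, fun t ht => ?_,
    fun t ht => ?_⟩
  · rw [y2' t ht, eA, eB, eI gm dm t ht, stripPotential, congrFun (congrFun eneg t) 1, zero_sub]
    simp only [hqm]
    ring
  · rw [y3' t ht, eA, eB, eI gp dp t ht, stripPotential, sub_self]
    simp only [hqp]
    ring
  -- Adding the row of a and the row of gm cancels qm and the A, B, I convolutions, which restores
  -- the flux condition.
  · change gm t = pm t - a t + ∫ s, H (t - s) * b s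
    linarith [y0' t ht, y2' t ht]
  · change gp t = pp t - b t + ∫ s, H (t - s) * a s
    linarith [y1' t ht, y3' t ht]

/-! ### Construction of the solution -/

theorem curvePotential_const_mul {K : ℝ → ℝ → ℝ} {s y f : ℝ → ℝ} {a b : ℝ} (c t x : ℝ) :
    curvePotential (fun t x => c * K t x) s y f a b t x = c * curvePotential K s y f a b t x := by
  simp only [curvePotential, mul_assoc]
  exact integral_const_mul _ _

theorem stripPotential_const_mul {K : ℝ → ℝ → ℝ} {w a b : ℝ → ℝ} (c t x : ℝ) :
    stripPotential (fun t x => c * K t x) w a b t x = c * stripPotential K w a b t x := by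
  have : ∀ a t x, layer (fun t x => c * K t x) a t x = c * layer K a t x := fun a t x => by
    simp only [layer, mul_assoc]
    exact integral_const_mul _ _
  simp only [stripPotential, initialPotential, curvePotential_const_mul, this]
  ring

theorem stripPotential_time_zero {K : ℝ → ℝ → ℝ} (hK : IsKernel K) {w a b : ℝ → ℝ}
    (ha : IsDensity a) (hb : IsDensity b) (x : ℝ) : stripPotential K w a b 0 x = 0 := by
  simp [stripPotential, initialPotential, curvePotential, layer_of_nonpos hK.zero ha le_rfl,
    layer_of_nonpos hK.zero hb le_rfl, hK.zero 0 le_rfl]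

theorem abs_stripPotential_heatK_le {w a b : ℝ → ℝ} (hw : ∀ z ∈ Ioo (0 : ℝ) 1, |w z| ≤ 1)
    (ha : IsDensity a) (hb : IsDensity b) {t M : ℝ} (hMa : ∀ s ≤ t, |a s| ≤ M)
    (hMb : ∀ s ≤ t, |b s| ≤ M) (ht : 0 < t) (x : ℝ) :
    |stripPotential (heatK 0) w a b t x| ≤
      3 + 4 * ((∫ τ, Real.exp (-τ) * heatK 0 τ 0) * (Real.exp t * M)) := by
  have h1 := abs_initialPotential_heatK_le hw ht x
  have h2 := abs_layer_heatK_le ha hMa x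
  have h3 := abs_layer_heatK_le hb hMb (x - 1)
  refine (abs_add_three _ _ _).trans ?_
  rw [abs_mul, abs_mul, abs_two]
  linarith

/-- The initial part has the parabolic size t^{-1/2} and each layer is bounded by its density,
uniformly in x. This is integrable down to t = 0 and dominates the time-integrated flux. -/
theorem abs_stripPotential_heatKx_le {w a b : ℝ → ℝ} (hw : ∀ z ∈ Ioo (0 : ℝ) 1, |w z| ≤ 1)
    {t M : ℝ} (hMa : ∀ s ≤ t, |a s| ≤ M) (hMb : ∀ s ≤ t, |b s| ≤ M)
    (ht : 0 < t) {x : ℝ} (hx : x ∈ Ioo (0 : ℝ) 1) :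
    |stripPotential heatKx w a b t x| ≤ 3 * (∫ z, |heatKx 1 z|) * (√t)⁻¹ + 4 * M := by
  have h1 := abs_initialPotential_heatKx_le hw ht x
  have h2 := abs_layer_heatKx_le hMa hx.1
  have h3 := abs_layer_heatKx_le hMb (x := 1 - x) (by linarith [hx.2])
  have h4 : layer heatKx b t (x - 1) = -1 * layer heatKx b t (1 - x) := by
    rw [← layer_neg (fun t x => by rw [heatKx_neg]; ring), neg_sub]
  refine (abs_add_three _ _ _).trans ?_
  rw [abs_mul, abs_mul, abs_two, h4, abs_mul, abs_neg, abs_one, one_mul]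
  linarith

theorem tendsto_one_sub_nhdsLT : Tendsto (fun r : ℝ => 1 - r) (𝓝[<] 1) (𝓝[>] 0) := by
  refine tendsto_nhdsWithin_iff.2 ⟨tendsto_nhdsWithin_of_tendsto_nhds
    (Continuous.tendsto' (by fun_prop) _ _ (by simp)), ?_⟩
  filter_upwards [self_mem_nhdsWithin] with r hr
  have : r < 1 := hr
  simpa using this

theorem hasDerivAt_primitive_of_isDensity {g : ℝ → ℝ} (hg : IsDensity g) (v : ℝ) {t : ℝ}
    (ht : 0 < t) : HasDerivAt (fun t => v + ∫ s in (0 : ℝ)..t, g s) (g t) t :=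
  (intervalIntegral.integral_hasDerivAt_right (hg.intervalIntegrable 0 t)
    (hg.cont.stronglyMeasurableAtFilter isOpen_Ioi t ht) (hg.continuousAt ht.ne')).const_add v

theorem continuous_primitive_of_isDensity {g : ℝ → ℝ} (hg : IsDensity g) (v : ℝ) :
    Continuous fun t => v + ∫ s in (0 : ℝ)..t, g s :=
  continuous_const.add (intervalIntegral.continuous_primitive hg.intervalIntegrable 0)

theorem isClassH_primitive_of_isDensity {g : ℝ → ℝ} (hg : IsDensity g) (v : ℝ) :
    IsClassH fun t => v + ∫ s in (0 : ℝ)..t, g s := by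
  have hd := fun t (ht : t ∈ Ioi (0 : ℝ)) => hasDerivAt_primitive_of_isDensity hg v ht
  refine ⟨?_, (continuous_primitive_of_isDensity hg v).continuousOn⟩
  rw [contDiffOn_one_iff_derivWithin isOpen_Ioi.uniqueDiffOn]
  refine ⟨fun t ht => (hd t ht).differentiableAt.differentiableWithinAt, hg.cont.congr ?_⟩
  intro t ht
  rw [derivWithin_of_isOpen isOpen_Ioi ht, (hd t ht).deriv]

theorem intervalIntegrable_inv_sqrt (a b : ℝ) :
    IntervalIntegrable (fun s : ℝ => (√s)⁻¹) volume a b := by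
  have hpos : ∀ c : ℝ, 0 ≤ c → IntervalIntegrable (fun s : ℝ => (√s)⁻¹) volume 0 c := fun c hc => by
    refine (intervalIntegral.intervalIntegrable_rpow' (r := -(1 / 2)) (by norm_num)).congr ?_
    intro s hs
    rw [uIoc_of_le hc] at hs
    simp only
    rw [Real.rpow_neg hs.1.le, Real.sqrt_eq_rpow]
  have hneg : ∀ c : ℝ, c ≤ 0 → IntervalIntegrable (fun s : ℝ => (√s)⁻¹) volume 0 c := fun c hc => by
    refine (intervalIntegrable_const (c := (0 : ℝ))).congr ?_
    intro s hs
    rw [uIoc_of_ge hc] at hs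
    simp [Real.sqrt_eq_zero_of_nonpos hs.2]
  have h : ∀ c : ℝ, IntervalIntegrable (fun s : ℝ => (√s)⁻¹) volume 0 c := fun c =>
    (le_total 0 c).elim (hpos c) (hneg c)
  exact (h a).symm.trans (h b)

/-- Passage to the boundary in the time-integrated flux. -/
theorem hasWeakFlux_of_dominated {u ux : ℝ → ℝ → ℝ} {g bound : ℝ → ℝ} {F : Filter ℝ}
    [F.IsCountablyGenerated] {t : ℝ} (ht : 0 < t) (hF : ∀ᶠ l in F, l ∈ Ioo (0 : ℝ) 1)
    (hd : ∀ r ∈ Ioo (0 : ℝ) 1, ∀ s > 0, HasDerivAt (fun x => u x s) (ux r s) r)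
    (hc : ContinuousOn (fun p : ℝ × ℝ => ux p.1 p.2) (Ioo 0 1 ×ˢ Ioi 0))
    (hb : ∀ r ∈ Ioo (0 : ℝ) 1, ∀ s ∈ Ioc 0 t, |ux r s| ≤ bound s)
    (hbi : IntervalIntegrable bound volume 0 t)
    (hg : ∀ s > 0, Tendsto (fun r => 1 / 2 * ux r s) F (𝓝 (g s))) :
    HasWeakFlux u F t (∫ s in (0 : ℝ)..t, g s) := by
  have hm : ∀ r ∈ Ioo (0 : ℝ) 1, AEStronglyMeasurable (fun s => 1 / 2 * ux r s)
      (volume.restrict (Ioc 0 t)) := fun r hr =>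
    ((continuousOn_const.mul (continuousOn_slice_right hr hc)).mono
      fun s hs => hs.1).aestronglyMeasurable measurableSet_Ioc
  have hn : ∀ r ∈ Ioo (0 : ℝ) 1, ∀ s ∈ Ioc 0 t, ‖1 / 2 * ux r s‖ ≤ bound s := fun r hr s hs => by
    rw [norm_mul, Real.norm_of_nonneg (by norm_num), Real.norm_eq_abs]
    linarith [hb r hr s hs, abs_nonneg (ux r s)]
  have hi : ∀ r ∈ Ioo (0 : ℝ) 1, IntervalIntegrable (fun s => 1 / 2 * ux r s) volume 0 t :=
    fun r hr => by
      rw [intervalIntegrable_iff_integrableOn_Ioc_of_le ht.le] at hbi ⊢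
      exact Integrable.mono' hbi (hm r hr)
        ((ae_restrict_iff' measurableSet_Ioc).2 (Eventually.of_forall (hn r hr)))
  refine ⟨fun l => ∫ s in (0 : ℝ)..t, 1 / 2 * ux l s, ?_, ?_⟩
  · filter_upwards [hF] with l hl
    have hprim := intervalIntegral.continuousOn_primitive_interval' (μ := volume) (hi l hl)
      (a := t) right_mem_uIcc
    rw [uIcc_of_le ht.le] at hprim
    have := ((hprim 0 (left_mem_Icc.2 ht.le)).mono_of_mem_nhdsWithin
      (Icc_mem_nhdsGT ht)).tendsto.neg
    rw [← intervalIntegral.integral_symm] at this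
    refine this.congr' ?_
    filter_upwards [Ioc_mem_nhdsGT ht] with t₀ ht₀
    rw [← intervalIntegral.integral_symm]
    refine intervalIntegral.integral_congr fun s hs => ?_
    rw [uIcc_of_le ht₀.2] at hs
    rw [(hd l hl s (ht₀.1.trans_le hs.1)).deriv]
  · refine intervalIntegral.tendsto_integral_filter_of_dominated_convergence bound ?_ ?_ hbi ?_
    · filter_upwards [hF] with r hr
      rw [uIoc_of_le ht.le]
      exact hm r hr
    · filter_upwards [hF] with r hr
      refine Eventually.of_forall fun s hs => ?_
      rw [uIoc_of_le ht.le] at hs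
      exact hn r hr s hs
    · refine Eventually.of_forall fun s hs => ?_
      rw [uIoc_of_le ht.le] at hs
      exact hg s hs.1

/-- The Volterra densities turn the strip potential into a solution with flux regular up to the
walls. The invariance of [0,1] then upgrades its local-in-time bounds to a global one. -/
theorem exists_isSolution {σ : ℝ} (hσ : 0 < σ) {u₀ : ℝ → ℝ} (hu₀ : ContinuousOn u₀ (Ioo 0 1))
    (hu₀_mem : ∀ r ∈ Ioo (0 : ℝ) 1, u₀ r ∈ Icc (0 : ℝ) 1) {vm vp : ℝ}
    (hvm : vm ∈ Icc (0 : ℝ) 1) (hvp : vp ∈ Icc (0 : ℝ) 1) :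
    ∃ (u : ℝ → ℝ → ℝ) (ρm ρp : ℝ → ℝ), IsSolution σ u₀ vm vp u ρm ρp := by
  set w : ℝ → ℝ := (Ioo (0 : ℝ) 1).indicator u₀ with hwdef
  have hw_in : ∀ z ∈ Ioo (0 : ℝ) 1, w z = u₀ z := fun z hz => indicator_of_mem hz _
  have hw_out : ∀ z ∉ Ioo (0 : ℝ) 1, w z = 0 := fun z hz => indicator_of_notMem hz _
  have hwm : Measurable w := by
    refine measurable_of_restrict_of_restrict_compl (s := Ioo (0 : ℝ) 1) measurableSet_Ioo ?_ ?_
    · have : (Ioo (0 : ℝ) 1).domRestrict w = (Ioo (0 : ℝ) 1).domRestrict u₀ := by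
        funext z; exact hw_in z z.2
      rw [this]
      exact (continuousOn_iff_continuous_domRestrict.1 hu₀).measurable
    · have : (Ioo (0 : ℝ) 1)ᶜ.domRestrict w = fun _ => 0 := by
        funext z; exact hw_out z z.2
      rw [this]
      exact measurable_const
  have hw1 : ∀ z, |w z| ≤ 1 := fun z => by
    by_cases hz : z ∈ Ioo (0 : ℝ) 1
    · rw [hw_in z hz, abs_of_nonneg (hu₀_mem z hz).1]
      exact (hu₀_mem z hz).2
    · rw [hw_out z hz]; simp
  have hw1' : ∀ z ∈ Ioo (0 : ℝ) 1, |w z| ≤ 1 := fun z _ => hw1 z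
  have hwi : ∀ w : ℝ → ℝ, Measurable w → (∀ z, |w z| ≤ 1) → IntegrableOn w (Ioo 0 1) :=
    fun w hwm hw1 => Measure.integrableOn_of_bounded (M := 1) (by simp) hwm.aestronglyMeasurable
      (Eventually.of_forall hw1)
  have hwI := hwi w hwm hw1
  have hwI' := hwi (fun z => w (1 - z)) (hwm.comp (by fun_prop)) (fun z => hw1 _)
  have hv1 : ∀ v ∈ Icc (0 : ℝ) 1, |v| ≤ 1 := fun v hv => abs_le.2 ⟨by linarith [hv.1], hv.2⟩
  obtain ⟨a, b, gm, gp, da, db, dm, dp, egm, egp, efm, efp⟩ :=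
    exists_boundary_densities hσ hwm hw1 (hv1 vm hvm) (hv1 vp hvp)
  set u : ℝ → ℝ → ℝ := fun r t => stripPotential (heatK 0) w a b t r with hu
  set ux : ℝ → ℝ → ℝ := fun r t => stripPotential heatKx w a b t r with hux
  set uxx : ℝ → ℝ → ℝ := fun r t => stripPotential heatKxx w a b t r with huxx
  set ρm : ℝ → ℝ := fun t => vm + ∫ s in (0 : ℝ)..t, gm s with hρm
  set ρp : ℝ → ℝ := fun t => vp + ∫ s in (0 : ℝ)..t, gp s with hρp
  have hcont : ∀ K, IsKernel K → ContinuousOn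
      (fun p : ℝ × ℝ => stripPotential K w a b p.2 p.1) (Ioo 0 1 ×ˢ Ioi 0) := fun K hK p hp =>
    (ContinuousAt.comp (g := fun q : ℝ × ℝ => stripPotential K w a b q.1 q.2)
      (f := fun p : ℝ × ℝ => (p.2, p.1)) (x := p)
      (continuousAt_stripPotential hK hwI da db (p := (p.2, p.1)) (ne_of_gt hp.2) hp.1)
      (by fun_prop)).continuousWithinAt
  have heven : ∀ t x, heatK 0 t (-x) = 1 * heatK 0 t x := fun t x => by rw [heatK_neg, one_mul]
  have hodd : ∀ t x, heatKx t (-x) = -1 * heatKx t x := fun t x => by rw [heatKx_neg]; ring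
  have hreg : IsRegularSolution σ u₀ vm vp u ux uxx (u 0) (u 1) gm gp ρm ρp :=
    { cont := hcont _ (isKernel_heatK 0)
      cont_x := hcont _ isKernel_heatKx
      cont_xx := hcont _ isKernel_heatKxx
      deriv_x := fun r hr t ht => hasDerivAt_stripPotential_right (isKernel_heatK 0)
        isKernel_heatKx hasDerivAt_heatK_zero_right hwI da db ht.ne' hr
      deriv_xx := fun r hr t ht => hasDerivAt_stripPotential_right isKernel_heatKx
        isKernel_heatKxx hasDerivAt_heatKx hwI da db ht.ne' hr
      deriv_t := fun r hr t ht => by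
        refine (hasDerivAt_stripPotential_left (isKernel_heatK 0)
          (isKernel_heatKxx.const_mul (1 / 2)) (fun t x h => hasDerivAt_heatK_left h) hwI da db
          ht.ne' hr).congr_deriv ?_
        rw [stripPotential_const_mul]
      bdd := fun T => by
        obtain ⟨Ma, hMa0, hMa⟩ := da.bdd T
        obtain ⟨Mb, hMb0, hMb⟩ := db.bdd T
        refine ⟨3 + 4 * ((∫ τ, Real.exp (-τ) * heatK 0 τ 0) * (Real.exp T * (Ma + Mb))),
          fun r _ t ht => ?_⟩
        refine (abs_stripPotential_heatK_le hw1' da db (M := Ma + Mb)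
          (fun s hs => (hMa s (hs.trans ht.2)).trans (le_add_of_nonneg_right hMb0))
          (fun s hs => (hMb s (hs.trans ht.2)).trans (le_add_of_nonneg_left hMa0)) ht.1 r).trans ?_
        have h0 : 0 ≤ ∫ τ, Real.exp (-τ) * heatK 0 τ 0 := integral_nonneg fun τ =>
          mul_nonneg (Real.exp_pos _).le (heatK_nonneg _ _ _)
        have := ht.2
        gcongr
      bdd_x := fun t₀ ht₀ T => by
        obtain ⟨Ma, hMa0, hMa⟩ := da.bdd T
        obtain ⟨Mb, hMb0, hMb⟩ := db.bdd T
        refine ⟨3 * (∫ z, |heatKx 1 z|) * (√t₀)⁻¹ + 4 * (Ma + Mb), fun r hr t ht => ?_⟩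
        refine (abs_stripPotential_heatKx_le hw1' (M := Ma + Mb)
          (fun s hs => (hMa s (hs.trans ht.2)).trans (le_add_of_nonneg_right hMb0))
          (fun s hs => (hMb s (hs.trans ht.2)).trans (le_add_of_nonneg_left hMa0))
          (ht₀.trans_le ht.1) hr).trans ?_
        have h0 : 0 ≤ ∫ z, |heatKx 1 z| := integral_nonneg fun τ => abs_nonneg _
        have := Real.sqrt_pos.2 ht₀
        have := ht.1
        gcongr
      left := fun t ht => tendsto_stripPotential_left hwI da db ht
      right := fun t ht => by
        have h1 := (tendsto_stripPotential_left hwI' db da ht).comp tendsto_one_sub_nhdsLT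
        have h2 := stripPotential_reflect (w := w) (a := a) (b := b) heven t
        have h3 : u 1 t = stripPotential (heatK 0) (fun z => w (1 - z)) b a t 0 := by
          have := h2 0
          rwa [sub_zero, one_mul] at this
        rw [h3]
        refine h1.congr fun r => ?_
        have := h2 (1 - r)
        rw [sub_sub_cancel, one_mul] at this
        exact this.symm
      flux_left := fun t ht => by
        have h1 := (tendsto_stripPotential_heatKx_left hwI da db ht).const_mul (1 / 2)
        rw [efm t ht]
        convert h1 using 2
        ring
      flux_right := fun t ht => by
        have h1 := ((tendsto_stripPotential_heatKx_left hwI' db da ht).comp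
          tendsto_one_sub_nhdsLT).const_mul (-(1 / 2))
        have h2 := initialPotential_reflect (w := w) hodd t 0
        rw [sub_zero] at h2
        rw [efp t ht, h2]
        refine (h1.congr fun r => ?_).trans_eq ?_
        · have := stripPotential_reflect (w := w) (a := a) (b := b) hodd t (1 - r)
          rw [sub_sub_cancel] at this
          simp only [hux, this, Function.comp_apply]
          ring
        · congr 1; ring
      initial := fun r hr => by
        have hc : ContinuousAt w r := by
          refine (hu₀.continuousAt (Ioo_mem_nhds hr.1 hr.2)).congr ?_
          filter_upwards [Ioo_mem_nhds hr.1 hr.2] with z hz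
          exact (hw_in z hz).symm
        rw [← hw_in r hr]
        exact tendsto_stripPotential_zero hwm hw1 hw_out da db hr hc
      cont_gm := dm.cont
      cont_gp := dp.cont
      gm_eq := egm
      gp_eq := egp
      deriv_m := fun t ht => hasDerivAt_primitive_of_isDensity dm vm ht
      deriv_p := fun t ht => hasDerivAt_primitive_of_isDensity dp vp ht
      init_m := tendsto_nhdsWithin_of_tendsto_nhds
        ((continuous_primitive_of_isDensity dm vm).tendsto' _ _ (by simp))
      init_p := tendsto_nhdsWithin_of_tendsto_nhds
        ((continuous_primitive_of_isDensity dp vp).tendsto' _ _ (by simp)) }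
  -- The potential estimates grow with time; the global bound and the range of the boundary values
  -- both rest on this step.
  have hu_mem : ∀ r ∈ Ioo (0 : ℝ) 1, ∀ t > 0, u r t ∈ Icc (0 : ℝ) 1 := fun r hr t ht =>
    ⟨hreg.nonneg hσ (fun r hr => (hu₀_mem r hr).1) hvm.1 hvp.1 r hr t ht, by
      have := hreg.one_sub.nonneg hσ (fun r hr => sub_nonneg.2 (hu₀_mem r hr).2)
        (sub_nonneg.2 hvm.2) (sub_nonneg.2 hvp.2) r hr t ht
      linarith⟩
  -- The boundary values are also required to lie in [0,1] at t = 0, where causality makes the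
  -- potential zero.
  have hzero : ∀ x, u x 0 = 0 := fun x => stripPotential_time_zero (isKernel_heatK 0) da db x
  have hflux_bound : ∀ t > 0, ∃ c M : ℝ, ∀ r ∈ Ioo (0 : ℝ) 1, ∀ s ∈ Ioc 0 t,
      |ux r s| ≤ c * (√s)⁻¹ + M := fun t ht => by
    obtain ⟨Ma, hMa0, hMa⟩ := da.bdd t
    obtain ⟨Mb, hMb0, hMb⟩ := db.bdd t
    exact ⟨3 * (∫ z, |heatKx 1 z|), 4 * (Ma + Mb), fun r hr s hs =>
      abs_stripPotential_heatKx_le hw1' (M := Ma + Mb)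
        (fun s' hs' => (hMa s' (hs'.trans hs.2)).trans (le_add_of_nonneg_right hMb0))
        (fun s' hs' => (hMb s' (hs'.trans hs.2)).trans (le_add_of_nonneg_left hMa0)) hs.1 hr⟩
  -- Boundary values are recovered from the relaxation law as σg + ρ, which is continuous without
  -- further study of the potentials along the walls.
  have hbcont : ∀ {β g ρ : ℝ → ℝ}, (∀ t > 0, g t = σ⁻¹ * (β t - ρ t)) → IsDensity g →
      Continuous ρ → ContinuousOn β (Ioi 0) := fun {β g ρ} hβ hg hρ => by
    refine ((continuousOn_const (c := σ)).mul hg.cont |>.add hρ.continuousOn).congr fun t ht => ?_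
    simp only [Pi.add_apply, Pi.mul_apply]
    rw [hβ t ht, mul_inv_cancel_left₀ hσ.ne']
    ring
  refine ⟨u, ρm, ρp,
    { mem_U :=
        { continuousOn := hreg.cont
          differentiableAt_r := fun r hr t ht => (hreg.deriv_x r hr t ht).differentiableAt
          differentiableAt_rr := ?_
          differentiableAt_t := fun r hr t ht => (hreg.deriv_t r hr t ht).differentiableAt
          continuousOn_r := hreg.cont_x.congr fun p hp => (hreg.deriv_x _ hp.1 _ hp.2).deriv
          continuousOn_rr := hreg.cont_xx.congr fun p hp => ?_
          continuousOn_t := (continuousOn_const.mul hreg.cont_xx).congr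
            fun p hp => (hreg.deriv_t _ hp.1 _ hp.2).deriv }
      mem_H_left := isClassH_primitive_of_isDensity dm vm
      mem_H_right := isClassH_primitive_of_isDensity dp vp
      bounded := ⟨1, fun r hr t ht => abs_le.2
        ⟨by linarith [(hu_mem r hr t ht).1], (hu_mem r hr t ht).2⟩⟩
      boundary_left := hreg.left
      boundary_right := hreg.right
      boundary_left_mem := fun t ht => ?_
      boundary_right_mem := fun t ht => ?_
      boundary_left_cont := hbcont egm dm (continuous_primitive_of_isDensity dm vm)
      boundary_right_cont := hbcont egp dp (continuous_primitive_of_isDensity dp vp)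
      heat := fun r hr t ht => ?_
      initial := hreg.initial
      reservoir_left_zero := by simp [hρm]
      reservoir_right_zero := by simp [hρp]
      ode_left := fun t ht => (hreg.deriv_m t ht).congr_deriv (egm t ht)
      ode_right := fun t ht => (hreg.deriv_p t ht).congr_deriv (egp t ht)
      flux_left := fun t ht => ?_
      flux_right := fun t ht => ?_ }⟩
  · intro r hr t ht
    refine ((hreg.deriv_xx r hr t ht).congr_of_eventuallyEq ?_).differentiableAt
    filter_upwards [Ioo_mem_nhds hr.1 hr.2] with y hy
    exact (hreg.deriv_x y hy t ht).deriv
  · refine ((hreg.deriv_xx _ hp.1 _ hp.2).congr_of_eventuallyEq ?_).deriv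
    filter_upwards [Ioo_mem_nhds hp.1.1 hp.1.2] with y hy
    exact (hreg.deriv_x y hy _ hp.2).deriv
  · rcases eq_or_lt_of_le (show (0 : ℝ) ≤ t from ht) with rfl | ht
    · rw [hzero]; simp
    · refine isClosed_Icc.mem_of_tendsto (hreg.left t ht) ?_
      filter_upwards [Ioo_mem_nhdsGT (show (0 : ℝ) < 1 from one_pos)] with r hr
      exact hu_mem r hr t ht
  · rcases eq_or_lt_of_le (show (0 : ℝ) ≤ t from ht) with rfl | ht
    · rw [hzero]; simp
    · refine isClosed_Icc.mem_of_tendsto (hreg.right t ht) ?_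
      filter_upwards [Ioo_mem_nhdsLT (show (0 : ℝ) < 1 from one_pos)] with r hr
      exact hu_mem r hr t ht
  · rw [(hreg.deriv_t r hr t ht).deriv]
    congr 1
    symm
    refine ((hreg.deriv_xx r hr t ht).congr_of_eventuallyEq ?_).deriv
    filter_upwards [Ioo_mem_nhds hr.1 hr.2] with y hy
    exact (hreg.deriv_x y hy t ht).deriv
  · obtain ⟨c, M, hcM⟩ := hflux_bound t ht
    refine ⟨_, hasWeakFlux_of_dominated ht (Ioo_mem_nhdsGT one_pos) hreg.deriv_x hreg.cont_x hcM
      (((intervalIntegrable_inv_sqrt 0 t).const_mul c).add intervalIntegrable_const)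
      hreg.flux_left, ?_⟩
    simp [hρm]
  · obtain ⟨c, M, hcM⟩ := hflux_bound t ht
    refine ⟨_, hasWeakFlux_of_dominated ht (Ioo_mem_nhdsLT one_pos) hreg.deriv_x hreg.cont_x hcM
      (((intervalIntegrable_inv_sqrt 0 t).const_mul c).add intervalIntegrable_const)
      hreg.flux_right, ?_⟩
    simp [hρp]

/-! ### Existence and uniqueness combined -/

theorem theorem1 (σ : ℝ) (hσ : 0 < σ) (u₀ : ℝ → ℝ)
    (hu₀ : ContinuousOn u₀ (Set.Ioo 0 1))
    (hu₀_mem : ∀ r ∈ Set.Ioo (0 : ℝ) 1, u₀ r ∈ Set.Icc (0 : ℝ) 1)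
    (vm vp : ℝ) (hvm : vm ∈ Set.Icc (0 : ℝ) 1) (hvp : vp ∈ Set.Icc (0 : ℝ) 1) :
    ∃ (u : ℝ → ℝ → ℝ) (ρm ρp : ℝ → ℝ), IsSolution σ u₀ vm vp u ρm ρp ∧
      ∀ (u' : ℝ → ℝ → ℝ) (ρm' ρp' : ℝ → ℝ), IsSolution σ u₀ vm vp u' ρm' ρp' →
        (∀ r ∈ Set.Icc (0 : ℝ) 1, ∀ t ∈ Set.Ioi (0 : ℝ), u' r t = u r t) ∧
        (∀ t ∈ Set.Ici (0 : ℝ), ρm' t = ρm t) ∧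
        (∀ t ∈ Set.Ici (0 : ℝ), ρp' t = ρp t) := by
  obtain ⟨u, ρm, ρp, h⟩ := exists_isSolution hσ hu₀ hu₀_mem hvm hvp
  refine ⟨u, ρm, ρp, h, fun u' ρm' ρp' h' => ?_⟩
  have hnull := h.isNullSolution_sub h'
  have hint : ∀ r ∈ Ioo (0 : ℝ) 1, ∀ t > 0, u' r t = u r t := fun r hr t ht =>
    sub_eq_zero.1 (hnull.eq_zero hσ hr ht)
  refine ⟨fun r hr t ht => ?_, fun t ht => ?_, fun t ht => ?_⟩
  · rcases eq_or_lt_of_le hr.1 with rfl | h0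
    · refine tendsto_nhds_unique (h'.boundary_left t ht) ((h.boundary_left t ht).congr' ?_)
      filter_upwards [Ioo_mem_nhdsGT (show (0 : ℝ) < 1 from one_pos)] with y hy
      exact (hint y hy t ht).symm
    · rcases eq_or_lt_of_le hr.2 with rfl | h1
      · refine tendsto_nhds_unique (h'.boundary_right t ht) ((h.boundary_right t ht).congr' ?_)
        filter_upwards [Ioo_mem_nhdsLT (show (0 : ℝ) < 1 from one_pos)] with y hy
        exact (hint y hy t ht).symm
      · exact hint r ⟨h0, h1⟩ t ht
  · rcases eq_or_lt_of_le (show (0 : ℝ) ≤ t from ht) with rfl | ht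
    · rw [h.reservoir_left_zero, h'.reservoir_left_zero]
    · exact sub_eq_zero.1 (hnull.reservoir_left_eq_zero hσ ht)
  · rcases eq_or_lt_of_le (show (0 : ℝ) ≤ t from ht) with rfl | ht
    · rw [h.reservoir_right_zero, h'.reservoir_right_zero]
    · exact sub_eq_zero.1 (hnull.reservoir_right_eq_zero hσ ht)
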